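/- Let $k$ be a commutative ring. All algebras are associative unital $k$-algebras, all bimodules are $k$-symmetric. **Bimodules.** For $k$-algebras $R,S$ consider bimodules $X$ over $R^{o}\otimes_k S$, i.e. $k$-modules with commuting left and right $R^{o}\otimes S$-actions. By the right action $X$ is a left $R$-module $X^{R^o}$ and a right $S$-module $X^S$; the tensor product $X\otimes_S Y$ (for $Y$ a bimodule over $S^o\otimes T$) is taken with respect to $X^S$ and $Y^{S^o}$. Put $$X\times_S Y=\Big\{\sum_i x_i\otimes y_i\in X\otimes_S Y:\ \sum_i (1\otimes s)x_i\otimes y_i=\sum_i x_i\otimes (s\otimes 1)y_i\ \ \forall s\in S\Big\},$$ a bimodule over $R^o\otimes T$, where the left actions of $R^o\otimes S$ on $X$ and of $S^o\otimes T$ on $Y$ are used, and let $X\times_S Y\times_T Z\subseteq X\otimes_S Y\otimes_T Z$ be defined by the two analogous conditions, for $S$ and for $T$. The module $\mathrm{Hom}_k(R,R)$ is a bimodule over $R^o\otimes R$, with $((a\otimes b)f)(x)=f(axb)$ and $(f(a\otimes b))(x)=af(x)b$. **Coalgebroids and comodules.** A coalgebroid $(A,R)$ is a $k$-algebra $R$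 and a bimodule $A$ over $R^o\otimes R$ with bimodule maps $\Delta:A\to A\times_R A$ and $\varepsilon:A\to \mathrm{Hom}_k(R,R)$ such that $\Delta$ is coassociative in $A\otimes_R A\otimes_R A$ and, for $\Delta(a)=\sum a_1\otimes a_2$, $\sum\varepsilon(a_1)(1)\,a_2=a=\sum a_1\,\varepsilon(a_2)(1)$. A comodule $M$ from $(A,R)$ to $(A',R')$ is a bimodule over $R^o\otimes R'$ with a bimodule map $\alpha:M\to A\times_R M\times_{R'}A'$, $m\mapsto\sum a\otimes n\otimes a'$, such that $(1\otimes\alpha\otimes1)\alpha=(\Delta\otimes1\otimes\Delta')\alpha$ in $A\otimes_R A\otimes_R M\otimes_{R'}A'\otimes_{R'}A'$ and $\sum\varepsilon(a)(1)\,n\,\varepsilon'(a')(1)=m$. Comodule maps are the bimodule maps that commute with the coactions. Applying $\varepsilon'(-)(1)$, respectively $\varepsilon(-)(1)$, to $\alpha$ gives the left coaction $\alpha_l:M\to A\times_R M$ and the right coaction $\alpha_r:M\to M\times_{R'}A'$. **Hypotheses.** A ring is hereditary if submodules of projective left modules and of projective right modules are projective. A module is a union of projectives if it is the union of a directed family of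 projective submodules. Consider the coalgebroids $(A,R)$ with $R$ hereditary and with $A^{R}$ and $A^{R^o}$ unions of projectives and, between such coalgebroids $(A,R)$ and $(A',R')$, the comodules $M$ with $M^{R'}$ and $M^{R^o}$ unions of projectives. **Theorem.** These coalgebroids (objects), comodules ($1$-cells) and comodule maps ($2$-cells) form a bicategory, in which the composite of $M_1:(A_1,R_1)\to(A_2,R_2)$ and $M_2:(A_2,R_2)\to(A_3,R_3)$ is the equalizer $$M_1\bullet M_2\longrightarrow M_1\times_{R_2}M_2\rightrightarrows M_1\times_{R_2}A_2\times_{R_2}M_2$$ of the maps induced by $\alpha_l$ of $M_2$ and by $\alpha_r$ of $M_1$. The coaction of $M_1\bullet M_2$ is induced by $\alpha_l$ of $M_1$ and $\alpha_r$ of $M_2$; the horizontal composite of $2$-cells $f,g$ is induced by $f\otimes g$; the identity $1$-cell of $(A,R)$ is $A$ with coaction $a\mapsto\sum a_1\otimes a_2\otimes a_3$; the associativity isomorphisms are induced by those of the tensor product, and the unit isomorphisms are the inverses of $\alpha_l:M\to A\bullet M$ and $\alpha_r:M\to M\bullet A'$. -/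

import Mathlib

open CategoryTheory MulOpposite
open scoped TensorProduct

universe w u

namespace Coalgebroids

/-! ### Bimodules and their tensor product over a noncommutative algebra -/

/-- An `R`-`S`-bimodule over `k`: a `k`-module with a left `R`-action `l` and a right `S`-action `r`
(written as an action of `Sᵐᵒᵖ`) which commute. -/
structure Bim (k : Type w) [CommRing k] (R : Type u) [Ring R] [Algebra k R]
    (S : Type u) [Ring S] [Algebra k S] where
  carrier : Type u
  [addCommGroup : AddCommGroup carrier]
  [module : Module k carrier]
  l : R →ₐ[k] Module.End k carrier
  r : Sᵐᵒᵖ →ₐ[k] Module.End k carrier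
  l_r : ∀ a b x, l a (r b x) = r b (l a x)

attribute [instance] Bim.addCommGroup Bim.module

variable {k : Type w} [CommRing k] {R : Type u} [Ring R] [Algebra k R]
  {S : Type u} [Ring S] [Algebra k S] {T : Type u} [Ring T] [Algebra k T]
  {U : Type u} [Ring U] [Algebra k U]

/-- Homomorphisms of bimodules. -/
@[ext]
structure Bim.Hom (X Y : Bim k R S) where
  lin : X.carrier →ₗ[k] Y.carrier
  map_l : ∀ a x, lin (X.l a x) = Y.l a (lin x)
  map_r : ∀ b x, lin (X.r b x) = Y.r b (lin x)

/-- The identity homomorphism. -/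
def Bim.Hom.id (X : Bim k R S) : X.Hom X where
  lin := LinearMap.id
  map_l _ _ := rfl
  map_r _ _ := rfl

/-- Composition, in diagrammatic order: first `f`, then `g`. -/
def Bim.Hom.comp {X Y Z : Bim k R S} (f : X.Hom Y) (g : Y.Hom Z) : X.Hom Z where
  lin := g.lin ∘ₗ f.lin
  map_l a x := by simp [f.map_l, g.map_l]
  map_r a x := by simp [f.map_r, g.map_r]

/-- The relations `x s ⊗ y = x ⊗ s y`. -/
def balRel (X : Bim k R S) (Y : Bim k S T) : Submodule k (X.carrier ⊗[k] Y.carrier) :=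
  Submodule.span k (Set.range fun p : S × X.carrier × Y.carrier =>
    X.r (op p.1) p.2.1 ⊗ₜ[k] p.2.2 - p.2.1 ⊗ₜ[k] Y.l p.1 p.2.2)

/-- The `k`-module `X ⊗_S Y`. -/
abbrev Ten (X : Bim k R S) (Y : Bim k S T) : Type u :=
  (X.carrier ⊗[k] Y.carrier) ⧸ balRel X Y

/-- The class of `x ⊗ y` in `X ⊗_S Y`. -/
def tmk (X : Bim k R S) (Y : Bim k S T) (x : X.carrier) (y : Y.carrier) : Ten X Y :=
  (balRel X Y).mkQ (x ⊗ₜ[k] y)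

theorem tmk_bal (X : Bim k R S) (Y : Bim k S T) (s : S) (x : X.carrier) (y : Y.carrier) :
    tmk X Y (X.r (op s) x) y = tmk X Y x (Y.l s y) := by
  refine (Submodule.Quotient.eq _).2 (Submodule.subset_span ⟨(s, x, y), rfl⟩)

/-- The linear map out of `X ⊗_S Y` given by a balanced bilinear map. -/
def tlift {X : Bim k R S} {Y : Bim k S T} {P : Type u} [AddCommGroup P] [Module k P]
    (f : X.carrier →ₗ[k] Y.carrier →ₗ[k] P)
    (hf : ∀ (s : S) x y, f (X.r (op s) x) y = f x (Y.l s y)) : Ten X Y →ₗ[k] P :=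
  (balRel X Y).liftQ (TensorProduct.lift f) (by
    refine Submodule.span_le.2 ?_
    rintro _ ⟨p, rfl⟩
    simp [hf])

@[simp]
theorem tlift_tmk {X : Bim k R S} {Y : Bim k S T} {P : Type u} [AddCommGroup P] [Module k P]
    (f : X.carrier →ₗ[k] Y.carrier →ₗ[k] P)
    (hf : ∀ (s : S) x y, f (X.r (op s) x) y = f x (Y.l s y)) (x : X.carrier) (y : Y.carrier) :
    tlift f hf (tmk X Y x y) = f x y := by
  exact TensorProduct.lift.tmul x y

theorem ten_ext {X : Bim k R S} {Y : Bim k S T} {P : Type*} [AddCommGroup P] [Module k P]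
    {f g : Ten X Y →ₗ[k] P} (h : ∀ x y, f (tmk X Y x y) = g (tmk X Y x y)) : f = g := by
  apply Submodule.linearMap_qext
  apply TensorProduct.ext'
  exact h

/-- `x ⊗ y` as a bilinear map. -/
def tmkL (X : Bim k R S) (Y : Bim k S T) : X.carrier →ₗ[k] Y.carrier →ₗ[k] Ten X Y :=
  (TensorProduct.mk k X.carrier Y.carrier).compr₂ (balRel X Y).mkQ

@[simp]
theorem tmkL_apply (X : Bim k R S) (Y : Bim k S T) (x : X.carrier) (y : Y.carrier) :
    tmkL X Y x y = tmk X Y x y := rfl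

/-- `f ⊗ g`, for `f` compatible with the right and `g` with the left action of `S`. -/
def tmap {X X' : Bim k R S} {Y Y' : Bim k S T}
    (f : X.carrier →ₗ[k] X'.carrier) (hf : ∀ b x, f (X.r b x) = X'.r b (f x))
    (g : Y.carrier →ₗ[k] Y'.carrier) (hg : ∀ a y, g (Y.l a y) = Y'.l a (g y)) :
    Ten X Y →ₗ[k] Ten X' Y' :=
  tlift ((tmkL X' Y').compl₁₂ f g) (fun s x y => by simp [hf, hg, tmk_bal])

@[simp]
theorem tmap_tmk {X X' : Bim k R S} {Y Y' : Bim k S T}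
    (f : X.carrier →ₗ[k] X'.carrier) (hf : ∀ b x, f (X.r b x) = X'.r b (f x))
    (g : Y.carrier →ₗ[k] Y'.carrier) (hg : ∀ a y, g (Y.l a y) = Y'.l a (g y)) (x y) :
    tmap f hf g hg (tmk X Y x y) = tmk X' Y' (f x) (g y) := by
  simp [tmap]

theorem tmk_add_left (X : Bim k R S) (Y : Bim k S T) (x x' : X.carrier) (y : Y.carrier) :
    tmk X Y (x + x') y = tmk X Y x y + tmk X Y x' y := by
  simp [← tmkL_apply]

theorem tmk_add_right (X : Bim k R S) (Y : Bim k S T) (x : X.carrier) (y y' : Y.carrier) :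
    tmk X Y x (y + y') = tmk X Y x y + tmk X Y x y' := by
  simp [← tmkL_apply]

theorem tmk_smul_left (X : Bim k R S) (Y : Bim k S T) (c : k) (x : X.carrier) (y : Y.carrier) :
    tmk X Y (c • x) y = c • tmk X Y x y := by
  simp [← tmkL_apply]

theorem tmk_smul_right (X : Bim k R S) (Y : Bim k S T) (c : k) (x : X.carrier) (y : Y.carrier) :
    tmk X Y x (c • y) = c • tmk X Y x y := by
  simp [← tmkL_apply]

/-- An algebra acting on `X` by right `S`-linear maps acts on `X ⊗_S Y`. -/
def actL {Q : Type u} [Ring Q] [Algebra k Q] (X : Bim k R S) (Y : Bim k S T)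
    (φ : Q →ₐ[k] Module.End k X.carrier) (h : ∀ q b x, φ q (X.r b x) = X.r b (φ q x)) :
    Q →ₐ[k] Module.End k (Ten X Y) :=
  AlgHom.ofLinearMap
    { toFun := fun q => tmap (φ q) (h q) LinearMap.id (fun _ _ => rfl)
      map_add' := fun a b => ten_ext fun x y => by
        simp [tmk_add_left]
      map_smul' := fun c a => ten_ext fun x y => by
        simp [tmk_smul_left] }
    (ten_ext fun x y => by simp)
    (fun a b => ten_ext fun x y => by simp)

/-- An algebra acting on `Y` by left `S`-linear maps acts on `X ⊗_S Y`. -/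
def actR {Q : Type u} [Ring Q] [Algebra k Q] (X : Bim k R S) (Y : Bim k S T)
    (φ : Q →ₐ[k] Module.End k Y.carrier) (h : ∀ q a y, φ q (Y.l a y) = Y.l a (φ q y)) :
    Q →ₐ[k] Module.End k (Ten X Y) :=
  AlgHom.ofLinearMap
    { toFun := fun q => tmap LinearMap.id (fun _ _ => rfl) (φ q) (h q)
      map_add' := fun a b => ten_ext fun x y => by
        simp [tmk_add_right]
      map_smul' := fun c a => ten_ext fun x y => by
        simp [tmk_smul_right] }
    (ten_ext fun x y => by simp)
    (fun a b => ten_ext fun x y => by simp)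

@[simp]
theorem actL_tmk {Q : Type u} [Ring Q] [Algebra k Q] (X : Bim k R S) (Y : Bim k S T)
    (φ : Q →ₐ[k] Module.End k X.carrier) (h : ∀ q b x, φ q (X.r b x) = X.r b (φ q x)) (q x y) :
    actL X Y φ h q (tmk X Y x y) = tmk X Y (φ q x) y := by
  simp [actL]

@[simp]
theorem actR_tmk {Q : Type u} [Ring Q] [Algebra k Q] (X : Bim k R S) (Y : Bim k S T)
    (φ : Q →ₐ[k] Module.End k Y.carrier) (h : ∀ q a y, φ q (Y.l a y) = Y.l a (φ q y)) (q x y) :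
    actR X Y φ h q (tmk X Y x y) = tmk X Y x (φ q y) := by
  simp [actR]

/-- Linear maps on `X ⊗_S Y` that agree on all `x ⊗ y` agree everywhere. -/
theorem ten_ext_apply {X : Bim k R S} {Y : Bim k S T} {P : Type*} [AddCommGroup P] [Module k P]
    (f g : Ten X Y →ₗ[k] P) (h : ∀ x y, f (tmk X Y x y) = g (tmk X Y x y)) (t : Ten X Y) :
    f t = g t := by
  rw [ten_ext h]

theorem actL_comm {Q P : Type u} [Ring Q] [Algebra k Q] [Ring P] [Algebra k P]
    (X : Bim k R S) (Y : Bim k S T)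
    (φ : Q →ₐ[k] Module.End k X.carrier) (h : ∀ q b x, φ q (X.r b x) = X.r b (φ q x))
    (ψ : P →ₐ[k] Module.End k X.carrier) (h' : ∀ q b x, ψ q (X.r b x) = X.r b (ψ q x))
    (c : ∀ q p x, φ q (ψ p x) = ψ p (φ q x)) (q : Q) (p : P) (t : Ten X Y) :
    actL X Y φ h q (actL X Y ψ h' p t) = actL X Y ψ h' p (actL X Y φ h q t) :=
  ten_ext_apply (actL X Y φ h q * actL X Y ψ h' p) (actL X Y ψ h' p * actL X Y φ h q)
    (fun _ _ => by simp [c]) t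

theorem actR_comm {Q P : Type u} [Ring Q] [Algebra k Q] [Ring P] [Algebra k P]
    (X : Bim k R S) (Y : Bim k S T)
    (φ : Q →ₐ[k] Module.End k Y.carrier) (h : ∀ q a y, φ q (Y.l a y) = Y.l a (φ q y))
    (ψ : P →ₐ[k] Module.End k Y.carrier) (h' : ∀ q a y, ψ q (Y.l a y) = Y.l a (ψ q y))
    (c : ∀ q p y, φ q (ψ p y) = ψ p (φ q y)) (q : Q) (p : P) (t : Ten X Y) :
    actR X Y φ h q (actR X Y ψ h' p t) = actR X Y ψ h' p (actR X Y φ h q t) :=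
  ten_ext_apply (actR X Y φ h q * actR X Y ψ h' p) (actR X Y ψ h' p * actR X Y φ h q)
    (fun _ _ => by simp [c]) t

theorem actL_actR {Q P : Type u} [Ring Q] [Algebra k Q] [Ring P] [Algebra k P]
    (X : Bim k R S) (Y : Bim k S T)
    (φ : Q →ₐ[k] Module.End k X.carrier) (h : ∀ q b x, φ q (X.r b x) = X.r b (φ q x))
    (ψ : P →ₐ[k] Module.End k Y.carrier) (h' : ∀ q a y, ψ q (Y.l a y) = Y.l a (ψ q y))
    (q : Q) (p : P) (t : Ten X Y) :
    actL X Y φ h q (actR X Y ψ h' p t) = actR X Y ψ h' p (actL X Y φ h q t) :=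
  ten_ext_apply (actL X Y φ h q * actR X Y ψ h' p) (actR X Y ψ h' p * actL X Y φ h q)
    (fun _ _ => by simp) t

/-- The bimodule `X ⊗_S Y`. -/
def Bim.tens (X : Bim k R S) (Y : Bim k S T) : Bim k R T where
  carrier := Ten X Y
  l := actL X Y X.l X.l_r
  r := actR X Y Y.r fun b a y => (Y.l_r a b y).symm
  l_r := actL_actR X Y _ _ _ _

/-- The element `x ⊗ y` of the bimodule `X ⊗_S Y`. -/
def Bim.tmul (X : Bim k R S) (Y : Bim k S T) (x : X.carrier) (y : Y.carrier) :
    (X.tens Y).carrier :=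
  tmk X Y x y

/-- `x ⊗ y` as a bilinear map. -/
def Bim.tmulL (X : Bim k R S) (Y : Bim k S T) :
    X.carrier →ₗ[k] Y.carrier →ₗ[k] (X.tens Y).carrier :=
  tmkL X Y

@[simp]
theorem Bim.tmulL_apply (X : Bim k R S) (Y : Bim k S T) (x : X.carrier) (y : Y.carrier) :
    X.tmulL Y x y = X.tmul Y x y := rfl

theorem Bim.tmul_bal (X : Bim k R S) (Y : Bim k S T) (s : S) (x : X.carrier) (y : Y.carrier) :
    X.tmul Y (X.r (op s) x) y = X.tmul Y x (Y.l s y) :=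
  tmk_bal X Y s x y

/-- The linear map out of the bimodule `X ⊗_S Y` given by a balanced bilinear map. -/
def Bim.lift {X : Bim k R S} {Y : Bim k S T} {P : Type u} [AddCommGroup P] [Module k P]
    (f : X.carrier →ₗ[k] Y.carrier →ₗ[k] P)
    (hf : ∀ (s : S) x y, f (X.r (op s) x) y = f x (Y.l s y)) : (X.tens Y).carrier →ₗ[k] P :=
  tlift f hf

@[simp]
theorem Bim.lift_tmul {X : Bim k R S} {Y : Bim k S T} {P : Type u} [AddCommGroup P] [Module k P]
    (f : X.carrier →ₗ[k] Y.carrier →ₗ[k] P)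
    (hf : ∀ (s : S) x y, f (X.r (op s) x) y = f x (Y.l s y)) (x : X.carrier) (y : Y.carrier) :
    Bim.lift f hf (X.tmul Y x y) = f x y :=
  tlift_tmk f hf x y

/-- Linear maps on `X ⊗_S Y` that agree on all `x ⊗ y` agree everywhere. -/
theorem Bim.tens_ext {X : Bim k R S} {Y : Bim k S T} {P : Type*} [AddCommGroup P] [Module k P]
    (f g : (X.tens Y).carrier →ₗ[k] P) (h : ∀ x y, f (X.tmul Y x y) = g (X.tmul Y x y))
    (t : (X.tens Y).carrier) : f t = g t :=
  ten_ext_apply f g h t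

@[simp]
theorem Bim.tens_l_tmul (X : Bim k R S) (Y : Bim k S T) (a x y) :
    (X.tens Y).l a (X.tmul Y x y) = X.tmul Y (X.l a x) y :=
  actL_tmk X Y _ _ _ _ _

@[simp]
theorem Bim.tens_r_tmul (X : Bim k R S) (Y : Bim k S T) (b x y) :
    (X.tens Y).r b (X.tmul Y x y) = X.tmul Y x (Y.r b y) :=
  actR_tmk X Y _ _ _ _ _

/-- An algebra acting on `X` by right `S`-linear maps acts on the bimodule `X ⊗_S Y`. -/
def Bim.onL {Q : Type u} [Ring Q] [Algebra k Q] (X : Bim k R S) (Y : Bim k S T)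
    (φ : Q →ₐ[k] Module.End k X.carrier) (h : ∀ q b x, φ q (X.r b x) = X.r b (φ q x)) :
    Q →ₐ[k] Module.End k (X.tens Y).carrier :=
  actL X Y φ h

/-- An algebra acting on `Y` by left `S`-linear maps acts on the bimodule `X ⊗_S Y`. -/
def Bim.onR {Q : Type u} [Ring Q] [Algebra k Q] (X : Bim k R S) (Y : Bim k S T)
    (φ : Q →ₐ[k] Module.End k Y.carrier) (h : ∀ q a y, φ q (Y.l a y) = Y.l a (φ q y)) :
    Q →ₐ[k] Module.End k (X.tens Y).carrier :=
  actR X Y φ h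

@[simp]
theorem Bim.onL_tmul {Q : Type u} [Ring Q] [Algebra k Q] (X : Bim k R S) (Y : Bim k S T)
    (φ : Q →ₐ[k] Module.End k X.carrier) (h : ∀ q b x, φ q (X.r b x) = X.r b (φ q x)) (q x y) :
    X.onL Y φ h q (X.tmul Y x y) = X.tmul Y (φ q x) y :=
  actL_tmk X Y φ h q x y

@[simp]
theorem Bim.onR_tmul {Q : Type u} [Ring Q] [Algebra k Q] (X : Bim k R S) (Y : Bim k S T)
    (φ : Q →ₐ[k] Module.End k Y.carrier) (h : ∀ q a y, φ q (Y.l a y) = Y.l a (φ q y)) (q x y) :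
    X.onR Y φ h q (X.tmul Y x y) = X.tmul Y x (φ q y) :=
  actR_tmk X Y φ h q x y

/-- The linear map `x ⊗ y ↦ f(x) ⊗ g(y)`. -/
def Bim.Hom.tensLin {X X' : Bim k R S} {Y Y' : Bim k S T} (f : X.Hom X') (g : Y.Hom Y') :
    (X.tens Y).carrier →ₗ[k] (X'.tens Y').carrier :=
  Bim.lift ((X'.tmulL Y').compl₁₂ f.lin g.lin)
    (fun s x y => by simp [f.map_r, g.map_l, Bim.tmul_bal])

@[simp]
theorem Bim.Hom.tensLin_tmul {X X' : Bim k R S} {Y Y' : Bim k S T} (f : X.Hom X') (g : Y.Hom Y')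
    (x y) : f.tensLin g (X.tmul Y x y) = X'.tmul Y' (f.lin x) (g.lin y) :=
  Bim.lift_tmul _ _ _ _

/-- `f ⊗ g` for bimodule homomorphisms. -/
def Bim.Hom.tens {X X' : Bim k R S} {Y Y' : Bim k S T} (f : X.Hom X') (g : Y.Hom Y') :
    (X.tens Y).Hom (X'.tens Y') where
  lin := f.tensLin g
  map_l a := Bim.tens_ext (f.tensLin g ∘ₗ (X.tens Y).l a) ((X'.tens Y').l a ∘ₗ f.tensLin g)
    (fun _ _ => by simp [f.map_l])
  map_r b := Bim.tens_ext (f.tensLin g ∘ₗ (X.tens Y).r b) ((X'.tens Y').r b ∘ₗ f.tensLin g)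
    (fun _ _ => by simp [g.map_r])

@[simp]
theorem Bim.Hom.id_tens_id (X : Bim k R S) (Y : Bim k S T) :
    (Bim.Hom.id X).tens (Bim.Hom.id Y) = Bim.Hom.id (X.tens Y) :=
  Bim.Hom.ext (LinearMap.ext (Bim.tens_ext _ LinearMap.id
    (fun x y => Bim.Hom.tensLin_tmul (Bim.Hom.id X) (Bim.Hom.id Y) x y)))

theorem Bim.Hom.comp_tens_comp {X X' X'' : Bim k R S} {Y Y' Y'' : Bim k S T} (f : X.Hom X')
    (f' : X'.Hom X'') (g : Y.Hom Y') (g' : Y'.Hom Y'') :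
    (f.comp f').tens (g.comp g') = (f.tens g).comp (f'.tens g') :=
  Bim.Hom.ext (LinearMap.ext (Bim.tens_ext _ ((f'.tensLin g') ∘ₗ (f.tensLin g))
    (fun x y => by
      refine ((f.comp f').tensLin_tmul (g.comp g') x y).trans ?_
      simp [Bim.Hom.comp])))

theorem Bim.Hom.id_comp {X Y : Bim k R S} (f : X.Hom Y) : (Bim.Hom.id X).comp f = f := rfl

theorem Bim.Hom.comp_id {X Y : Bim k R S} (f : X.Hom Y) : f.comp (Bim.Hom.id Y) = f := rfl

theorem Bim.Hom.comp_assoc {X Y Z W : Bim k R S} (f : X.Hom Y) (g : Y.Hom Z) (h : Z.Hom W) :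
    (f.comp g).comp h = f.comp (g.comp h) := rfl

/-- `x ⊗ y ↦ (z ↦ x ⊗ (y ⊗ z))`. -/
def assocAux (X : Bim k R S) (Y : Bim k S T) (Z : Bim k T U) :
    (X.tens Y).carrier →ₗ[k] Z.carrier →ₗ[k] (X.tens (Y.tens Z)).carrier :=
  Bim.lift ((LinearMap.llcomp k Z.carrier (Y.tens Z).carrier (X.tens (Y.tens Z)).carrier ∘ₗ
      X.tmulL (Y.tens Z)).compl₂ (Y.tmulL Z))
    (fun s x y => by
      ext z
      simp [Bim.tmul_bal])

@[simp]
theorem assocAux_tmul (X : Bim k R S) (Y : Bim k S T) (Z : Bim k T U) (x y z) :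
    assocAux X Y Z (X.tmul Y x y) z = X.tmul (Y.tens Z) x (Y.tmul Z y z) := by
  simp [assocAux]

/-- The associativity map `(x ⊗ y) ⊗ z ↦ x ⊗ (y ⊗ z)`. -/
def assocLin (X : Bim k R S) (Y : Bim k S T) (Z : Bim k T U) :
    ((X.tens Y).tens Z).carrier →ₗ[k] (X.tens (Y.tens Z)).carrier :=
  Bim.lift (assocAux X Y Z)
    (fun t q z => Bim.tens_ext
      ((assocAux X Y Z).flip z ∘ₗ (X.tens Y).r (op t)) ((assocAux X Y Z).flip (Z.l t z))
      (fun x y => by simp [Bim.tmul_bal]) q)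

@[simp]
theorem assocLin_tmul (X : Bim k R S) (Y : Bim k S T) (Z : Bim k T U) (x y z) :
    assocLin X Y Z ((X.tens Y).tmul Z (X.tmul Y x y) z)
      = X.tmul (Y.tens Z) x (Y.tmul Z y z) :=
  (Bim.lift_tmul _ _ _ _).trans (assocAux_tmul X Y Z x y z)

theorem Bim.tens_ext₃ {X : Bim k R S} {Y : Bim k S T} {Z : Bim k T U} {P : Type u}
    [AddCommGroup P] [Module k P] (f g : ((X.tens Y).tens Z).carrier →ₗ[k] P)
    (h : ∀ x y z, f ((X.tens Y).tmul Z (X.tmul Y x y) z) = g ((X.tens Y).tmul Z (X.tmul Y x y) z))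
    (t) : f t = g t :=
  Bim.tens_ext f g (fun q z => Bim.tens_ext
    (f ∘ₗ ((X.tens Y).tmulL Z).flip z) (g ∘ₗ ((X.tens Y).tmulL Z).flip z)
    (fun x y => h x y z) q) t

/-- The associativity homomorphism `(x ⊗ y) ⊗ z ↦ x ⊗ (y ⊗ z)`. -/
def assoc (X : Bim k R S) (Y : Bim k S T) (Z : Bim k T U) :
    ((X.tens Y).tens Z).Hom (X.tens (Y.tens Z)) where
  lin := assocLin X Y Z
  map_l a := Bim.tens_ext₃
    (assocLin X Y Z ∘ₗ ((X.tens Y).tens Z).l a) ((X.tens (Y.tens Z)).l a ∘ₗ assocLin X Y Z)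
    (fun x y z => by simp)
  map_r b := Bim.tens_ext₃
    (assocLin X Y Z ∘ₗ ((X.tens Y).tens Z).r b) ((X.tens (Y.tens Z)).r b ∘ₗ assocLin X Y Z)
    (fun x y z => by simp)

/-! ### Bimodules over `Rᵐᵒᵖ ⊗ S` -/

/-- A bimodule over `Rᵐᵒᵖ ⊗[k] S`, that is, a `k`-module with two commuting two-sided actions:
the right action of `Rᵐᵒᵖ ⊗ S` is given by the left `R`-action `l` and the right `S`-action `r`, the
left action of `Rᵐᵒᵖ ⊗ S` is given by the left `Rᵐᵒᵖ`-action `lo` and the left `S`-action `lt`. -/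
structure QBim (k : Type w) [CommRing k] (R : Type u) [Ring R] [Algebra k R]
    (S : Type u) [Ring S] [Algebra k S] extends Bim.{w, u} k R S where
  lo : Rᵐᵒᵖ →ₐ[k] Module.End k carrier
  lt : S →ₐ[k] Module.End k carrier
  lo_lt : ∀ p q x, lo p (lt q x) = lt q (lo p x)
  lo_l : ∀ p a x, lo p (l a x) = l a (lo p x)
  lo_r : ∀ p b x, lo p (r b x) = r b (lo p x)
  lt_l : ∀ q a x, lt q (l a x) = l a (lt q x)
  lt_r : ∀ q b x, lt q (r b x) = r b (lt q x)

/-- Homomorphisms of `(Rᵐᵒᵖ ⊗ S)`-bimodules. -/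
@[ext]
structure QBim.Hom (X Y : QBim k R S) extends toBimHom : Bim.Hom X.toBim Y.toBim where
  map_lo : ∀ p x, lin (X.lo p x) = Y.lo p (lin x)
  map_lt : ∀ q x, lin (X.lt q x) = Y.lt q (lin x)

/-- The identity homomorphism. -/
def QBim.Hom.id (X : QBim k R S) : X.Hom X where
  toBimHom := Bim.Hom.id X.toBim
  map_lo _ _ := rfl
  map_lt _ _ := rfl

/-- Composition, in diagrammatic order. -/
def QBim.Hom.comp {X Y Z : QBim k R S} (f : X.Hom Y) (g : Y.Hom Z) : X.Hom Z where
  toBimHom := f.toBimHom.comp g.toBimHom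
  map_lo p x := by simp [Bim.Hom.comp, f.map_lo, g.map_lo]
  map_lt p x := by simp [Bim.Hom.comp, f.map_lt, g.map_lt]

/-- `X ⊗_S Y` as a bimodule over `Rᵐᵒᵖ ⊗ T`: the actions of `R` and `Rᵐᵒᵖ` are those on `X`, the
actions of `T` are those on `Y`. -/
@[reducible]
def QBim.tens (X : QBim k R S) (Y : QBim k S T) : QBim k R T where
  toBim := X.toBim.tens Y.toBim
  lo := Bim.onL X.toBim Y.toBim X.lo X.lo_r
  lt := Bim.onR X.toBim Y.toBim Y.lt Y.lt_l
  lo_lt := actL_actR _ _ _ _ _ _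
  lo_l := actL_comm _ _ _ _ _ _ X.lo_l
  lo_r := actL_actR _ _ _ _ _ _
  lt_l q a x := (actL_actR _ _ _ _ _ _ a q x).symm
  lt_r := actR_comm _ _ _ _ _ _ Y.lt_r

/-- Restriction of an action to a stable submodule. -/
def restr {Q V : Type u} [Ring Q] [Algebra k Q] [AddCommGroup V] [Module k V]
    (φ : Q →ₐ[k] Module.End k V) (N : Submodule k V) (h : ∀ q, ∀ x ∈ N, φ q x ∈ N) :
    Q →ₐ[k] Module.End k N :=
  AlgHom.ofLinearMap
    { toFun := fun q => (φ q).restrict (h q)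
      map_add' := fun a b => by ext x; simp
      map_smul' := fun c a => by ext x; simp }
    (by ext x; simp)
    (fun a b => by ext x; simp)

/-- A submodule stable under all the actions. -/
structure QBim.Stable (X : QBim k R S) (N : Submodule k X.carrier) : Prop where
  l : ∀ a, ∀ x ∈ N, X.l a x ∈ N
  r : ∀ b, ∀ x ∈ N, X.r b x ∈ N
  lo : ∀ p, ∀ x ∈ N, X.lo p x ∈ N
  lt : ∀ q, ∀ x ∈ N, X.lt q x ∈ N

/-- A stable submodule, as a bimodule. -/
def QBim.sub (X : QBim k R S) (N : Submodule k X.carrier) (h : X.Stable N) : QBim k R S where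
  carrier := N
  l := restr X.l N h.l
  r := restr X.r N h.r
  lo := restr X.lo N h.lo
  lt := restr X.lt N h.lt
  l_r a b x := Subtype.ext (X.l_r a b x)
  lo_lt a b x := Subtype.ext (X.lo_lt a b x)
  lo_l a b x := Subtype.ext (X.lo_l a b x)
  lo_r a b x := Subtype.ext (X.lo_r a b x)
  lt_l a b x := Subtype.ext (X.lt_l a b x)
  lt_r a b x := Subtype.ext (X.lt_r a b x)

/-- The inclusion of a stable submodule. -/
def QBim.incl (X : QBim k R S) (N : Submodule k X.carrier) (h : X.Stable N) :
    (X.sub N h).Hom X where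
  lin := N.subtype
  map_l _ _ := rfl
  map_r _ _ := rfl
  map_lo _ _ := rfl
  map_lt _ _ := rfl

/-- The elements `t` of `V` with `φ s t = ψ s t` for all `s`. -/
def agree {V Q : Type u} [AddCommGroup V] [Module k V] (φ ψ : Q → Module.End k V) :
    Submodule k V where
  carrier := {t | ∀ s, φ s t = ψ s t}
  add_mem' ha hb s := by rw [map_add, map_add, ha s, hb s]
  zero_mem' s := by rw [map_zero, map_zero]
  smul_mem' c x hx s := by rw [map_smul, map_smul, hx s]

theorem agree_stable {V Q : Type u} [AddCommGroup V] [Module k V] {φ ψ : Q → Module.End k V}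
    (f : Module.End k V) (hφ : ∀ s x, φ s (f x) = f (φ s x)) (hψ : ∀ s x, ψ s (f x) = f (ψ s x))
    (x : V) (hx : x ∈ agree φ ψ) : f x ∈ agree φ ψ := fun s => by
  rw [hφ, hψ, hx s]

/-! ### The Takeuchi products -/

/-- The set of `∑ xᵢ ⊗ yᵢ ∈ X ⊗_S Y` with `∑ s xᵢ ⊗ yᵢ = ∑ xᵢ ⊗ s yᵢ` for all `s ∈ S`, where `S` acts
on `X` by the left `S`-action and on `Y` by the left `Sᵐᵒᵖ`-action. -/
def takeuchi (X : QBim k R S) (Y : QBim k S T) : Submodule k (X.tens Y).carrier :=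
  agree (Q := S) (fun s => Bim.onL X.toBim Y.toBim X.lt X.lt_r s)
    (fun s => Bim.onR X.toBim Y.toBim Y.lo Y.lo_l (op s))

theorem takeuchi_stable (X : QBim k R S) (Y : QBim k S T) : (X.tens Y).Stable (takeuchi X Y) where
  l a := agree_stable _ (fun s => actL_comm _ _ _ _ _ _ X.lt_l s a)
    (fun s x => (actL_actR _ _ _ _ _ _ a (op s) x).symm)
  r b := agree_stable _ (fun s => actL_actR _ _ _ _ _ _ s b)
    (fun s => actR_comm _ _ _ _ _ _ Y.lo_r (op s) b)
  lo p := agree_stable _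
    (fun s => actL_comm _ _ _ _ _ _ (fun q p x => (X.lo_lt p q x).symm) s p)
    (fun s x => (actL_actR _ _ _ _ _ _ p (op s) x).symm)
  lt q := agree_stable _ (fun s => actL_actR _ _ _ _ _ _ s q)
    (fun s => actR_comm _ _ _ _ _ _ Y.lo_lt (op s) q)

/-- The Takeuchi product `X ×_S Y`. -/
def T2 (X : QBim k R S) (Y : QBim k S T) : QBim k R T :=
  (X.tens Y).sub (takeuchi X Y) (takeuchi_stable X Y)

/-- The inclusion `X ×_S Y → X ⊗_S Y`. -/
def T2.incl (X : QBim k R S) (Y : QBim k S T) : (T2 X Y).Hom (X.tens Y) :=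
  (X.tens Y).incl (takeuchi X Y) (takeuchi_stable X Y)

/-- The set of `∑ xᵢ ⊗ yᵢ ⊗ zᵢ ∈ X ⊗_S Y ⊗_T Z` with `∑ s xᵢ ⊗ yᵢ ⊗ zᵢ = ∑ xᵢ ⊗ s yᵢ ⊗ zᵢ` for all
`s ∈ S` and `∑ xᵢ ⊗ t yᵢ ⊗ zᵢ = ∑ xᵢ ⊗ yᵢ ⊗ t zᵢ` for all `t ∈ T`, for the same actions. -/
def takeuchi3 (X : QBim k R S) (Y : QBim k S T) (Z : QBim k T U) :
    Submodule k (X.tens (Y.tens Z)).carrier :=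
  takeuchi X (Y.tens Z) ⊓
    agree (Q := T)
      (fun t => Bim.onR X.toBim (Y.tens Z).toBim (Bim.onL Y.toBim Z.toBim Y.lt Y.lt_r)
        (actL_comm _ _ _ _ _ _ Y.lt_l) t)
      (fun t => Bim.onR X.toBim (Y.tens Z).toBim (Bim.onR Y.toBim Z.toBim Z.lo Z.lo_l)
        (fun q a x => (actL_actR _ _ _ _ _ _ a q x).symm) (op t))

theorem takeuchi3_stable (X : QBim k R S) (Y : QBim k S T) (Z : QBim k T U) :
    (X.tens (Y.tens Z)).Stable (takeuchi3 X Y Z) where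
  l a x hx := ⟨(takeuchi_stable X (Y.tens Z)).l a x hx.1, agree_stable _
    (fun s x => (actL_actR _ _ _ _ _ _ a s x).symm)
    (fun s x => (actL_actR _ _ _ _ _ _ a (op s) x).symm) x hx.2⟩
  r b x hx := ⟨(takeuchi_stable X (Y.tens Z)).r b x hx.1, agree_stable _
    (fun s => actR_comm _ _ _ _ _ _ (actL_actR _ _ _ _ _ _) s b)
    (fun s => actR_comm _ _ _ _ _ _ (actR_comm _ _ _ _ _ _ Z.lo_r) (op s) b) x hx.2⟩
  lo p x hx := ⟨(takeuchi_stable X (Y.tens Z)).lo p x hx.1, agree_stable _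
    (fun s x => (actL_actR _ _ _ _ _ _ p s x).symm)
    (fun s x => (actL_actR _ _ _ _ _ _ p (op s) x).symm) x hx.2⟩
  lt q x hx := ⟨(takeuchi_stable X (Y.tens Z)).lt q x hx.1, agree_stable _
    (fun s => actR_comm _ _ _ _ _ _ (actL_actR _ _ _ _ _ _) s q)
    (fun s => actR_comm _ _ _ _ _ _ (actR_comm _ _ _ _ _ _ Z.lo_lt) (op s) q) x hx.2⟩

/-- The ternary Takeuchi product `X ×_S Y ×_T Z`. -/
def T3 (X : QBim k R S) (Y : QBim k S T) (Z : QBim k T U) : QBim k R U :=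
  (X.tens (Y.tens Z)).sub (takeuchi3 X Y Z) (takeuchi3_stable X Y Z)

/-- The inclusion `X ×_S Y ×_T Z → X ⊗_S Y ⊗_T Z`. -/
def T3.incl (X : QBim k R S) (Y : QBim k S T) (Z : QBim k T U) :
    (T3 X Y Z).Hom (X.tens (Y.tens Z)) :=
  (X.tens (Y.tens Z)).incl (takeuchi3 X Y Z) (takeuchi3_stable X Y Z)

/-- The nullary Takeuchi product: `Hom_k(R, R)`, with `(l a f) x = a f(x)`, `(r b f) x = f(x) b`,
`(lo p f) x = f(p x)` and `(lt q f) x = f(x q)`. -/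
def T0 (k : Type w) [CommRing k] (R : Type u) [Ring R] [Algebra k R] : QBim k R R where
  carrier := R →ₗ[k] R
  l := AlgHom.ofLinearMap
    { toFun := fun a => (LinearMap.mulLeft k a).compRight k
      map_add' := fun a b => by ext f x; simp [add_mul]
      map_smul' := fun c a => by ext f x; simp }
    (by ext f x; simp) (fun a b => by ext f x; simp)
  r := AlgHom.ofLinearMap
    { toFun := fun b => (LinearMap.mulRight k b.unop).compRight k
      map_add' := fun a b => by ext f x; simp [mul_add]
      map_smul' := fun c a => by ext f x; simp }
    (by ext f x; simp) (fun a b => by ext f x; simp [mul_assoc])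
  lo := AlgHom.ofLinearMap
    { toFun := fun p => LinearMap.lcomp k R (LinearMap.mulLeft k p.unop)
      map_add' := fun a b => by ext f x; simp [add_mul]
      map_smul' := fun c a => by ext f x; simp }
    (by ext f x; simp) (fun a b => by ext f x; simp)
  lt := AlgHom.ofLinearMap
    { toFun := fun q => LinearMap.lcomp k R (LinearMap.mulRight k q)
      map_add' := fun a b => by ext f x; simp [mul_add]
      map_smul' := fun c a => by ext f x; simp }
    (by ext f x; simp) (fun a b => by ext f x; simp)
  l_r a b f := by ext x; simp [mul_assoc]
  lo_lt a b f := by ext x; simp [mul_assoc]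
  lo_l a b f := by ext x; simp
  lo_r a b f := by ext x; simp
  lt_l a b f := by ext x; simp
  lt_r a b f := by ext x; simp

/-- `ε(a)(1)` as a linear function of `a`. -/
def evalOne {A : QBim k R R} (ε : A.Hom (T0 k R)) : A.carrier →ₗ[k] R :=
  (LinearMap.applyₗ (1 : R) : (R →ₗ[k] R) →ₗ[k] R) ∘ₗ ε.lin

theorem evalOne_l {A : QBim k R R} (ε : A.Hom (T0 k R)) (s : R) (a : A.carrier) :
    evalOne ε (A.l s a) = s * evalOne ε a :=
  congrArg (fun f : R →ₗ[k] R => f 1) (ε.map_l s a)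

theorem evalOne_r {A : QBim k R R} (ε : A.Hom (T0 k R)) (s : R) (a : A.carrier) :
    evalOne ε (A.r (op s) a) = evalOne ε a * s :=
  congrArg (fun f : R →ₗ[k] R => f 1) (ε.map_r (op s) a)

/-- The contraction `A ⊗_R X → X`, `a ⊗ x ↦ ε(a)(1) x`, as a linear map. -/
def contrLLin {A : QBim k R R} (ε : A.Hom (T0 k R)) (X : Bim k R S) :
    (A.toBim.tens X).carrier →ₗ[k] X.carrier :=
  Bim.lift (X.l.toLinearMap ∘ₗ evalOne ε) (fun s a x => by simp [evalOne_r])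

@[simp]
theorem contrLLin_tmul {A : QBim k R R} (ε : A.Hom (T0 k R)) (X : Bim k R S) (a x) :
    contrLLin ε X (A.toBim.tmul X a x) = X.l (evalOne ε a) x :=
  Bim.lift_tmul _ _ _ _

/-- The contraction `A ⊗_R X → X`, `a ⊗ x ↦ ε(a)(1) x`. -/
def contrL {A : QBim k R R} (ε : A.Hom (T0 k R)) (X : Bim k R S) : (A.toBim.tens X).Hom X where
  lin := contrLLin ε X
  map_l a := Bim.tens_ext (contrLLin ε X ∘ₗ (A.toBim.tens X).l a) (X.l a ∘ₗ contrLLin ε X)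
    (fun c x => by simp [evalOne_l])
  map_r b := Bim.tens_ext (contrLLin ε X ∘ₗ (A.toBim.tens X).r b) (X.r b ∘ₗ contrLLin ε X)
    (fun c x => by simp [X.l_r])

/-- The contraction `X ⊗_S A → X`, `x ⊗ a ↦ x ε(a)(1)`, as a linear map. -/
def contrRLin {A : QBim k S S} (ε : A.Hom (T0 k S)) (X : Bim k R S) :
    (X.tens A.toBim).carrier →ₗ[k] X.carrier :=
  Bim.lift (X.r.toLinearMap ∘ₗ (opLinearEquiv k : S ≃ₗ[k] Sᵐᵒᵖ).toLinearMap ∘ₗ evalOne ε).flip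
    (fun s x a => by simp [evalOne_l])

@[simp]
theorem contrRLin_tmul {A : QBim k S S} (ε : A.Hom (T0 k S)) (X : Bim k R S) (x a) :
    contrRLin ε X (X.tmul A.toBim x a) = X.r (op (evalOne ε a)) x :=
  Bim.lift_tmul _ _ _ _

/-- The contraction `X ⊗_S A → X`, `x ⊗ a ↦ x ε(a)(1)`. -/
def contrR {A : QBim k S S} (ε : A.Hom (T0 k S)) (X : Bim k R S) : (X.tens A.toBim).Hom X where
  lin := contrRLin ε X
  map_l a := Bim.tens_ext (contrRLin ε X ∘ₗ (X.tens A.toBim).l a) (X.l a ∘ₗ contrRLin ε X)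
    (fun x c => by simp [X.l_r])
  map_r b := Bim.tens_ext (contrRLin ε X ∘ₗ (X.tens A.toBim).r b) (X.r b ∘ₗ contrRLin ε X)
    (fun x c => by
      rw [← op_unop b]
      simp only [LinearMap.comp_apply, Bim.tens_r_tmul, contrRLin_tmul, evalOne_r, op_mul, map_mul]
      rfl)

/-! ### Coalgebroids and comodules -/

/-- The composite `A → A ×_R A → A ⊗_R A`. -/
def QBim.Hom.ten2 {X : QBim k R T} {Y : QBim k R S} {Z : QBim k S T} (f : X.Hom (T2 Y Z)) :
    X.toBim.Hom (Y.toBim.tens Z.toBim) :=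
  (f.comp (T2.incl Y Z)).toBimHom

/-- The composite `X → Y ×_S Z ×_T W → Y ⊗_S (Z ⊗_T W)`. -/
def QBim.Hom.ten3 {X : QBim k R U} {Y : QBim k R S} {Z : QBim k S T} {W : QBim k T U}
    (f : X.Hom (T3 Y Z W)) : X.toBim.Hom (Y.toBim.tens (Z.toBim.tens W.toBim)) :=
  (f.comp (T3.incl Y Z W)).toBimHom

variable (k) in
/-- A coalgebroid `(A, R)` over `k`: a bimodule `A` over `Rᵐᵒᵖ ⊗ R` with bimodule homomorphisms
`Δ : A → A ×_R A` and `ε : A → Hom_k(R, R)` which are coassociative and counital. -/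
structure Coalgebroid where
  R : Type u
  [ring : Ring R]
  [algebra : Algebra k R]
  A : QBim k R R
  comul : A.Hom (T2 A A)
  counit : A.Hom (T0 k R)
  coassoc : (comul.ten2.comp (comul.ten2.tens (Bim.Hom.id A.toBim))).comp
      (assoc A.toBim A.toBim A.toBim) =
    comul.ten2.comp ((Bim.Hom.id A.toBim).tens comul.ten2)
  counit_left : comul.ten2.comp (contrL counit A.toBim) = Bim.Hom.id A.toBim
  counit_right : comul.ten2.comp (contrR counit A.toBim) = Bim.Hom.id A.toBim

attribute [instance] Coalgebroid.ring Coalgebroid.algebra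

/-- `A` as a bimodule for the right action only. -/
abbrev Coalgebroid.B (𝒜 : Coalgebroid.{w, u} k) : Bim k 𝒜.R 𝒜.R := 𝒜.A.toBim

/-- A comodule `M` from `(A, R)` to `(A', S)`: a bimodule over `Rᵐᵒᵖ ⊗ S` with a coaction
`α : M → A ×_R M ×_S A'` satisfying `(1 ⊗ α ⊗ 1) α = (Δ ⊗ 1 ⊗ Δ') α`, as maps to
`A ⊗ (A ⊗ (M ⊗ (A' ⊗ A')))`, and `(ε ⊗ 1 ⊗ ε') α = 1`. -/
structure Comodule (𝒜 ℬ : Coalgebroid.{w, u} k) where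
  M : QBim k 𝒜.R ℬ.R
  coact : M.Hom (T3 𝒜.A M ℬ.A)
  coassoc :
    (coact.ten3.comp ((Bim.Hom.id 𝒜.B).tens (coact.ten3.tens (Bim.Hom.id ℬ.B)))).comp
      ((Bim.Hom.id 𝒜.B).tens ((assoc 𝒜.B (M.toBim.tens ℬ.B) ℬ.B).comp
        ((Bim.Hom.id 𝒜.B).tens (assoc M.toBim ℬ.B ℬ.B)))) =
    (coact.ten3.comp (𝒜.comul.ten2.tens ((Bim.Hom.id M.toBim).tens ℬ.comul.ten2))).comp
      (assoc 𝒜.B 𝒜.B (M.toBim.tens (ℬ.B.tens ℬ.B)))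
  counit : (coact.ten3.comp (contrL 𝒜.counit (M.toBim.tens ℬ.B))).comp (contrR ℬ.counit M.toBim) =
    Bim.Hom.id M.toBim

/-- Homomorphisms of comodules: bimodule homomorphisms that commute with the coactions. -/
@[ext]
structure Comodule.Hom {𝒜 ℬ : Coalgebroid.{w, u} k} (M N : Comodule 𝒜 ℬ) extends
    toQHom : QBim.Hom M.M N.M where
  coact_comm : M.coact.ten3.comp ((Bim.Hom.id 𝒜.B).tens (toBimHom.tens (Bim.Hom.id ℬ.B))) =
    toBimHom.comp N.coact.ten3

/-- The left coaction `M → A ⊗ M`, obtained from the coaction by contracting with `ε'`. -/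
def Comodule.left {𝒜 ℬ : Coalgebroid.{w, u} k} (M : Comodule 𝒜 ℬ) :
    M.M.toBim.Hom (𝒜.B.tens M.M.toBim) :=
  M.coact.ten3.comp ((Bim.Hom.id 𝒜.B).tens (contrR ℬ.counit M.M.toBim))

/-- The right coaction `M → M ⊗ A'`, obtained from the coaction by contracting with `ε`. -/
def Comodule.right {𝒜 ℬ : Coalgebroid.{w, u} k} (M : Comodule 𝒜 ℬ) :
    M.M.toBim.Hom (M.M.toBim.tens ℬ.B) :=
  M.coact.ten3.comp (contrL 𝒜.counit (M.M.toBim.tens ℬ.B))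

/-- The identity homomorphism of a comodule. -/
def Comodule.Hom.id {𝒜 ℬ : Coalgebroid.{w, u} k} (M : Comodule 𝒜 ℬ) : M.Hom M where
  toQHom := QBim.Hom.id M.M
  coact_comm := by
    change M.coact.ten3.comp ((Bim.Hom.id _).tens ((Bim.Hom.id _).tens (Bim.Hom.id _))) = _
    rw [Bim.Hom.id_tens_id, Bim.Hom.id_tens_id]
    rfl

/-- Composition of comodule homomorphisms, in diagrammatic order. -/
def Comodule.Hom.comp {𝒜 ℬ : Coalgebroid.{w, u} k} {M N P : Comodule 𝒜 ℬ} (f : M.Hom N)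
    (g : N.Hom P) : M.Hom P where
  toQHom := f.toQHom.comp g.toQHom
  coact_comm := by
    change M.coact.ten3.comp (((Bim.Hom.id _).comp (Bim.Hom.id _)).tens
      ((f.toBimHom.comp g.toBimHom).tens ((Bim.Hom.id _).comp (Bim.Hom.id _)))) = _
    rw [Bim.Hom.comp_tens_comp, Bim.Hom.comp_tens_comp, ← Bim.Hom.comp_assoc, f.coact_comm,
      Bim.Hom.comp_assoc, g.coact_comm]
    rfl

/-- For comodules `M` from `(A₁, R₁)` to `(A₂, R₂)` and `N` from `(A₂, R₂)` to `(A₃, R₃)`, the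
equalizer `M • N` of the two maps `M ×_{R₂} N → M ×_{R₂} A₂ ×_{R₂} N` induced by the right coaction
of `M` and by the left coaction of `N`. -/
def bullet {𝒜 ℬ 𝒞 : Coalgebroid.{w, u} k} (M : Comodule 𝒜 ℬ) (N : Comodule ℬ 𝒞) :
    Submodule k (M.M.tens N.M).carrier :=
  takeuchi M.M N.M ⊓
    LinearMap.eqLocus
      ((M.right.tens (Bim.Hom.id N.M.toBim)).comp (assoc M.M.toBim ℬ.B N.M.toBim)).lin
      ((Bim.Hom.id M.M.toBim).tens N.left).lin

/-! ### Hereditary rings and unions of projectives -/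

/-- A ring is hereditary if submodules of projective left modules and of projective right modules
are projective. -/
def IsHereditary (R : Type u) [Ring R] : Prop :=
  (∀ (P : Type u) [AddCommGroup P] [Module R P], Module.Projective R P →
    ∀ N : Submodule R P, Module.Projective R N) ∧
  (∀ (P : Type u) [AddCommGroup P] [Module Rᵐᵒᵖ P], Module.Projective Rᵐᵒᵖ P →
    ∀ N : Submodule Rᵐᵒᵖ P, Module.Projective Rᵐᵒᵖ N)

/-- A module is a union of projectives if it is the union of a directed family of projective
submodules. -/
def IsUnionOfProjectives (R : Type u) [Ring R] (X : Type u) [AddCommGroup X] [Module R X] : Prop :=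
  ∃ D : Set (Submodule R X), D.Nonempty ∧ DirectedOn (· ≤ ·) D ∧
    (∀ P ∈ D, Module.Projective R P) ∧ ∀ x : X, ∃ P ∈ D, x ∈ P

/-- The left `R`-module underlying an `R`-`S`-bimodule. -/
@[reducible]
def Bim.leftModule (X : Bim k R S) : Module R X.carrier :=
  Module.compHom X.carrier (X.l : R →+* Module.End k X.carrier)

/-- The right `S`-module underlying an `R`-`S`-bimodule. -/
@[reducible]
def Bim.rightModule (X : Bim k R S) : Module Sᵐᵒᵖ X.carrier :=
  Module.compHom X.carrier (X.r : Sᵐᵒᵖ →+* Module.End k X.carrier)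

/-- `X` is a union of projectives as a left `R`-module and as a right `S`-module. -/
def Bim.UnionOfProjectives (X : Bim k R S) : Prop :=
  (letI := X.leftModule; IsUnionOfProjectives R X.carrier) ∧
  (letI := X.rightModule; IsUnionOfProjectives Sᵐᵒᵖ X.carrier)

/-! ### The objects, 1-cells and 2-cells -/

variable (k) in
/-- Coalgebroids `(A, R)` with `R` hereditary and `A` a union of projectives on both sides. -/
structure HCoalgebroid extends Coalgebroid.{w, u} k where
  hereditary : IsHereditary R
  union : A.toBim.UnionOfProjectives

/-- Comodules that are unions of projectives on both sides. -/
structure HComodule (𝒜 ℬ : HCoalgebroid.{w, u} k) extends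
    Comodule 𝒜.toCoalgebroid ℬ.toCoalgebroid where
  union : M.toBim.UnionOfProjectives

instance (𝒜 ℬ : HCoalgebroid.{w, u} k) : Category.{u} (HComodule 𝒜 ℬ) where
  Hom M N := M.toComodule.Hom N.toComodule
  id M := Comodule.Hom.id M.toComodule
  comp f g := f.comp g

/-- The bimodule homomorphism underlying a homomorphism of comodules. -/
def bimHom {𝒜 ℬ : HCoalgebroid.{w, u} k} {M N : HComodule 𝒜 ℬ} (f : M ⟶ N) :
    M.M.toBim.Hom N.M.toBim :=
  (Comodule.Hom.toQHom f).toBimHom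

/-! ### The bicategory -/

variable (k) in
/-- A bicategory whose objects are the coalgebroids `(A, R)` with `R` hereditary and `A` a union of
projectives on both sides, whose 1-cells and 2-cells are the comodules that are unions of projectives
on both sides and their homomorphisms, with composition `•`. -/
structure BulletBicategory where
  [bicategory : Bicategory.{u, max w (u + 1)} (HCoalgebroid.{w, u} k)]
  /-- The category of 1-cells from `𝒜` to `ℬ` is isomorphic to the category of comodules. -/
  cell (𝒜 ℬ : HCoalgebroid.{w, u} k) : (𝒜 ⟶ ℬ) ⥤ HComodule 𝒜 ℬ
  cell_isEquivalence (𝒜 ℬ) : (cell 𝒜 ℬ).IsEquivalence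
  cell_bijective (𝒜 ℬ) : Function.Bijective (cell 𝒜 ℬ).obj
  /-- The identity 1-cell on `(A, R)` is `A`. -/
  unit (𝒜 : HCoalgebroid.{w, u} k) : ((cell 𝒜 𝒜).obj (𝟙 𝒜)).M.Hom 𝒜.A
  unit_bijective (𝒜) : Function.Bijective (unit 𝒜).lin
  /-- The coaction of `A` on itself is `a ↦ a₁ ⊗ a₂ ⊗ a₃`. -/
  unit_coact (𝒜) :
    ((cell 𝒜 𝒜).obj (𝟙 𝒜)).coact.ten3.comp
        ((Bim.Hom.id 𝒜.B).tens ((unit 𝒜).toBimHom.tens (Bim.Hom.id 𝒜.B))) =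
      (unit 𝒜).toBimHom.comp
        (𝒜.comul.ten2.comp ((Bim.Hom.id 𝒜.B).tens 𝒜.comul.ten2))
  /-- The composite of `M` and `N` is `M • N`. -/
  incl {𝒜 ℬ 𝒞 : HCoalgebroid.{w, u} k} (M : 𝒜 ⟶ ℬ) (N : ℬ ⟶ 𝒞) :
    ((cell 𝒜 𝒞).obj (M ≫ N)).M.Hom (((cell 𝒜 ℬ).obj M).M.tens ((cell ℬ 𝒞).obj N).M)
  incl_injective {𝒜 ℬ 𝒞} (M : 𝒜 ⟶ ℬ) (N : ℬ ⟶ 𝒞) : Function.Injective (incl M N).lin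
  incl_range {𝒜 ℬ 𝒞} (M : 𝒜 ⟶ ℬ) (N : ℬ ⟶ 𝒞) : LinearMap.range (incl M N).lin =
    bullet ((cell 𝒜 ℬ).obj M).toComodule ((cell ℬ 𝒞).obj N).toComodule
  /-- The coaction of `M • N` is induced by the left coaction of `M` and the right coaction of `N`. -/
  incl_coact {𝒜 ℬ 𝒞} (M : 𝒜 ⟶ ℬ) (N : ℬ ⟶ 𝒞) :
    (((cell 𝒜 𝒞).obj (M ≫ N)).coact.ten3.comp
        ((Bim.Hom.id 𝒜.B).tens ((incl M N).toBimHom.tens (Bim.Hom.id 𝒞.B)))).comp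
        ((Bim.Hom.id 𝒜.B).tens (assoc _ _ 𝒞.B)) =
      ((incl M N).toBimHom.comp
        (((cell 𝒜 ℬ).obj M).left.tens ((cell ℬ 𝒞).obj N).right)).comp (assoc 𝒜.B _ _)
  /-- Horizontal composition of 2-cells is induced by the tensor product of homomorphisms. -/
  whiskerLeft_incl {𝒜 ℬ 𝒞} (M : 𝒜 ⟶ ℬ) {N N' : ℬ ⟶ 𝒞} (g : N ⟶ N') :
    (bimHom ((cell 𝒜 𝒞).map (Bicategory.whiskerLeft M g))).comp (incl M N').toBimHom =
      (incl M N).toBimHom.comp ((Bim.Hom.id _).tens (bimHom ((cell ℬ 𝒞).map g)))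
  whiskerRight_incl {𝒜 ℬ 𝒞} {M M' : 𝒜 ⟶ ℬ} (f : M ⟶ M') (N : ℬ ⟶ 𝒞) :
    (bimHom ((cell 𝒜 𝒞).map (Bicategory.whiskerRight f N))).comp (incl M' N).toBimHom =
      (incl M N).toBimHom.comp ((bimHom ((cell 𝒜 ℬ).map f)).tens (Bim.Hom.id _))
  /-- The associator is induced by `(m ⊗ n) ⊗ p ↦ m ⊗ (n ⊗ p)`. -/
  associator_incl {𝒜 ℬ 𝒞 𝒟} (M : 𝒜 ⟶ ℬ) (N : ℬ ⟶ 𝒞) (P : 𝒞 ⟶ 𝒟) :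
    ((bimHom ((cell 𝒜 𝒟).map (Bicategory.associator M N P).hom)).comp
        (incl M (N ≫ P)).toBimHom).comp ((Bim.Hom.id _).tens (incl N P).toBimHom) =
      ((incl (M ≫ N) P).toBimHom.comp
        ((incl M N).toBimHom.tens (Bim.Hom.id _))).comp (assoc _ _ _)
  /-- The left unitor `A • M → M` is the inverse of the left coaction `M → A ⊗ M`. -/
  leftUnitor_incl {𝒜 ℬ} (M : 𝒜 ⟶ ℬ) :
    (bimHom ((cell 𝒜 ℬ).map (Bicategory.leftUnitor M).hom)).comp ((cell 𝒜 ℬ).obj M).left =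
      (incl (𝟙 𝒜) M).toBimHom.comp ((unit 𝒜).toBimHom.tens (Bim.Hom.id _))
  /-- The right unitor `M • A' → M` is the inverse of the right coaction `M → M ⊗ A'`. -/
  rightUnitor_incl {𝒜 ℬ} (M : 𝒜 ⟶ ℬ) :
    (bimHom ((cell 𝒜 ℬ).map (Bicategory.rightUnitor M).hom)).comp ((cell 𝒜 ℬ).obj M).right =
      (incl M (𝟙 ℬ)).toBimHom.comp ((Bim.Hom.id _).tens (unit ℬ).toBimHom)

end Coalgebroids

namespace Coalgebroids

open Bicategory

/-! ### The bicategory of algebras and bimodules -/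

section BimBicategory

variable {k : Type w} [CommRing k] {R : Type u} [Ring R] [Algebra k R]
  {S : Type u} [Ring S] [Algebra k S] {T : Type u} [Ring T] [Algebra k T]
  {U : Type u} [Ring U] [Algebra k U]

/-! A bimodule over `Rᵐᵒᵖ ⊗ S` is treated as an ordinary `R`-`S`-bimodule with extra commuting
endomorphisms, the actions `lo` and `lt`. Ordinary bimodules form a bicategory. In it a coalgebroid
is a comonad (coring), and a comodule is a 1-cell with commuting left and right coactions compatible
with the extra endomorphisms (`Bicoaction.ofCoact`, `Comodule.compatible`, `Bicoaction.toComodule`).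
The composite `M • N` is cut out of `M ⊗ N` by the cotensor equation and by one Takeuchi equation
for every element of the middle algebra: it is a joint equalizer of a possibly infinite family.

The difficulty is that tensoring need not preserve such a subobject, so that neither the coactions
on `M • N` nor associativity come for free. The hypotheses serve exactly this purpose. A relation `∑
xᵢ ⊗ yᵢ = 0` with the `xᵢ` in a locally projective module is witnessed by finitely supported
coefficients (`IsBalTensor.vanishing`), which gives flatness. Flatness alone handles finitely many
equations; if the targets of the equations are locally projective as well, coordinates on a
projective submodule split an element of `X ⊗ Y` into pieces each of which satisfies all the
equations (`IsBalTensor.exists_rep_of_forall_sum_eq_zero`). Over hereditary rings, unions of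
projectives are closed under subobjects and under tensor products
(`IsBalTensor.isUnionOfProjectives`), so the targets qualify and `M • N` stays in the class.

Hence `A ⊗ (M • N)` is the joint equalizer of the tensored equations inside `A ⊗ M ⊗ N`, and the
left coaction of `M` restricts to it because it commutes with the right one; the other side is
symmetric. Likewise both bracketings of a triple composite are the same subobject of `M ⊗ N ⊗ P`.
The left coaction identifies `M` with `A • M`, the inverse being contraction with the counit, and
similarly on the right. Finally the inclusions into tensor products remain monic after tensoring
with the 1-cells that occur, so every coherence law can be checked in the bicategory of bimodules
(`SubComposition`). -/

theorem Bim.tens_induction {X : Bim k R S} {Y : Bim k S T} {p : (X.tens Y).carrier → Prop}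
    (t : (X.tens Y).carrier) (zero : p 0) (tmul : ∀ x y, p (X.tmul Y x y))
    (add : ∀ s t, p s → p t → p (s + t)) : p t := by
  obtain ⟨t, rfl⟩ := Submodule.mkQ_surjective _ t
  induction t using TensorProduct.induction_on with
  | zero => rwa [map_zero]
  | tmul x y => exact tmul x y
  | add s t hs ht => rw [map_add]; exact add _ _ hs ht

instance (R : Type u) [Ring R] [Algebra k R] (S : Type u) [Ring S] [Algebra k S] :
    Category.{u} (Bim k R S) where
  Hom X Y := X.Hom Y
  id X := Bim.Hom.id X
  comp f g := f.comp g

theorem Bim.hom_ext {X Y : Bim k R S} {f g : X ⟶ Y}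
    (h : ∀ x, Bim.Hom.lin f x = Bim.Hom.lin g x) : f = g :=
  Bim.Hom.ext (LinearMap.ext h)

@[simp]
theorem Bim.comp_lin {X Y Z : Bim k R S} (f : X ⟶ Y) (g : Y ⟶ Z) (x : X.carrier) :
    Bim.Hom.lin (f ≫ g) x = Bim.Hom.lin g (Bim.Hom.lin f x) := rfl

@[simp]
theorem Bim.id_lin (X : Bim k R S) (x : X.carrier) : Bim.Hom.lin (𝟙 X) x = x := rfl

theorem Bim.tens_hom_ext {X : Bim k R S} {Y : Bim k S T} {Z : Bim k R T} {f g : X.tens Y ⟶ Z}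
    (h : ∀ x y, Bim.Hom.lin f (X.tmul Y x y) = Bim.Hom.lin g (X.tmul Y x y)) : f = g :=
  Bim.hom_ext fun t => Bim.tens_ext (Bim.Hom.lin f) (Bim.Hom.lin g) h t

theorem Bim.tmul_add_left (X : Bim k R S) (Y : Bim k S T) (x x' : X.carrier) (y : Y.carrier) :
    X.tmul Y (x + x') y = X.tmul Y x y + X.tmul Y x' y := tmk_add_left X Y x x' y

theorem Bim.tmul_zero_left (X : Bim k R S) (Y : Bim k S T) (y : Y.carrier) :
    X.tmul Y 0 y = 0 := by rw [← Bim.tmulL_apply, map_zero, LinearMap.zero_apply]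

@[simp]
theorem Bim.Hom.tens_lin_tmul {X X' : Bim k R S} {Y Y' : Bim k S T} (f : X.Hom X') (g : Y.Hom Y')
    (x y) : (f.tens g).lin (X.tmul Y x y) = X'.tmul Y' (f.lin x) (g.lin y) :=
  f.tensLin_tmul g x y

@[simp]
theorem assoc_lin_tmul (X : Bim k R S) (Y : Bim k S T) (Z : Bim k T U) (x y z) :
    (assoc X Y Z).lin ((X.tens Y).tmul Z (X.tmul Y x y) z) =
      X.tmul (Y.tens Z) x (Y.tmul Z y z) :=
  assocLin_tmul X Y Z x y z

/-- `y ⊗ z ↦ (x ⊗ y) ⊗ z`, as a function of `x`. -/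
def assocInvAux (X : Bim k R S) (Y : Bim k S T) (Z : Bim k T U) :
    (Y.tens Z).carrier →ₗ[k] X.carrier →ₗ[k] ((X.tens Y).tens Z).carrier :=
  Bim.lift (((LinearMap.llcomp k X.carrier (X.tens Y).carrier ((X.tens Y).tens Z).carrier ∘ₗ
      ((X.tens Y).tmulL Z).flip).compl₂ (X.tmulL Y).flip).flip)
    (fun s y z => by
      ext x
      simp only [LinearMap.flip_apply, LinearMap.compl₂_apply, LinearMap.comp_apply,
        LinearMap.llcomp_apply, Bim.tmulL_apply]
      rw [← Bim.tens_r_tmul, Bim.tmul_bal])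

@[simp]
theorem assocInvAux_tmul (X : Bim k R S) (Y : Bim k S T) (Z : Bim k T U) (x y z) :
    assocInvAux X Y Z (Y.tmul Z y z) x = (X.tens Y).tmul Z (X.tmul Y x y) z := by
  simp [assocInvAux]

/-- The map `x ⊗ (y ⊗ z) ↦ (x ⊗ y) ⊗ z`. -/
def assocInvLin (X : Bim k R S) (Y : Bim k S T) (Z : Bim k T U) :
    (X.tens (Y.tens Z)).carrier →ₗ[k] ((X.tens Y).tens Z).carrier :=
  Bim.lift (assocInvAux X Y Z).flip
    (fun s x q => Bim.tens_ext
      (((assocInvAux X Y Z).flip (X.r (op s) x))) ((assocInvAux X Y Z).flip x ∘ₗ (Y.tens Z).l s)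
      (fun y z => by simp [Bim.tmul_bal]) q)

@[simp]
theorem assocInvLin_tmul (X : Bim k R S) (Y : Bim k S T) (Z : Bim k T U) (x y z) :
    assocInvLin X Y Z (X.tmul (Y.tens Z) x (Y.tmul Z y z)) =
      (X.tens Y).tmul Z (X.tmul Y x y) z :=
  (Bim.lift_tmul _ _ _ _).trans (assocInvAux_tmul X Y Z x y z)

theorem assocInvLin_assoc (X : Bim k R S) (Y : Bim k S T) (Z : Bim k T U) (t) :
    assocInvLin X Y Z ((assoc X Y Z).lin t) = t :=
  Bim.tens_ext₃ (assocInvLin X Y Z ∘ₗ (assoc X Y Z).lin) LinearMap.id (fun x y z => by simp) t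

theorem assoc_assocInvLin (X : Bim k R S) (Y : Bim k S T) (Z : Bim k T U) (t) :
    (assoc X Y Z).lin (assocInvLin X Y Z t) = t := by
  refine Bim.tens_ext ((assoc X Y Z).lin ∘ₗ assocInvLin X Y Z) LinearMap.id (fun x q => ?_) t
  exact Bim.tens_ext ((assoc X Y Z).lin ∘ₗ assocInvLin X Y Z ∘ₗ X.tmulL _ x) (X.tmulL _ x)
    (fun y z => by simp) q

/-- A bijective homomorphism of bimodules is invertible. -/
def Bim.isoOfInverse {X Y : Bim k R S} (f : X ⟶ Y) (g : Y.carrier →ₗ[k] X.carrier)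
    (hfg : ∀ x, g (Bim.Hom.lin f x) = x) (hgf : ∀ y, Bim.Hom.lin f (g y) = y) : X ≅ Y where
  hom := f
  inv :=
    { lin := g
      map_l := fun a y => by
        conv_lhs => rw [← hgf y, ← Bim.Hom.map_l f, hfg]
      map_r := fun a y => by
        conv_lhs => rw [← hgf y, ← Bim.Hom.map_r f, hfg] }
  hom_inv_id := Bim.hom_ext hfg
  inv_hom_id := Bim.hom_ext hgf

/-- The regular bimodule. -/
@[reducible]
def Bim.regular (k : Type w) [CommRing k] (R : Type u) [Ring R] [Algebra k R] : Bim k R R where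
  carrier := R
  l := Algebra.lmul k R
  r := AlgHom.ofLinearMap
    { toFun := fun b => LinearMap.mulRight k b.unop
      map_add' := fun a b => by ext x; simp [mul_add]
      map_smul' := fun c a => by ext x; simp }
    (by ext x; simp) (fun a b => by ext x; simp [mul_assoc])
  l_r a b x := (mul_assoc a x b.unop).symm

@[simp]
theorem Bim.regular_l (a x : R) : (Bim.regular k R).l a x = (a * x : R) := rfl

@[simp]
theorem Bim.regular_r (a : Rᵐᵒᵖ) (x : R) : (Bim.regular k R).r a x = (x * a.unop : R) := rfl

/-- The map `R ⊗_R X → X`. -/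
def lunitLin (X : Bim k R S) : ((Bim.regular k R).tens X).carrier →ₗ[k] X.carrier :=
  Bim.lift (X := Bim.regular k R) X.l.toLinearMap (fun s a x => by simp)

@[simp]
theorem lunitLin_tmul (X : Bim k R S) (a : R) (x) :
    lunitLin X ((Bim.regular k R).tmul X a x) = X.l a x :=
  Bim.lift_tmul _ _ _ _

/-- The map `X ⊗_S S → X`. -/
def runitLin (X : Bim k R S) : (X.tens (Bim.regular k S)).carrier →ₗ[k] X.carrier :=
  Bim.lift (Y := Bim.regular k S)
    (X.r.toLinearMap ∘ₗ (opLinearEquiv k : S ≃ₗ[k] Sᵐᵒᵖ).toLinearMap).flip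
    (fun s x a => by simp)

@[simp]
theorem runitLin_tmul (X : Bim k R S) (x) (a : S) :
    runitLin X (X.tmul (Bim.regular k S) x a) = X.r (op a) x :=
  Bim.lift_tmul _ _ _ _

/-- The isomorphism `R ⊗_R X ≅ X`. -/
def lunit (X : Bim k R S) : (Bim.regular k R).tens X ≅ X :=
  Bim.isoOfInverse
    { lin := lunitLin X
      map_l := fun a => Bim.tens_ext (lunitLin X ∘ₗ ((Bim.regular k R).tens X).l a)
        (X.l a ∘ₗ lunitLin X) (fun b x => by simp)
      map_r := fun a => Bim.tens_ext (lunitLin X ∘ₗ ((Bim.regular k R).tens X).r a)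
        (X.r a ∘ₗ lunitLin X) (fun b x => by simp [X.l_r]) }
    ((Bim.regular k R).tmulL X (1 : R))
    (Bim.tens_ext ((Bim.regular k R).tmulL X (1 : R) ∘ₗ lunitLin X) LinearMap.id
      (fun (a : R) x => by
        refine ((Bim.regular k R).tmul_bal X a (1 : R) x).symm.trans ?_
        rw [Bim.regular_r, unop_op, one_mul, LinearMap.id_apply]))
    (fun x => by
      rw [Bim.tmulL_apply]
      exact (lunitLin_tmul X 1 x).trans (by simp))

/-- The isomorphism `X ⊗_S S ≅ X`. -/
def runit (X : Bim k R S) : X.tens (Bim.regular k S) ≅ X :=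
  Bim.isoOfInverse
    { lin := runitLin X
      map_l := fun a => Bim.tens_ext (runitLin X ∘ₗ (X.tens (Bim.regular k S)).l a)
        (X.l a ∘ₗ runitLin X) (fun b x => by simp [X.l_r])
      map_r := fun a => Bim.tens_ext (runitLin X ∘ₗ (X.tens (Bim.regular k S)).r a)
        (X.r a ∘ₗ runitLin X) (fun b (x : S) => by simp) }
    ((X.tmulL (Bim.regular k S)).flip (1 : S))
    (Bim.tens_ext ((X.tmulL (Bim.regular k S)).flip (1 : S) ∘ₗ runitLin X) LinearMap.id
      (fun x (a : S) => by
        refine (X.tmul_bal (Bim.regular k S) a x (1 : S)).trans ?_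
        rw [Bim.regular_l, mul_one, LinearMap.id_apply]))
    (fun x => (runitLin_tmul X x 1).trans (by simp))

@[simp]
theorem lunit_hom_tmul (X : Bim k R S) (a : R) (x) :
    Bim.Hom.lin (lunit X).hom ((Bim.regular k R).tmul X a x) = X.l a x := lunitLin_tmul X a x

@[simp]
theorem runit_hom_tmul (X : Bim k R S) (x) (a : S) :
    Bim.Hom.lin (runit X).hom (X.tmul (Bim.regular k S) x a) = X.r (op a) x := runitLin_tmul X x a

/-- The associativity isomorphism. -/
def assocIso (X : Bim k R S) (Y : Bim k S T) (Z : Bim k T U) :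
    (X.tens Y).tens Z ≅ X.tens (Y.tens Z) :=
  Bim.isoOfInverse (assoc X Y Z) (assocInvLin X Y Z) (assocInvLin_assoc X Y Z)
    (assoc_assocInvLin X Y Z)

@[simp]
theorem assocIso_hom_tmul (X : Bim k R S) (Y : Bim k S T) (Z : Bim k T U) (x y z) :
    Bim.Hom.lin (assocIso X Y Z).hom ((X.tens Y).tmul Z (X.tmul Y x y) z) =
      X.tmul (Y.tens Z) x (Y.tmul Z y z) :=
  assocLin_tmul X Y Z x y z

@[simp]
theorem Bim.Hom.id_lin (X : Bim k R S) (x : X.carrier) : (Bim.Hom.id X).lin x = x := rfl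

end BimBicategory

/-- A `k`-algebra, as an object of the bicategory of bimodules. -/
structure AlgObj (k : Type w) [CommRing k] where
  R : Type u
  [ring : Ring R]
  [algebra : Algebra k R]

attribute [instance] AlgObj.ring AlgObj.algebra

section

variable {k : Type w} [CommRing k] {R : Type u} [Ring R] [Algebra k R]
  {S : Type u} [Ring S] [Algebra k S] {T : Type u} [Ring T] [Algebra k T]
  {U : Type u} [Ring U] [Algebra k U]

theorem Bim.tens_hom_ext₃ {X : Bim k R S} {Y : Bim k S T} {Z : Bim k T U} {W : Bim k R U}
    {f g : (X.tens Y).tens Z ⟶ W}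
    (h : ∀ x y z, Bim.Hom.lin f ((X.tens Y).tmul Z (X.tmul Y x y) z) =
      Bim.Hom.lin g ((X.tens Y).tmul Z (X.tmul Y x y) z)) : f = g :=
  Bim.hom_ext (Bim.tens_ext₃ (Bim.Hom.lin f) (Bim.Hom.lin g) h)

/-- Turns naturality squares into the conjugated form in which the bicategory axioms are stated. -/
theorem eq_conj_of_comp_eq {C : Type*} [Category* C] {X Y X' Y' : C} {e : X ≅ Y} {e' : X' ≅ Y'}
    {f : X ⟶ X'} {g : Y ⟶ Y'} (h : f ≫ e'.hom = e.hom ≫ g) : f = e.hom ≫ g ≫ e'.inv := by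
  rw [← Category.assoc, ← h, Category.assoc, e'.hom_inv_id, Category.comp_id]

theorem eq_inv_conj_of_comp_eq {C : Type*} [Category* C] {X Y X' Y' : C} {e : Y ≅ X} {e' : Y' ≅ X'}
    {f : X ⟶ X'} {g : Y ⟶ Y'} (h : e.hom ≫ f = g ≫ e'.hom) : f = e.inv ≫ g ≫ e'.hom := by
  rw [← h, e.inv_hom_id_assoc]

/-- The ambient bicategory. All later manipulations of tensor factors take place here, where the
coherence isomorphisms can be handled by `bicategory`. -/
instance : Bicategory.{u, max w (u + 1)} (AlgObj.{w, u} k) where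
  Hom a b := Bim k a.R b.R
  id a := Bim.regular k a.R
  comp X Y := X.tens Y
  homCategory a b := inferInstanceAs (Category (Bim k a.R b.R))
  whiskerLeft X _ _ g := (Bim.Hom.id X).tens g
  whiskerRight f Y := f.tens (Bim.Hom.id Y)
  associator X Y Z := assocIso X Y Z
  leftUnitor X := lunit X
  rightUnitor X := runit X
  whiskerLeft_id X Y := Bim.Hom.id_tens_id X Y
  whiskerLeft_comp X _ _ _ f g := Bim.Hom.comp_tens_comp (Bim.Hom.id X) (Bim.Hom.id X) f g
  id_whiskerLeft f := eq_conj_of_comp_eq (Bim.tens_hom_ext fun x y => by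
    simp [Bim.Hom.map_l]
    rfl)
  comp_whiskerLeft X Y Z Z' f := eq_conj_of_comp_eq (Bim.tens_hom_ext₃ fun x y z => by simp)
  id_whiskerRight X Y := Bim.Hom.id_tens_id X Y
  comp_whiskerRight f g X := Bim.Hom.comp_tens_comp f g (Bim.Hom.id X) (Bim.Hom.id X)
  whiskerRight_id f := eq_conj_of_comp_eq (Bim.tens_hom_ext fun x y => by
    simp [Bim.Hom.map_r]
    rfl)
  whiskerRight_comp f X Y := eq_inv_conj_of_comp_eq (Bim.tens_hom_ext₃ fun x y z => by simp)
  whisker_assoc X Y Y' f Z := eq_conj_of_comp_eq (Bim.tens_hom_ext₃ fun x y z => by simp)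
  whisker_exchange f g := Bim.tens_hom_ext fun x y => by simp
  pentagon X Y Z W := Bim.tens_hom_ext fun t w => by
    induction t using Bim.tens_induction with
    | zero => simp only [Bim.tmul_zero_left, map_zero]
    | add s t hs ht => simp only [Bim.tmul_add_left, map_add, hs, ht]
    | tmul t z =>
      induction t using Bim.tens_induction with
      | zero => simp only [Bim.tmul_zero_left, map_zero]
      | add s t hs ht => simp only [Bim.tmul_add_left, map_add, hs, ht]
      | tmul x y => simp
  triangle X Y := Bim.tens_hom_ext₃ fun x y z => by
    simp [Bim.tmul_bal]

end

/-! ### Locally projective modules and balanced tensor products -/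

/-- Every finite subset lies in a projective submodule. -/
def LocallyProjective (R : Type u) [Ring R] (X : Type u) [AddCommGroup X] [Module R X] : Prop :=
  ∀ Z : Finset X, ∃ P : Submodule R X, Module.Projective R P ∧ ∀ z ∈ Z, z ∈ P

/-- Directedness absorbs the elements of a finite set one at a time. Only this consequence of the
hypothesis is used for flatness. -/
theorem IsUnionOfProjectives.locallyProjective {R : Type u} [Ring R] {X : Type u} [AddCommGroup X]
    [Module R X] (h : IsUnionOfProjectives R X) : LocallyProjective R X := by
  classical
  obtain ⟨D, ⟨P₀, hP₀⟩, hdir, hproj, hcov⟩ := h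
  have key : ∀ Z : Finset X, ∃ P ∈ D, ∀ z ∈ Z, z ∈ P := fun Z => by
    induction Z using Finset.induction_on with
    | empty => exact ⟨P₀, hP₀, by simp⟩
    | insert a Z _ ih =>
      obtain ⟨P, hP, hZ⟩ := ih
      obtain ⟨Q, hQ, ha⟩ := hcov a
      obtain ⟨N, hN, hPN, hQN⟩ := hdir P hP Q hQ
      refine ⟨N, hN, fun z hz => ?_⟩
      rcases Finset.mem_insert.1 hz with rfl | hz
      · exact hQN ha
      · exact hPN (hZ z hz)
  intro Z
  obtain ⟨P, hP, hZ⟩ := key Z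
  exact ⟨P, hproj P hP, hZ⟩

/-- Submodules of projective modules are projective. -/
def SubmodulesProjective (R : Type u) [Ring R] : Prop :=
  ∀ (P : Type u) [AddCommGroup P] [Module R P], Module.Projective R P →
    ∀ N : Submodule R P, Module.Projective R N

/-! ### Locally projective modules over hereditary rings -/

section Hereditary

variable {R : Type u} [Ring R] {X : Type u} [AddCommGroup X] [Module R X]

theorem SubmodulesProjective.of_injective (hR : SubmodulesProjective R) {N P : Type u}
    [AddCommGroup N] [Module R N] [AddCommGroup P] [Module R P] [hP : Module.Projective R P]
    (f : N →ₗ[R] P) (hf : Function.Injective f) : Module.Projective R N :=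
  have := hR P hP (LinearMap.range f)
  Module.Projective.of_equiv' (LinearEquiv.ofInjective f hf).symm

theorem SubmodulesProjective.of_le (hR : SubmodulesProjective R) {N P : Submodule R X}
    (hP : Module.Projective R P) (h : N ≤ P) : Module.Projective R N :=
  hR.of_injective (Submodule.inclusion h) (Submodule.inclusion_injective h)

/-- A finite generating set lies in some projective submodule, which then contains the whole span;
heredity finishes. -/
theorem LocallyProjective.projective_of_fg (hR : SubmodulesProjective R)
    (hX : LocallyProjective R X) {N : Submodule R X} (hN : N.FG) : Module.Projective R N := by
  obtain ⟨Z, rfl⟩ := hN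
  obtain ⟨P, hP, hZ⟩ := hX Z
  exact hR.of_le hP (Submodule.span_le.2 hZ)

/-- The finitely generated submodules always form a directed cover. With the preceding lemma this
makes the class closed under submodules over a hereditary ring. -/
theorem isUnionOfProjectives_of_fg
    (h : ∀ N : Submodule R X, N.FG → Module.Projective R N) : IsUnionOfProjectives R X :=
  ⟨{N | N.FG}, ⟨⊥, Submodule.fg_bot⟩, fun N hN P hP => ⟨N ⊔ P, hN.sup hP, le_sup_left, le_sup_right⟩,
    h, fun x => ⟨Submodule.span R {x}, Submodule.fg_span_singleton x,
      Submodule.mem_span_singleton_self x⟩⟩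

theorem IsUnionOfProjectives.of_injective (hR : SubmodulesProjective R)
    (hX : IsUnionOfProjectives R X) {E : Type u} [AddCommGroup E] [Module R E] (f : E →ₗ[R] X)
    (hf : Function.Injective f) : IsUnionOfProjectives R E :=
  isUnionOfProjectives_of_fg fun N hN => by
    have := hX.locallyProjective.projective_of_fg hR (hN.map f)
    exact Module.Projective.of_equiv' (Submodule.equivMapOfInjective f hf N).symm

theorem LocallyProjective.finsupp (hX : LocallyProjective R X) (ι : Type u) :
    LocallyProjective R (ι →₀ X) := by
  classical
  intro Z
  -- Finitely many finitely supported functions take finitely many nonzero values. One projective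
  -- `P` containing these values makes the functions elements of the direct sum of copies of `P`.
  obtain ⟨P, hP, hZ⟩ := hX (Z.biUnion fun f => f.support.image f)
  have : Module.Projective R (ι →₀ P) :=
    Module.Projective.of_equiv' (finsuppLequivDFinsupp R (M := P) (ι := ι)).symm
  refine ⟨LinearMap.range (Finsupp.mapRange.linearMap (α := ι) P.subtype),
    Module.Projective.of_equiv' (LinearEquiv.ofInjective _
      (Finsupp.mapRange_injective _ rfl P.subtype_injective)), fun f hf => ?_⟩
  have hmem : ∀ i, f i ∈ P := fun i => by
    by_cases hi : f i = 0
    · rw [hi]; exact P.zero_mem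
    · exact hZ _ (Finset.mem_biUnion.2 ⟨f, hf, Finset.mem_image_of_mem _ (Finsupp.mem_support_iff.2 hi)⟩)
  refine ⟨Finsupp.onFinset f.support (fun i => ⟨f i, hmem i⟩) (fun i hi => ?_), ?_⟩
  · rw [Finsupp.mem_support_iff]
    exact fun h => hi (Subtype.ext h)
  · ext i
    simp

end Hereditary

/-- `β : X × Y → W` presents `W` as the tensor product of `X` and `Y` over an algebra acting on `X`
through `S'` and on `Y` through `S`, where `τ : S' → S` is an anti-isomorphism. -/
structure IsBalTensor {k : Type w} [CommRing k] {S' S : Type u} [Ring S'] [Algebra k S'] [Ring S]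
    [Algebra k S] (τ : S' ≃ₗ[k] S) {X Y W : Type u} [AddCommGroup X] [Module k X] [Module S' X]
    [AddCommGroup Y] [Module k Y] [Module S Y] [AddCommGroup W] [Module k W]
    (β : X →ₗ[k] Y →ₗ[k] W) : Prop where
  anti : ∀ a b, τ (a * b) = τ b * τ a
  bal : ∀ a x y, β (a • x) y = β x (τ a • y)
  exists_rep : ∀ t, ∃ (n : ℕ) (x : Fin n → X) (y : Fin n → Y), t = ∑ i, β (x i) (y i)
  exists_lift : ∀ {P : Type u} [AddCommGroup P] [Module k P] (γ : X →ₗ[k] Y →ₗ[k] P),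
    (∀ a x y, γ (a • x) y = γ x (τ a • y)) → ∃ g : W →ₗ[k] P, ∀ x y, g (β x y) = γ x y

/-! ### The equational criterion for vanishing in a tensor product -/

namespace IsBalTensor

variable {k : Type w} [CommRing k] {S' S : Type u} [Ring S'] [Algebra k S'] [Ring S]
    [Algebra k S] {τ : S' ≃ₗ[k] S} {X Y W : Type u} [AddCommGroup X] [Module k X] [Module S' X]
    [AddCommGroup Y] [Module k Y] [Module S Y] [AddCommGroup W] [Module k W]
    {β : X →ₗ[k] Y →ₗ[k] W}

/-- The point of allowing an anti-isomorphism `τ`: the roles of left and right can be exchanged, so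
each result below is proved on one side only. -/
theorem flip (h : IsBalTensor τ β) : IsBalTensor τ.symm β.flip where
  anti a b := by
    rw [LinearEquiv.symm_apply_eq, h.anti, τ.apply_symm_apply, τ.apply_symm_apply]
  bal a y x := by simp [h.bal]
  exists_rep t := by
    obtain ⟨n, x, y, ht⟩ := h.exists_rep t
    exact ⟨n, y, x, ht⟩
  exists_lift γ hγ := by
    obtain ⟨g, hg⟩ := h.exists_lift γ.flip (fun a x y => by simp [hγ])
    exact ⟨g, fun y x => hg x y⟩

variable {ι : Type*} [Fintype ι]

/-- Expand the first factors in the `v c`, move the coefficients across the tensor sign and collect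
by `c`. The set `T` only has to contain the supports. -/
theorem sum_eq_sum_support (h : IsBalTensor τ β) {κ : Type*} (v : κ → X) (σ : ι → κ →₀ S')
    (y : ι → Y) : ∃ T : Finset κ, ∑ i, β (Finsupp.linearCombination S' v (σ i)) (y i) =
      ∑ c ∈ T, β (v c) (∑ i, τ (σ i c) • y i) := by
  classical
  refine ⟨Finset.univ.biUnion fun i => (σ i).support, ?_⟩
  simp only [map_sum]
  rw [Finset.sum_comm]
  refine Finset.sum_congr rfl fun i _ => ?_
  rw [Finsupp.linearCombination_apply, Finsupp.sum_of_support_subset (σ i)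
    (Finset.subset_biUnion_of_mem (fun i => (σ i).support) (Finset.mem_univ i)) _ (by simp),
    map_sum, LinearMap.sum_apply]
  exact Finset.sum_congr rfl fun c _ => h.bal _ _ _

/-- Expanding `x` in coordinates on a projective submodule would give a map out of the tensor
product, but no single projective submodule contains all of `X`. So the coordinates are taken for
all finite `Z` at once, in a product over `Z`, and families that vanish for all large `Z` are
divided out. The resulting map is bilinear and balanced; evaluating it on the zero sum and choosing
`Z` large gives the coefficients. -/
theorem vanishing [IsScalarTower k S' X] [IsScalarTower k S Y] (h : IsBalTensor τ β)
    (hX : LocallyProjective S' X) (x : ι → X) (y : ι → Y) (h0 : ∑ i, β (x i) (y i) = 0) :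
    ∃ (κ : Type u) (v : κ → X) (σ : ι → κ →₀ S'),
      (∀ i, x i = Finsupp.linearCombination S' v (σ i)) ∧ ∀ c, ∑ i, τ (σ i c) • y i = 0 := by
  classical
  choose P hP hZ using hX
  choose s hs using fun Z => (hP Z).out
  -- The value `0` outside `P Z` is harmless: any given `x` lies in `P Z` as soon as `Z` contains
  -- it.
  let c : ∀ Z : Finset X, X → P Z → S' := fun Z x p => if hx : x ∈ P Z then s Z ⟨x, hx⟩ p else 0
  -- The families of functions that are eventually zero along the finite subsets of `X`.
  let N : Submodule k (∀ Z : Finset X, P Z → Y) :=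
    { carrier := {g | ∃ Z₀ : Finset X, ∀ Z, Z₀ ⊆ Z → g Z = 0}
      zero_mem' := ⟨∅, fun _ _ => rfl⟩
      add_mem' := by
        rintro f g ⟨Z₁, h₁⟩ ⟨Z₂, h₂⟩
        refine ⟨Z₁ ∪ Z₂, fun Z hZ => ?_⟩
        rw [Pi.add_apply, h₁ Z (Finset.union_subset_left hZ), h₂ Z (Finset.union_subset_right hZ),
          add_zero]
      smul_mem' := by
        rintro a f ⟨Z₁, h₁⟩
        exact ⟨Z₁, fun Z hZ => by rw [Pi.smul_apply, h₁ Z hZ, smul_zero]⟩ }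
  let G : X → Y → ∀ Z : Finset X, P Z → Y := fun x y Z p => τ (c Z x p) • y
  have mem : ∀ (Z : Finset X) x, {x} ⊆ Z → x ∈ P Z := fun Z x hx =>
    hZ Z x (hx (Finset.mem_singleton_self x))
  have smulk : ∀ (a : k) (r : S) (y : Y), r • a • y = a • r • y := fun a r y => by
    rw [← algebraMap_smul S a y, ← algebraMap_smul S a (r • y), ← mul_smul, ← mul_smul,
      Algebra.commutes]
  let γ : X →ₗ[k] Y →ₗ[k] ((∀ Z : Finset X, P Z → Y) ⧸ N) := LinearMap.mk₂ k
    (fun x y => N.mkQ (G x y))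
    (fun x x' y => by
      rw [← map_add]
      refine (Submodule.Quotient.eq N).2 ⟨{x} ∪ {x'}, fun Z hZ => ?_⟩
      have h1 := mem Z x (Finset.union_subset_left hZ)
      have h2 := mem Z x' (Finset.union_subset_right hZ)
      have h3 := (P Z).add_mem h1 h2
      funext p
      have : s Z ⟨x + x', h3⟩ = s Z ⟨x, h1⟩ + s Z ⟨x', h2⟩ := by rw [← map_add]; rfl
      simp only [Pi.sub_apply, Pi.add_apply, Pi.zero_apply, G, c, dif_pos h1, dif_pos h2,
        dif_pos h3, this, Finsupp.add_apply, map_add, add_smul, sub_self])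
    (fun a x y => by
      rw [← map_smul]
      refine (Submodule.Quotient.eq N).2 ⟨{x}, fun Z hZ => ?_⟩
      have h1 := mem Z x hZ
      have h3 : a • x ∈ P Z := by
        rw [← algebraMap_smul S' a x]
        exact (P Z).smul_mem _ h1
      funext p
      have : s Z ⟨a • x, h3⟩ p = a • s Z ⟨x, h1⟩ p := by
        have : (⟨a • x, h3⟩ : P Z) = algebraMap k S' a • ⟨x, h1⟩ :=
          Subtype.ext (algebraMap_smul S' a x).symm
        rw [this, map_smul, Finsupp.smul_apply, algebraMap_smul]
      simp only [Pi.sub_apply, Pi.smul_apply, Pi.zero_apply, G, c, dif_pos h1,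
        dif_pos h3, this, map_smul, smul_assoc, sub_self])
    (fun x y y' => by
      rw [← map_add]
      congr 1
      funext Z p
      exact smul_add _ _ _)
    (fun a x y => by
      rw [← map_smul]
      congr 1
      funext Z p
      exact smulk _ _ _)
  -- Balancedness: the section is linear for large `Z`, and `τ` reverses the product `a * s Z x p`
  -- into the order in which it acts on `y`.
  obtain ⟨g, hg⟩ := h.exists_lift γ (fun a x y => by
    refine (Submodule.Quotient.eq N).2 ⟨{x}, fun Z hZ => ?_⟩
    have h1 := mem Z x hZ
    have h3 := (P Z).smul_mem a h1
    funext p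
    have : s Z ⟨a • x, h3⟩ p = a * s Z ⟨x, h1⟩ p := by
      rw [← smul_eq_mul, ← Finsupp.smul_apply, ← map_smul]
      rfl
    simp only [Pi.sub_apply, Pi.zero_apply, G, c, dif_pos h1, dif_pos h3, this, h.anti, mul_smul,
      sub_self])
  have h1 : N.mkQ (∑ i, G (x i) (y i)) = 0 := by
    rw [map_sum, ← map_zero g, ← h0, map_sum]
    exact Finset.sum_congr rfl fun i _ => (hg _ _).symm
  obtain ⟨Z₀, hZ₀⟩ := (Submodule.Quotient.mk_eq_zero N).1 h1
  -- Large enough both for the zero sum to be visible and for the coordinates of each `x i` to be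
  -- genuine.
  let Z := Z₀ ∪ Finset.univ.image x
  have hx : ∀ i, x i ∈ P Z := fun i =>
    hZ Z _ (Finset.mem_union_right _ (Finset.mem_image_of_mem x (Finset.mem_univ i)))
  refine ⟨P Z, Subtype.val, fun i => s Z ⟨x i, hx i⟩, fun i => ?_, fun p => ?_⟩
  · have := congrArg (P Z).subtype (hs Z ⟨x i, hx i⟩)
    rw [Finsupp.linearCombination_apply, map_finsuppSum] at this
    rw [Finsupp.linearCombination_apply]
    exact this.symm
  · have := congrFun (hZ₀ Z Finset.subset_union_left) p
    simpa only [Finset.sum_apply, G, c, dif_pos (hx _), Pi.zero_apply] using this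

end IsBalTensor

namespace IsBalTensor

/-! ### Flatness and preservation of joint kernels -/

section

variable {k : Type w} [CommRing k] {S' S : Type u} [Ring S'] [Algebra k S'] [Ring S]
    [Algebra k S] {τ : S' ≃ₗ[k] S} {X Y W : Type u} [AddCommGroup X] [Module k X] [Module S' X]
    [AddCommGroup Y] [Module k Y] [Module S Y] [AddCommGroup W] [Module k W]
    {β : X →ₗ[k] Y →ₗ[k] W} {ι : Type*} [Fintype ι]

/-- Flatness in terms of elements: the relations on the `f (y i)` supplied by `vanishing` are images
under `f`, and injectivity pulls them back to relations on the `y i`. -/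
theorem sum_eq_zero_of_injective [IsScalarTower k S' X] [IsScalarTower k S Y]
    (h : IsBalTensor τ β) (hX : LocallyProjective S' X) {Y' W' : Type u} [AddCommGroup Y']
    [Module k Y'] [Module S Y'] [IsScalarTower k S Y'] [AddCommGroup W'] [Module k W']
    {β' : X →ₗ[k] Y' →ₗ[k] W'} (h' : IsBalTensor τ β') (f : Y →ₗ[S] Y')
    (hf : Function.Injective f) (x : ι → X) (y : ι → Y) (h0 : ∑ i, β' (x i) (f (y i)) = 0) :
    ∑ i, β (x i) (y i) = 0 := by
  obtain ⟨κ, v, σ, hx, hy⟩ := h'.vanishing hX x _ h0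
  obtain ⟨T, hT⟩ := h.sum_eq_sum_support v σ y
  simp only [hx]
  rw [hT]
  refine Finset.sum_eq_zero fun c _ => ?_
  have : ∑ i, τ (σ i c) • y i = 0 := hf (by
    rw [map_zero, ← hy c, map_sum]
    exact Finset.sum_congr rfl fun i _ => map_smul _ _ _)
  rw [this, map_zero]

/-- The functional `g` is defined on `Q` only, so it cannot be applied to the ambient tensor product
directly. The relations from `vanishing` already hold in `Q`, however, and `g` carries them to
relations among the coefficients of the `x i`. -/
theorem sum_smul_eq_zero [IsScalarTower k S' X] [IsScalarTower k S Y] (h : IsBalTensor τ β)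
    (hX : LocallyProjective S' X) (Q : Submodule S Y) (g : Q →ₗ[S] S) (x : ι → X) (y : ι → Q)
    (h0 : ∑ i, β (x i) (y i) = 0) : ∑ i, τ.symm (g (y i)) • x i = 0 := by
  obtain ⟨κ, v, σ, hx, hy⟩ := h.vanishing hX x _ h0
  have : ∑ i, τ.symm (g (y i)) • σ i = 0 := by
    ext c
    have hc : ∑ i, τ (σ i c) • y i = 0 := Subtype.ext (by
      rw [Submodule.coe_zero, ← hy c, ← Submodule.subtype_apply, map_sum]
      rfl)
    apply τ.injective
    rw [Finsupp.finsetSum_apply, map_sum, Finsupp.zero_apply, map_zero, ← map_zero g, ← hc, map_sum]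
    refine Finset.sum_congr rfl fun i _ => ?_
    rw [Finsupp.smul_apply, smul_eq_mul, h.anti, τ.apply_symm_apply, map_smul, smul_eq_mul]
  simp only [hx]
  rw [← map_zero (Finsupp.linearCombination S' v), ← this, map_sum]
  exact Finset.sum_congr rfl fun i _ => (map_smul _ _ _).symm

/-- The heart of the argument. With dual-basis coordinates on a projective `P` containing the `x i`,
the sum becomes `∑ v c ⊗ e c`, where `e c` arises by applying the `c`-th coordinate to the first
factors. That coordinate preserves each of the given relations, so every `e c` is killed by all `f
j`. The choice of `P` depends on the `x i` alone, which is why the index set `I` can be arbitrary.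
-/
theorem exists_rep_of_forall_sum_eq_zero [IsScalarTower k S' X]
    (h : IsBalTensor τ β) (hX : LocallyProjective S' X) {I : Type*} {Y' W' : I → Type u}
    [∀ j, AddCommGroup (Y' j)] [∀ j, Module k (Y' j)] [∀ j, Module S (Y' j)]
    [∀ j, IsScalarTower k S (Y' j)] [∀ j, AddCommGroup (W' j)] [∀ j, Module k (W' j)]
    {β' : ∀ j, X →ₗ[k] Y' j →ₗ[k] W' j} (h' : ∀ j, IsBalTensor τ (β' j))
    (hY' : ∀ j, LocallyProjective S (Y' j)) (f : ∀ j, Y →ₗ[S] Y' j)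
    (x : ι → X) (y : ι → Y) (h0 : ∀ j, ∑ i, β' j (x i) (f j (y i)) = 0) :
    ∃ (κ : Type u) (T : Finset κ) (v : κ → X) (e : κ → Y), (∀ c j, f j (e c) = 0) ∧
      ∑ i, β (x i) (y i) = ∑ c ∈ T, β (v c) (e c) := by
  classical
  obtain ⟨P, hP, hZ⟩ := hX (Finset.univ.image x)
  obtain ⟨s, hs⟩ := hP.out
  have hx : ∀ i, x i ∈ P := fun i => hZ _ (Finset.mem_image_of_mem x (Finset.mem_univ i))
  have hsx : ∀ i, x i = Finsupp.linearCombination S' (Subtype.val : P → X) (s ⟨x i, hx i⟩) :=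
    fun i => by
      have := congrArg P.subtype (hs ⟨x i, hx i⟩)
      rw [Finsupp.linearCombination_apply, map_finsuppSum] at this
      rw [Finsupp.linearCombination_apply]
      exact this.symm
  obtain ⟨T, hT⟩ := h.sum_eq_sum_support (Subtype.val : P → X) (fun i => s ⟨x i, hx i⟩) y
  refine ⟨P, T, Subtype.val, fun c => ∑ i, τ (s ⟨x i, hx i⟩ c) • y i, fun c j => ?_, ?_⟩
  -- Here local projectivity of the target `Y' j` is needed: it permits applying a coordinate that
  -- is defined only on `P ⊆ X`.
  · have := (h' j).flip.sum_smul_eq_zero (hY' j) P (Finsupp.lapply c ∘ₗ s) (fun i => f j (y i))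
      (fun i => ⟨x i, hx i⟩) (h0 j)
    rw [← this, map_sum]
    exact Finset.sum_congr rfl fun i _ => map_smul _ _ _
  · rw [← hT]
    exact Finset.sum_congr rfl fun i _ => by rw [← hsx]

end

/-! ### Tensor products of unions of projectives -/

section Union

variable {k : Type w} [CommRing k] {S' S R : Type u} [Ring S'] [Algebra k S'] [Ring S]
    [Algebra k S] [Ring R] {τ : S' ≃ₗ[k] S} {X Y W : Type u} [AddCommGroup X] [Module k X]
    [Module S' X] [AddCommGroup Y] [Module k Y] [Module S Y] [AddCommGroup W] [Module k W]
    {β : X →ₗ[k] Y →ₗ[k] W} [Module R X] [Module R W] [SMulCommClass R S' X]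

/-- The second factors of finitely many elements lie in a projective `P`, whose section into a free
module embeds `X ⊗ P` into a direct sum of copies of `X`. By flatness `X ⊗ P` also embeds into `W`.
Thus a finitely generated submodule of `W` is isomorphic to one of a direct sum of copies of `X`,
where heredity applies. -/
theorem isUnionOfProjectives [IsScalarTower k S' X] [IsScalarTower k S Y] (h : IsBalTensor τ β)
    (hR : SubmodulesProjective R) (hβ : ∀ (r : R) x y, β (r • x) y = r • β x y)
    (hXR : LocallyProjective R X) (hX : LocallyProjective S' X) (hY : LocallyProjective S Y) :
    IsUnionOfProjectives R W := by
  classical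
  refine isUnionOfProjectives_of_fg fun N hN => ?_
  obtain ⟨Z, rfl⟩ := hN
  choose n x y hxy using h.exists_rep
  obtain ⟨P, hP, hPZ⟩ := hY (Z.biUnion fun t => Finset.univ.image (y t))
  have hy : ∀ (t : Z) i, y t i ∈ P := fun t i => hPZ _
    (Finset.mem_biUnion.2 ⟨t, t.2, Finset.mem_image_of_mem _ (Finset.mem_univ i)⟩)
  obtain ⟨s, hs⟩ := hP.out
  let coef : ∀ t : Z, Fin (n t) → P →₀ S := fun t i => s ⟨y t i, hy t i⟩
  let v : (Z →₀ R) →ₗ[R] (P →₀ X) := Finsupp.linearCombination R fun t =>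
    ∑ i, (coef t i).mapRange (fun a => τ.symm a • x t i) (by rw [map_zero, zero_smul])
  let p : (Z →₀ R) →ₗ[R] W := Finsupp.linearCombination R Subtype.val
  have hv : ∀ r q, v r q = ∑ t, ∑ i, τ.symm (coef t i q) • r t • x t i := fun r q => by
    simp only [v, Finsupp.linearCombination_apply]
    rw [Finsupp.sum_fintype r _ (by simp), Finsupp.finsetSum_apply]
    refine Finset.sum_congr rfl fun t _ => ?_
    rw [Finsupp.smul_apply, Finsupp.finsetSum_apply, Finset.smul_sum]
    exact Finset.sum_congr rfl fun i _ => smul_comm _ _ _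
  have hp : ∀ r, p r = ∑ t, ∑ i, β (r t • x t i) (y t i) := fun r => by
    simp only [p, Finsupp.linearCombination_apply]
    rw [Finsupp.sum_fintype r _ (by simp)]
    refine Finset.sum_congr rfl fun t _ => ?_
    conv_lhs => rw [hxy t.1, Finset.smul_sum]
    exact Finset.sum_congr rfl fun i _ => (hβ _ _ _).symm
  -- `v` and `p` are two images of the same free module, so equal kernels make their ranges
  -- isomorphic. One inclusion reassembles the second factors from their coordinates; the other
  -- applies each coordinate functional of `P` to the relation.
  have hker : LinearMap.ker v = LinearMap.ker p := by
    ext r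
    rw [LinearMap.mem_ker, LinearMap.mem_ker, hp, ← Fintype.sum_sigma']
    constructor
    · intro h0
      obtain ⟨T, hT⟩ := h.flip.sum_eq_sum_support (Subtype.val : P → Y)
        (fun j : Σ t : Z, Fin (n t) => coef j.1 j.2) (fun j => r j.1 • x j.1 j.2)
      have h1 : ∀ t i, Finsupp.linearCombination S (Subtype.val : P → Y) (coef t i) = y t i :=
        fun t i => by
          have := congrArg P.subtype (hs ⟨y t i, hy t i⟩)
          rw [Finsupp.linearCombination_apply, map_finsuppSum] at this
          rw [Finsupp.linearCombination_apply]
          exact this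
      simp only [h1, LinearMap.flip_apply] at hT
      rw [hT]
      refine Finset.sum_eq_zero fun q _ => ?_
      have := hv r q
      rw [h0, ← Fintype.sum_sigma'] at this
      rw [← this, Finsupp.zero_apply, map_zero, LinearMap.zero_apply]
    · intro h0
      ext q
      rw [hv, ← Fintype.sum_sigma']
      exact h.sum_smul_eq_zero hX P (Finsupp.lapply q ∘ₗ s) _
        (fun j : Σ t : Z, Fin (n t) => ⟨y j.1 j.2, hy j.1 j.2⟩) h0
  have hrange : LinearMap.range p = Submodule.span R Z := by
    simp only [p, Finsupp.range_linearCombination, Subtype.range_coe_subtype, Finset.setOfPred_mem]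
  have hfg : (LinearMap.range v).FG := by
    rw [LinearMap.range_eq_map]
    exact Module.Finite.fg_top.map v
  have := (hXR.finsupp P).projective_of_fg hR hfg
  exact Module.Projective.of_equiv' ((v.quotKerEquivRange.symm ≪≫ₗ
    Submodule.quotEquivOfEq _ _ hker) ≪≫ₗ (p.quotKerEquivRange ≪≫ₗ LinearEquiv.ofEq _ _ hrange))

end Union

end IsBalTensor

/-! ### Flatness of bimodules that are unions of projectives -/

section

variable {k : Type w} [CommRing k] {R : Type u} [Ring R] [Algebra k R]
  {S : Type u} [Ring S] [Algebra k S] {T : Type u} [Ring T] [Algebra k T]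

theorem IsHereditary.left (h : IsHereditary R) : SubmodulesProjective R := h.1

theorem IsHereditary.right (h : IsHereditary R) : SubmodulesProjective Rᵐᵒᵖ := h.2

theorem Bim.leftModule_isScalarTower (X : Bim k R S) :
    letI := X.leftModule; IsScalarTower k R X.carrier :=
  letI := X.leftModule
  ⟨fun c a x => by
    change X.l (c • a) x = c • X.l a x
    rw [map_smul, LinearMap.smul_apply]⟩

theorem Bim.rightModule_isScalarTower (X : Bim k R S) :
    letI := X.rightModule; IsScalarTower k Sᵐᵒᵖ X.carrier :=
  letI := X.rightModule
  ⟨fun c a x => by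
    change X.r (c • a) x = c • X.r a x
    rw [map_smul, LinearMap.smul_apply]⟩

/-- A homomorphism of bimodules, as a map of left modules. -/
def Bim.Hom.leftLinear {X Y : Bim k R S} (f : X.Hom Y) :
    letI := X.leftModule; letI := Y.leftModule; X.carrier →ₗ[R] Y.carrier :=
  letI := X.leftModule; letI := Y.leftModule
  { toFun := f.lin
    map_add' := f.lin.map_add
    map_smul' := f.map_l }

/-- A homomorphism of bimodules, as a map of right modules. -/
def Bim.Hom.rightLinear {X Y : Bim k R S} (f : X.Hom Y) :
    letI := X.rightModule; letI := Y.rightModule; X.carrier →ₗ[Sᵐᵒᵖ] Y.carrier :=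
  letI := X.rightModule; letI := Y.rightModule
  { toFun := f.lin
    map_add' := f.lin.map_add
    map_smul' := f.map_r }

theorem Bim.exists_rep (X : Bim k R S) (Y : Bim k S T) (t : (X.tens Y).carrier) :
    ∃ (n : ℕ) (x : Fin n → X.carrier) (y : Fin n → Y.carrier), t = ∑ i, X.tmul Y (x i) (y i) := by
  induction t using Bim.tens_induction with
  | zero => exact ⟨0, Fin.elim0, Fin.elim0, by simp⟩
  | tmul x y => exact ⟨1, fun _ => x, fun _ => y, by simp⟩
  | add s t hs ht =>
    obtain ⟨n, x, y, rfl⟩ := hs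
    obtain ⟨m, x', y', rfl⟩ := ht
    exact ⟨n + m, Fin.append x x', Fin.append y y', by simp [Fin.sum_univ_add]⟩

theorem Bim.isBalTensor (X : Bim k R S) (Y : Bim k S T) :
    letI := X.rightModule; letI := Y.leftModule
    IsBalTensor (opLinearEquiv k : S ≃ₗ[k] Sᵐᵒᵖ).symm (X.tmulL Y) :=
  letI := X.rightModule; letI := Y.leftModule
  { anti := fun _ _ => rfl
    bal := fun a x y => X.tmul_bal Y a.unop x y
    exists_rep := X.exists_rep Y
    exists_lift := fun γ hγ => ⟨Bim.lift γ fun s => hγ (op s), Bim.lift_tmul _ _⟩ }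

/-- Finite subsets lie in projective left submodules. -/
def Bim.LeftProj (X : Bim k R S) : Prop :=
  letI := X.leftModule; LocallyProjective R X.carrier

/-- Finite subsets lie in projective right submodules. -/
def Bim.RightProj (X : Bim k R S) : Prop :=
  letI := X.rightModule; LocallyProjective Sᵐᵒᵖ X.carrier

theorem Bim.UnionOfProjectives.leftProj {X : Bim k R S} (h : X.UnionOfProjectives) : X.LeftProj :=
  letI := X.leftModule; IsUnionOfProjectives.locallyProjective h.1

theorem Bim.UnionOfProjectives.rightProj {X : Bim k R S} (h : X.UnionOfProjectives) :
    X.RightProj :=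
  letI := X.rightModule; IsUnionOfProjectives.locallyProjective h.2

theorem Bim.UnionOfProjectives.of_injective {X Y : Bim k R S} (hR : IsHereditary R)
    (hS : IsHereditary S) (hY : Y.UnionOfProjectives) (f : X.Hom Y)
    (hf : Function.Injective f.lin) : X.UnionOfProjectives := by
  constructor
  · let := X.leftModule; let := Y.leftModule
    exact hY.1.of_injective hR.left f.leftLinear hf
  · let := X.rightModule; let := Y.rightModule
    exact hY.2.of_injective hS.right f.rightLinear hf

/-- Each side uses the outer ring's heredity and local projectivity of both factors over the middle
ring; the right-hand side is the flipped instance. No heredity of the middle ring is required. -/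
theorem Bim.UnionOfProjectives.tens {X : Bim k R S} {Y : Bim k S T} (hR : IsHereditary R)
    (hT : IsHereditary T) (hX : X.UnionOfProjectives) (hY : Y.UnionOfProjectives) :
    (X.tens Y).UnionOfProjectives := by
  let := X.rightModule; let := Y.leftModule; let := X.leftModule; let := Y.rightModule
  have := X.rightModule_isScalarTower
  have := Y.leftModule_isScalarTower
  constructor
  · let := (X.tens Y).leftModule
    have : SMulCommClass R Sᵐᵒᵖ X.carrier := ⟨X.l_r⟩
    exact (X.isBalTensor Y).isUnionOfProjectives hR.left (fun r x y => (X.tens_l_tmul Y r x y).symm)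
      hX.leftProj hX.rightProj hY.leftProj
  · let := (X.tens Y).rightModule
    have : SMulCommClass Tᵐᵒᵖ S Y.carrier := ⟨fun b a y => (Y.l_r a b y).symm⟩
    exact (X.isBalTensor Y).flip.isUnionOfProjectives hT.right
      (fun r y x => (X.tens_r_tmul Y r x y).symm) hY.rightProj hY.leftProj hX.rightProj

theorem Bim.tens_id_injective {X : Bim k R S} (hX : X.RightProj) {Y Y' : Bim k S T} (f : Y.Hom Y')
    (hf : Function.Injective f.lin) : Function.Injective ((Bim.Hom.id X).tens f).lin := by
  let := X.rightModule; let := Y.leftModule; let := Y'.leftModule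
  have := X.rightModule_isScalarTower
  have := Y.leftModule_isScalarTower
  have := Y'.leftModule_isScalarTower
  refine (injective_iff_map_eq_zero _).2 fun t ht => ?_
  obtain ⟨n, x, y, rfl⟩ := X.exists_rep Y t
  exact (X.isBalTensor Y).sum_eq_zero_of_injective hX (X.isBalTensor Y') f.leftLinear hf x y
    (by
      simp only [map_sum, Bim.Hom.tens_lin_tmul, Bim.Hom.id_lin] at ht
      exact ht)

theorem Bim.id_tens_injective {Y : Bim k S T} (hY : Y.LeftProj) {X X' : Bim k R S} (f : X.Hom X')
    (hf : Function.Injective f.lin) : Function.Injective (f.tens (Bim.Hom.id Y)).lin := by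
  let := Y.leftModule; let := X.rightModule; let := X'.rightModule
  have := Y.leftModule_isScalarTower
  have := X.rightModule_isScalarTower
  have := X'.rightModule_isScalarTower
  refine (injective_iff_map_eq_zero _).2 fun t ht => ?_
  obtain ⟨n, x, y, rfl⟩ := X.exists_rep Y t
  exact (X.isBalTensor Y).flip.sum_eq_zero_of_injective hY (X'.isBalTensor Y).flip f.rightLinear hf
    y x (by
      simp only [map_sum, Bim.Hom.tens_lin_tmul, Bim.Hom.id_lin] at ht
      exact ht)

/-- Tensoring with a union of projectives preserves arbitrary joint equalizers. -/
theorem Bim.exists_of_tens_id_eq {X : Bim k R S} (hX : X.RightProj) {E Y : Bim k S T}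
    (j : E.Hom Y) {I : Type*} {Z : I → Bim k S T} (hZ : ∀ i, (Z i).LeftProj)
    (f g : ∀ i, Y.Hom (Z i))
    (hj : ∀ y, (∀ i, (f i).lin y = (g i).lin y) → ∃ e, j.lin e = y) (t : (X.tens Y).carrier)
    (ht : ∀ i, ((Bim.Hom.id X).tens (f i)).lin t = ((Bim.Hom.id X).tens (g i)).lin t) :
    ∃ e, ((Bim.Hom.id X).tens j).lin e = t := by
  let := X.rightModule; let := Y.leftModule; let := fun i => (Z i).leftModule
  have := X.rightModule_isScalarTower
  have := Y.leftModule_isScalarTower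
  have := fun i => (Z i).leftModule_isScalarTower
  obtain ⟨n, x, y, rfl⟩ := X.exists_rep Y t
  -- Equalizers are turned into kernels of differences.
  obtain ⟨κ, s, v, e, he, hsum⟩ := (X.isBalTensor Y).exists_rep_of_forall_sum_eq_zero hX
    (fun i => X.isBalTensor (Z i)) hZ (fun i => (f i).leftLinear - (g i).leftLinear) x y
    (fun i => by
      have := ht i
      simp only [map_sum, Bim.Hom.tens_lin_tmul, Bim.Hom.id_lin] at this
      rw [← sub_eq_zero, ← Finset.sum_sub_distrib] at this
      rw [← this]
      refine Finset.sum_congr rfl fun j _ => ?_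
      rw [LinearMap.sub_apply, map_sub]
      rfl)
  choose e' he' using fun c => hj (e c) (fun i => sub_eq_zero.1 (he c i))
  refine ⟨∑ c ∈ s, X.tmul E (v c) (e' c), ?_⟩
  simp only [map_sum, Bim.Hom.tens_lin_tmul, Bim.Hom.id_lin, he']
  exact hsum.symm

theorem Bim.exists_of_id_tens_eq {Y : Bim k S T} (hY : Y.LeftProj) {E X : Bim k R S}
    (j : E.Hom X) {I : Type*} {Z : I → Bim k R S} (hZ : ∀ i, (Z i).RightProj)
    (f g : ∀ i, X.Hom (Z i))
    (hj : ∀ x, (∀ i, (f i).lin x = (g i).lin x) → ∃ e, j.lin e = x) (t : (X.tens Y).carrier)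
    (ht : ∀ i, ((f i).tens (Bim.Hom.id Y)).lin t = ((g i).tens (Bim.Hom.id Y)).lin t) :
    ∃ e, (j.tens (Bim.Hom.id Y)).lin e = t := by
  let := Y.leftModule; let := X.rightModule; let := fun i => (Z i).rightModule
  have := Y.leftModule_isScalarTower
  have := X.rightModule_isScalarTower
  have := fun i => (Z i).rightModule_isScalarTower
  obtain ⟨n, x, y, rfl⟩ := X.exists_rep Y t
  obtain ⟨κ, s, v, e, he, hsum⟩ := (X.isBalTensor Y).flip.exists_rep_of_forall_sum_eq_zero hY
    (fun i => ((Z i).isBalTensor Y).flip) hZ (fun i => (f i).rightLinear - (g i).rightLinear) y x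
    (fun i => by
      have := ht i
      simp only [map_sum, Bim.Hom.tens_lin_tmul, Bim.Hom.id_lin] at this
      rw [← sub_eq_zero, ← Finset.sum_sub_distrib] at this
      rw [← this]
      refine Finset.sum_congr rfl fun j _ => ?_
      rw [LinearMap.sub_apply, map_sub]
      rfl)
  choose e' he' using fun c => hj (e c) (fun i => sub_eq_zero.1 (he c i))
  refine ⟨∑ c ∈ s, E.tmul Y (e' c) (v c), ?_⟩
  simp only [map_sum, Bim.Hom.tens_lin_tmul, Bim.Hom.id_lin, he']
  exact hsum.symm

end

/-! ### Corings and bicoactions in a bicategory -/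

section Coring

universe w₁ v₁ u₁

variable {B : Type u₁} [Bicategory.{w₁, v₁} B] {a b c d : B}

/-- A coring (comonad) in a bicategory. -/
structure Coring (a : B) where
  A : a ⟶ a
  comul : A ⟶ A ≫ A
  counit : A ⟶ 𝟙 a
  coassoc : comul ≫ comul ▷ A ≫ (α_ A A A).hom = comul ≫ A ◁ comul
  counit_left : comul ≫ counit ▷ A ≫ (λ_ A).hom = 𝟙 A
  counit_right : comul ≫ A ◁ counit ≫ (ρ_ A).hom = 𝟙 A

/-- A pair of commuting coactions of two corings on a 1-cell. -/
@[ext]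
structure Bicoaction (C : Coring a) (D : Coring b) (M : a ⟶ b) where
  l : M ⟶ C.A ≫ M
  r : M ⟶ M ≫ D.A
  l_coassoc : l ≫ C.comul ▷ M ≫ (α_ C.A C.A M).hom = l ≫ C.A ◁ l
  l_counit : l ≫ C.counit ▷ M ≫ (λ_ M).hom = 𝟙 M
  r_coassoc : r ≫ r ▷ D.A ≫ (α_ M D.A D.A).hom = r ≫ M ◁ D.comul
  r_counit : r ≫ M ◁ D.counit ≫ (ρ_ M).hom = 𝟙 M
  comm : r ≫ l ▷ D.A ≫ (α_ C.A M D.A).hom = l ≫ C.A ◁ r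

/-! ### Two-sided coactions as pairs of commuting coactions -/

section OfCoact

variable {C : Coring a} {D : Coring b} {M : a ⟶ b} (coact : M ⟶ C.A ≫ M ≫ D.A)
  (hco : coact ≫ C.A ◁ (coact ▷ D.A) ≫
      C.A ◁ ((α_ C.A (M ≫ D.A) D.A).hom ≫ C.A ◁ (α_ M D.A D.A).hom) =
    coact ≫ (C.comul ▷ (M ≫ D.A) ≫ (C.A ≫ C.A) ◁ (M ◁ D.comul)) ≫
      (α_ C.A C.A (M ≫ D.A ≫ D.A)).hom)
include hco

/-- Apply the counit to both copies of `D` in the two-sided coassociativity law. The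
comultiplication of `D` then disappears by counitality. -/
theorem coact_left_coassoc :
    (coact ≫ C.A ◁ (M ◁ D.counit ≫ (ρ_ M).hom)) ≫ C.comul ▷ M ≫ (α_ C.A C.A M).hom =
      (coact ≫ C.A ◁ (M ◁ D.counit ≫ (ρ_ M).hom)) ≫
        C.A ◁ (coact ≫ C.A ◁ (M ◁ D.counit ≫ (ρ_ M).hom)) := by
  have h := congrArg (· ≫ C.A ◁ C.A ◁ (M ◁ (D.A ◁ D.counit ≫ (ρ_ D.A).hom ≫ D.counit) ≫
    (ρ_ M).hom)) hco
  simp only [Category.assoc] at h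
  calc _ = coact ≫ C.comul ▷ (M ≫ D.A) ≫ (C.A ≫ C.A) ◁ (M ◁ ((D.comul ≫ D.A ◁ D.counit ≫
          (ρ_ D.A).hom) ≫ D.counit)) ≫ (α_ _ _ _).hom ≫ C.A ◁ C.A ◁ (ρ_ M).hom := by
        rw [D.counit_right, Category.id_comp, ← whisker_exchange_assoc]
        bicategory
    _ = _ := by
        refine Eq.trans ?_ (h.symm.trans ?_)
        · bicategory
        · have e := whisker_exchange coact D.counit
          calc _ = coact ≫ C.A ◁ ((coact ▷ D.A ≫ (C.A ≫ M ≫ D.A) ◁ D.counit) ≫ (ρ_ _).hom ≫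
                C.A ◁ (M ◁ D.counit ≫ (ρ_ M).hom)) := by bicategory
            _ = _ := by
              rw [← e]
              bicategory

/-- The mirror argument, applying the counit to both copies of `C`. -/
theorem coact_right_coassoc :
    (coact ≫ C.counit ▷ (M ≫ D.A) ≫ (λ_ (M ≫ D.A)).hom) ≫
        (coact ≫ C.counit ▷ (M ≫ D.A) ≫ (λ_ (M ≫ D.A)).hom) ▷ D.A ≫ (α_ M D.A D.A).hom =
      (coact ≫ C.counit ▷ (M ≫ D.A) ≫ (λ_ (M ≫ D.A)).hom) ≫ M ◁ D.comul := by
  have h := congrArg (· ≫ C.A ◁ (C.counit ▷ _ ≫ (λ_ (M ≫ D.A ≫ D.A)).hom) ≫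
    C.counit ▷ _ ≫ (λ_ (M ≫ D.A ≫ D.A)).hom) hco
  simp only [Category.assoc] at h
  calc _ = coact ≫ C.A ◁ (coact ▷ D.A ≫ (α_ C.A (M ≫ D.A) D.A).hom ≫ C.A ◁ (α_ M D.A D.A).hom ≫
          C.counit ▷ _ ≫ (λ_ (M ≫ D.A ≫ D.A)).hom) ≫ C.counit ▷ _ ≫ (λ_ _).hom := by
        rw [whisker_exchange_assoc]
        bicategory
    _ = coact ≫ C.comul ▷ (M ≫ D.A) ≫ (C.A ≫ C.A) ◁ (M ◁ D.comul) ≫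
          ((C.A ◁ C.counit ≫ (ρ_ _).hom ≫ C.counit) ▷ _) ≫ (λ_ (M ≫ D.A ≫ D.A)).hom := by
        refine Eq.trans ?_ (h.trans ?_) <;> bicategory
    _ = coact ≫ ((C.comul ≫ C.A ◁ C.counit ≫ (ρ_ _).hom) ≫ C.counit) ▷ (M ≫ D.A) ≫
          (λ_ _).hom ≫ M ◁ D.comul := by
        rw [whisker_exchange_assoc]
        bicategory
    _ = _ := by
        rw [C.counit_right, Category.id_comp]
        bicategory

/-- Contract the inner copy of `C` and the outer copy of `D` in the coassociativity law. What
remains on one side is the left coaction followed by the right one; on the other, counitality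
restores the coaction. -/
theorem coact_eq_left_comp_right :
    coact = (coact ≫ C.A ◁ (M ◁ D.counit ≫ (ρ_ M).hom)) ≫
      C.A ◁ (coact ≫ C.counit ▷ (M ≫ D.A) ≫ (λ_ (M ≫ D.A)).hom) := by
  have h := congrArg (· ≫ C.A ◁ (C.counit ▷ _ ≫ (λ_ (M ≫ D.A ≫ D.A)).hom ≫
    M ◁ (D.A ◁ D.counit ≫ (ρ_ D.A).hom))) hco
  simp only [Category.assoc] at h
  calc coact = coact ≫ (C.comul ≫ C.A ◁ C.counit ≫ (ρ_ _).hom) ▷ (M ≫ D.A) ≫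
          C.A ◁ M ◁ (D.comul ≫ D.A ◁ D.counit ≫ (ρ_ D.A).hom) := by
        rw [C.counit_right, D.counit_right]
        bicategory
    _ = coact ≫ C.comul ▷ (M ≫ D.A) ≫ ((C.A ◁ C.counit ≫ (ρ_ _).hom) ▷ (M ≫ D.A) ≫
          C.A ◁ (M ◁ D.comul)) ≫ C.A ◁ M ◁ (D.A ◁ D.counit ≫ (ρ_ D.A).hom) := by
        bicategory
    _ = coact ≫ C.A ◁ ((coact ≫ C.counit ▷ (M ≫ D.A) ≫ (λ_ (M ≫ D.A)).hom) ▷ D.A ≫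
          (M ≫ D.A) ◁ D.counit ≫ (ρ_ _).hom) := by
        rw [← whisker_exchange]
        refine Eq.trans ?_ (h.symm.trans ?_) <;> bicategory
    _ = _ := by
        rw [← whisker_exchange_assoc]
        bicategory

/-- Now the outer copy of `C` and the inner copy of `D` are contracted. Together with the previous
lemma this shows that the one-sided coactions commute. -/
theorem coact_eq_right_comp_left :
    (coact ≫ C.counit ▷ (M ≫ D.A) ≫ (λ_ (M ≫ D.A)).hom) ≫
      (coact ≫ C.A ◁ (M ◁ D.counit ≫ (ρ_ M).hom)) ▷ D.A ≫ (α_ C.A M D.A).hom = coact := by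
  have h := congrArg (· ≫ C.counit ▷ _ ≫ (λ_ (C.A ≫ M ≫ D.A ≫ D.A)).hom ≫
    C.A ◁ (M ◁ (D.counit ▷ D.A ≫ (λ_ D.A).hom))) hco
  simp only [Category.assoc] at h
  calc _ = coact ≫ (C.counit ▷ _ ≫ 𝟙 a ◁ (coact ▷ D.A ≫ (α_ C.A (M ≫ D.A) D.A).hom ≫
          C.A ◁ (α_ M D.A D.A).hom)) ≫ (λ_ _).hom ≫
          C.A ◁ (M ◁ (D.counit ▷ D.A ≫ (λ_ D.A).hom)) := by
        bicategory
    _ = coact ≫ C.comul ▷ (M ≫ D.A) ≫ ((C.A ≫ C.A) ◁ (M ◁ D.comul) ≫ 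
          ((C.counit ▷ C.A ≫ (λ_ _).hom) ▷ _)) ≫ C.A ◁ (M ◁ (D.counit ▷ D.A ≫ (λ_ D.A).hom)) := by
        rw [← whisker_exchange]
        refine Eq.trans ?_ (h.trans ?_) <;> bicategory
    _ = coact ≫ (C.comul ≫ C.counit ▷ C.A ≫ (λ_ _).hom) ▷ (M ≫ D.A) ≫
          C.A ◁ M ◁ (D.comul ≫ D.counit ▷ D.A ≫ (λ_ D.A).hom) := by
        rw [whisker_exchange]
        bicategory
    _ = coact := by
        rw [C.counit_left, D.counit_left]
        bicategory

/-- The commuting coactions given by a two-sided coaction. -/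
def Bicoaction.ofCoact
    (hcounit : (coact ≫ C.counit ▷ (M ≫ D.A) ≫ (λ_ (M ≫ D.A)).hom) ≫
      M ◁ D.counit ≫ (ρ_ M).hom = 𝟙 M) : Bicoaction C D M where
  l := coact ≫ C.A ◁ (M ◁ D.counit ≫ (ρ_ M).hom)
  r := coact ≫ C.counit ▷ (M ≫ D.A) ≫ (λ_ (M ≫ D.A)).hom
  l_coassoc := coact_left_coassoc coact hco
  l_counit := by
    rw [Category.assoc, whisker_exchange_assoc, ← hcounit]
    bicategory
  r_coassoc := coact_right_coassoc coact hco
  r_counit := hcounit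
  comm := (coact_eq_right_comp_left coact hco).trans (coact_eq_left_comp_right coact hco)

end OfCoact

/-! ### Constructions with bicoactions -/

namespace Bicoaction

variable {C : Coring a} {D : Coring b} {E : Coring c} {M M' : a ⟶ b} {N : b ⟶ c}
  (X : Bicoaction C D M) (X' : Bicoaction C D M')

/-- The two-sided coaction of a bicoaction. -/
def coact : M ⟶ C.A ≫ M ≫ D.A := X.l ≫ C.A ◁ X.r

/-- Commutation moves the two left coactions together and the two right coactions together;
one-sided coassociativity then applies to each pair. -/
theorem coact_coassoc : X.coact ≫ C.A ◁ (X.coact ▷ D.A) ≫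
      C.A ◁ ((α_ C.A (M ≫ D.A) D.A).hom ≫ C.A ◁ (α_ M D.A D.A).hom) =
    X.coact ≫ (C.comul ▷ (M ≫ D.A) ≫ (C.A ≫ C.A) ◁ (M ◁ D.comul)) ≫
      (α_ C.A C.A (M ≫ D.A ≫ D.A)).hom := by
  calc _ = X.l ≫ C.A ◁ ((X.r ≫ X.l ▷ D.A ≫ (α_ C.A M D.A).hom) ≫
          C.A ◁ (X.r ▷ D.A ≫ (α_ M D.A D.A).hom)) := by
        rw [coact]
        bicategory
    _ = (X.l ≫ C.A ◁ X.l) ≫ C.A ◁ C.A ◁ (X.r ≫ X.r ▷ D.A ≫ (α_ M D.A D.A).hom) := by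
        rw [X.comm]
        bicategory
    _ = X.l ≫ (C.comul ▷ M ≫ (C.A ≫ C.A) ◁ X.r) ≫ (C.A ≫ C.A) ◁ M ◁ D.comul ≫
          (α_ C.A C.A (M ≫ D.A ≫ D.A)).hom := by
        rw [← X.l_coassoc, X.r_coassoc]
        bicategory
    _ = _ := by
        rw [← whisker_exchange, coact]
        bicategory

theorem coact_counit : X.coact ≫ C.counit ▷ (M ≫ D.A) ≫ (λ_ (M ≫ D.A)).hom = X.r := by
  rw [coact, Category.assoc, whisker_exchange_assoc]
  calc _ = (X.l ≫ C.counit ▷ M ≫ (λ_ M).hom) ≫ X.r := by bicategory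
    _ = _ := by rw [X.l_counit, Category.id_comp]

theorem coact_counit' : X.coact ≫ C.A ◁ (M ◁ D.counit ≫ (ρ_ M).hom) = X.l := by
  rw [coact, Category.assoc, ← whiskerLeft_comp, X.r_counit, whiskerLeft_id, Category.comp_id]

variable {X X'}

theorem coact_comm {f : M ⟶ M'} (hl : X.l ≫ C.A ◁ f = f ≫ X'.l)
    (hr : X.r ≫ f ▷ D.A = f ≫ X'.r) : X.coact ≫ C.A ◁ (f ▷ D.A) = f ≫ X'.coact := by
  rw [coact, coact, Category.assoc, ← whiskerLeft_comp, hr, whiskerLeft_comp, reassoc_of% hl]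

/-- Contracting the outer tensor factor with its counit recovers the one-sided coaction naturally,
so compatibility with the two-sided coaction descends. -/
theorem l_comm {f : M ⟶ M'} (h : X.coact ≫ C.A ◁ (f ▷ D.A) = f ≫ X'.coact) :
    X.l ≫ C.A ◁ f = f ≫ X'.l := by
  rw [← X.coact_counit', ← X'.coact_counit', ← reassoc_of% h]
  simp only [Category.assoc, ← whiskerLeft_comp]
  rw [← whisker_exchange_assoc]
  bicategory

theorem r_comm {f : M ⟶ M'} (h : X.coact ≫ C.A ◁ (f ▷ D.A) = f ≫ X'.coact) :
    X.r ≫ f ▷ D.A = f ≫ X'.r := by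
  rw [← X.coact_counit, ← X'.coact_counit, ← reassoc_of% h, whisker_exchange_assoc]
  bicategory

/-- The tensor product of bicoactions over the algebra in the middle. -/
@[simps]
def tens (X : Bicoaction C D M) (Y : Bicoaction D E N) : Bicoaction C E (M ≫ N) where
  l := X.l ▷ N ≫ (α_ C.A M N).hom
  r := M ◁ Y.r ≫ (α_ M N E.A).inv
  l_coassoc := by
    calc _ = (X.l ≫ C.comul ▷ M ≫ (α_ C.A C.A M).hom) ▷ N ≫ (α_ _ _ _).hom ≫
          C.A ◁ (α_ _ _ _).hom := by bicategory
      _ = _ := by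
        rw [X.l_coassoc]
        bicategory
  l_counit := by
    calc _ = (X.l ≫ C.counit ▷ M ≫ (λ_ M).hom) ▷ N := by bicategory
      _ = _ := by rw [X.l_counit, id_whiskerRight]
  r_coassoc := by
    calc _ = M ◁ (Y.r ≫ Y.r ▷ E.A ≫ (α_ N E.A E.A).hom) ≫ (α_ _ _ _).inv := by bicategory
      _ = _ := by
        rw [Y.r_coassoc]
        bicategory
  r_counit := by
    calc _ = M ◁ (Y.r ≫ N ◁ E.counit ≫ (ρ_ N).hom) := by bicategory
      _ = _ := by rw [Y.r_counit, whiskerLeft_id]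
  comm := by
    calc _ = (M ◁ Y.r ≫ X.l ▷ (N ≫ E.A)) ≫ (α_ _ _ _).hom ≫ C.A ◁ (α_ _ _ _).inv := by
          bicategory
      _ = _ := by
        rw [whisker_exchange]
        bicategory

/-- A subobject of a bicomodule that inherits the coactions. -/
def sub (X : Bicoaction C D M) {P : a ⟶ b} (j : P ⟶ M) [Mono j] [Mono (C.A ◁ C.A ◁ j)]
    [Mono (j ▷ (D.A ≫ D.A))] [Mono (C.A ◁ (j ▷ D.A))] (l : P ⟶ C.A ≫ P)
    (hl : l ≫ C.A ◁ j = j ≫ X.l) (r : P ⟶ P ≫ D.A) (hr : r ≫ j ▷ D.A = j ≫ X.r) :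
    Bicoaction C D P where
  l := l
  r := r
  l_coassoc := by
    -- Every law of the subobject is tested after the inclusion, where it becomes the law of `X`.
    -- Monicity of the tensored inclusions is what makes this legitimate.
    rw [← cancel_mono (C.A ◁ C.A ◁ j)]
    calc _ = l ≫ (C.comul ▷ P ≫ (C.A ≫ C.A) ◁ j) ≫ (α_ _ _ _).hom := by bicategory
      _ = (l ≫ C.A ◁ j) ≫ C.comul ▷ M ≫ (α_ _ _ _).hom := by
        rw [← whisker_exchange]
        bicategory
      _ = (j ≫ X.l) ≫ C.A ◁ X.l := by
        rw [hl, Category.assoc, X.l_coassoc, Category.assoc]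
      _ = l ≫ C.A ◁ (l ≫ C.A ◁ j) := by
        rw [hl, whiskerLeft_comp, reassoc_of% hl, Category.assoc]
      _ = _ := by bicategory
  l_counit := by
    rw [← cancel_mono j]
    calc _ = l ≫ (C.counit ▷ P ≫ 𝟙 a ◁ j) ≫ (λ_ _).hom := by bicategory
      _ = (l ≫ C.A ◁ j) ≫ C.counit ▷ M ≫ (λ_ _).hom := by
        rw [← whisker_exchange]
        bicategory
      _ = _ := by rw [hl, Category.assoc, X.l_counit, Category.comp_id, Category.id_comp]
  r_coassoc := by
    rw [← cancel_mono (j ▷ (D.A ≫ D.A))]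
    calc _ = r ≫ (r ≫ j ▷ D.A) ▷ D.A ≫ (α_ _ _ _).hom := by bicategory
      _ = (j ≫ X.r) ≫ X.r ▷ D.A ≫ (α_ _ _ _).hom := by
        rw [hr, comp_whiskerRight, Category.assoc, reassoc_of% hr, Category.assoc]
      _ = (r ≫ j ▷ D.A) ≫ M ◁ D.comul := by
        rw [Category.assoc, X.r_coassoc, hr, Category.assoc]
      _ = r ≫ (j ▷ D.A ≫ M ◁ D.comul) := by rw [Category.assoc]
      _ = _ := by rw [← whisker_exchange, Category.assoc]
  r_counit := by
    rw [← cancel_mono j]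
    calc _ = r ≫ (P ◁ D.counit ≫ j ▷ 𝟙 b) ≫ (ρ_ _).hom := by bicategory
      _ = (r ≫ j ▷ D.A) ≫ M ◁ D.counit ≫ (ρ_ _).hom := by
        rw [whisker_exchange]
        bicategory
      _ = _ := by rw [hr, Category.assoc, X.r_counit, Category.comp_id, Category.id_comp]
  comm := by
    rw [← cancel_mono (C.A ◁ (j ▷ D.A))]
    calc _ = r ≫ (l ≫ C.A ◁ j) ▷ D.A ≫ (α_ _ _ _).hom := by bicategory
      _ = (r ≫ j ▷ D.A) ≫ X.l ▷ D.A ≫ (α_ _ _ _).hom := by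
        rw [hl]
        bicategory
      _ = (l ≫ C.A ◁ j) ≫ C.A ◁ X.r := by
        rw [hr, hl, Category.assoc, X.comm, Category.assoc]
      _ = l ≫ C.A ◁ (r ≫ j ▷ D.A) := by
        rw [hr]
        bicategory
      _ = _ := by bicategory

/-- The regular bicomodule of a coring. -/
@[simps]
def regular (C : Coring a) : Bicoaction C C C.A where
  l := C.comul
  r := C.comul
  l_coassoc := C.coassoc
  l_counit := C.counit_left
  r_coassoc := C.coassoc
  r_counit := C.counit_right
  comm := C.coassoc

end Bicoaction

end Coring

/-! ### Passing the extra endomorphisms from a two-sided coaction to the one-sided ones -/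

section Endomorphisms

universe w₁ v₁ u₁

variable {B : Type u₁} [Bicategory.{w₁, v₁} B] {a b c d : B} {C : Coring a} {D : Coring b}
  {M : a ⟶ b} {coact : M ⟶ C.A ≫ M ≫ D.A} {f : M ⟶ M}

theorem left_endo_outer {v : C.A ⟶ C.A} (h : f ≫ coact = coact ≫ v ▷ (M ≫ D.A)) :
    f ≫ coact ≫ C.A ◁ (M ◁ D.counit ≫ (ρ_ M).hom) =
      (coact ≫ C.A ◁ (M ◁ D.counit ≫ (ρ_ M).hom)) ≫ v ▷ M := by
  rw [reassoc_of% h, Category.assoc, whisker_exchange]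

/-- After `coact`, the endomorphism `f` appears as `v` on the factor `D`, which is about to be
contracted. The counit does not distinguish `v` from `v'`, and the Takeuchi condition trades `v'`
for `f` on the middle factor. -/
theorem left_endo {v v' : D.A ⟶ D.A} (h : f ≫ coact = coact ≫ C.A ◁ M ◁ v)
    (h' : coact ≫ C.A ◁ f ▷ D.A = coact ≫ C.A ◁ M ◁ v') (hv : v ≫ D.counit = v' ≫ D.counit) :
    f ≫ coact ≫ C.A ◁ (M ◁ D.counit ≫ (ρ_ M).hom) =
      (coact ≫ C.A ◁ (M ◁ D.counit ≫ (ρ_ M).hom)) ≫ C.A ◁ f := by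
  rw [reassoc_of% h]
  calc _ = coact ≫ C.A ◁ (M ◁ (v ≫ D.counit) ≫ (ρ_ M).hom) := by bicategory
    _ = (coact ≫ C.A ◁ M ◁ v') ≫ C.A ◁ (M ◁ D.counit ≫ (ρ_ M).hom) := by
        rw [hv]
        bicategory
    _ = coact ≫ C.A ◁ ((f ▷ D.A ≫ M ◁ D.counit) ≫ (ρ_ M).hom) := by
        rw [← h']
        bicategory
    _ = _ := by
        rw [← whisker_exchange]
        bicategory

theorem left_takeuchi {v : C.A ⟶ C.A}
    (h : coact ≫ v ▷ (M ≫ D.A) = coact ≫ C.A ◁ f ▷ D.A) :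
    (coact ≫ C.A ◁ (M ◁ D.counit ≫ (ρ_ M).hom)) ≫ v ▷ M =
      (coact ≫ C.A ◁ (M ◁ D.counit ≫ (ρ_ M).hom)) ≫ C.A ◁ f := by
  rw [Category.assoc, whisker_exchange, reassoc_of% h]
  calc _ = coact ≫ C.A ◁ ((f ▷ D.A ≫ M ◁ D.counit) ≫ (ρ_ M).hom) := by bicategory
    _ = _ := by
        rw [← whisker_exchange]
        bicategory

/-- The same exchange, carried out at the factor `C` that is contracted away. -/
theorem right_endo {v v' : C.A ⟶ C.A} (h : f ≫ coact = coact ≫ v ▷ (M ≫ D.A))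
    (h' : coact ≫ v' ▷ (M ≫ D.A) = coact ≫ C.A ◁ f ▷ D.A) (hv : v' ≫ C.counit = v ≫ C.counit) :
    f ≫ coact ≫ C.counit ▷ (M ≫ D.A) ≫ (λ_ (M ≫ D.A)).hom =
      (coact ≫ C.counit ▷ (M ≫ D.A) ≫ (λ_ (M ≫ D.A)).hom) ≫ f ▷ D.A := by
  rw [reassoc_of% h]
  calc _ = coact ≫ (v ≫ C.counit) ▷ (M ≫ D.A) ≫ (λ_ (M ≫ D.A)).hom := by bicategory
    _ = (coact ≫ v' ▷ (M ≫ D.A)) ≫ C.counit ▷ (M ≫ D.A) ≫ (λ_ (M ≫ D.A)).hom := by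
        rw [← hv]
        bicategory
    _ = coact ≫ (C.A ◁ (f ▷ D.A) ≫ C.counit ▷ (M ≫ D.A)) ≫ (λ_ (M ≫ D.A)).hom := by
        rw [h']
        bicategory
    _ = _ := by
        rw [whisker_exchange]
        bicategory

theorem right_endo_outer {v : D.A ⟶ D.A} (h : f ≫ coact = coact ≫ C.A ◁ M ◁ v) :
    f ≫ coact ≫ C.counit ▷ (M ≫ D.A) ≫ (λ_ (M ≫ D.A)).hom =
      (coact ≫ C.counit ▷ (M ≫ D.A) ≫ (λ_ (M ≫ D.A)).hom) ≫ M ◁ v := by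
  rw [reassoc_of% h, whisker_exchange_assoc]
  bicategory

theorem right_takeuchi {v : D.A ⟶ D.A} (h : coact ≫ C.A ◁ f ▷ D.A = coact ≫ C.A ◁ M ◁ v) :
    (coact ≫ C.counit ▷ (M ≫ D.A) ≫ (λ_ (M ≫ D.A)).hom) ≫ f ▷ D.A =
      (coact ≫ C.counit ▷ (M ≫ D.A) ≫ (λ_ (M ≫ D.A)).hom) ≫ M ◁ v := by
  calc _ = coact ≫ (C.counit ▷ (M ≫ D.A) ≫ 𝟙 _ ◁ f ▷ D.A) ≫ (λ_ (M ≫ D.A)).hom := by bicategory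
    _ = (coact ≫ C.A ◁ f ▷ D.A) ≫ C.counit ▷ (M ≫ D.A) ≫ (λ_ (M ≫ D.A)).hom := by
        rw [← whisker_exchange]
        bicategory
    _ = coact ≫ (C.A ◁ M ◁ v ≫ C.counit ▷ (M ≫ D.A)) ≫ (λ_ (M ≫ D.A)).hom := by
        rw [h]
        bicategory
    _ = _ := by
        rw [whisker_exchange]
        bicategory

end Endomorphisms

/-! ### Coalgebroids and comodules in terms of corings and bicoactions -/

section

variable {k : Type w} [CommRing k] {R : Type u} [Ring R] [Algebra k R]
  {S : Type u} [Ring S] [Algebra k S] {T : Type u} [Ring T] [Algebra k T]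
  {U : Type u} [Ring U] [Algebra k U]

/-- The action of `p` by `lo`, as an endomorphism of the underlying bimodule. -/
def QBim.loHom (X : QBim k R S) (p : Rᵐᵒᵖ) : X.toBim.Hom X.toBim where
  lin := X.lo p
  map_l := X.lo_l p
  map_r := X.lo_r p

/-- The action of `q` by `lt`, as an endomorphism of the underlying bimodule. -/
def QBim.ltHom (X : QBim k R S) (q : S) : X.toBim.Hom X.toBim where
  lin := X.lt q
  map_l := X.lt_l q
  map_r := X.lt_r q

theorem QBim.Hom.loHom_comp {X Y : QBim k R S} (f : X.Hom Y) (p : Rᵐᵒᵖ) :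
    (X.loHom p).comp f.toBimHom = f.toBimHom.comp (Y.loHom p) :=
  Bim.hom_ext fun x => f.map_lo p x

theorem QBim.Hom.ltHom_comp {X Y : QBim k R S} (f : X.Hom Y) (q : S) :
    (X.ltHom q).comp f.toBimHom = f.toBimHom.comp (Y.ltHom q) :=
  Bim.hom_ext fun x => f.map_lt q x

/-- A bimodule homomorphism that commutes with `lo` and `lt`. -/
def QBim.homMk {X Y : QBim k R S} (f : X.toBim.Hom Y.toBim)
    (hlo : ∀ p, (X.loHom p).comp f = f.comp (Y.loHom p))
    (hlt : ∀ q, (X.ltHom q).comp f = f.comp (Y.ltHom q)) : X.Hom Y where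
  toBimHom := f
  map_lo p x := congrArg (fun g : X.toBim.Hom Y.toBim => g.lin x) (hlo p)
  map_lt p x := congrArg (fun g : X.toBim.Hom Y.toBim => g.lin x) (hlt p)

theorem QBim.tens_loHom (X : QBim k R S) (Y : QBim k S T) (p : Rᵐᵒᵖ) :
    (X.tens Y).loHom p = (X.loHom p).tens (Bim.Hom.id Y.toBim) :=
  Bim.tens_hom_ext fun x y => (Bim.onL_tmul X.toBim Y.toBim X.lo X.lo_r p x y).trans
    (Bim.Hom.tens_lin_tmul (X.loHom p) (Bim.Hom.id Y.toBim) x y).symm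

theorem QBim.tens_ltHom (X : QBim k R S) (Y : QBim k S T) (q : T) :
    (X.tens Y).ltHom q = (Bim.Hom.id X.toBim).tens (Y.ltHom q) :=
  Bim.tens_hom_ext fun x y => (Bim.onR_tmul X.toBim Y.toBim Y.lt Y.lt_l q x y).trans
    (Bim.Hom.tens_lin_tmul (Bim.Hom.id X.toBim) (Y.ltHom q) x y).symm

theorem Bim.onL_eq (X : Bim k R S) (Y : Bim k S T) {Q : Type u} [Ring Q] [Algebra k Q]
    (φ : Q →ₐ[k] Module.End k X.carrier) (h : ∀ q b x, φ q (X.r b x) = X.r b (φ q x)) (q : Q)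
    (f : X.Hom X) (hf : ∀ x, φ q x = f.lin x) :
    X.onL Y φ h q = (f.tens (Bim.Hom.id Y)).lin :=
  LinearMap.ext (Bim.tens_ext _ _ fun x y => by
    rw [Bim.onL_tmul, Bim.Hom.tens_lin_tmul, hf, Bim.Hom.id_lin])

theorem Bim.onR_eq (X : Bim k R S) (Y : Bim k S T) {Q : Type u} [Ring Q] [Algebra k Q]
    (φ : Q →ₐ[k] Module.End k Y.carrier) (h : ∀ q a y, φ q (Y.l a y) = Y.l a (φ q y)) (q : Q)
    (f : Y.Hom Y) (hf : ∀ y, φ q y = f.lin y) :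
    X.onR Y φ h q = ((Bim.Hom.id X).tens f).lin :=
  LinearMap.ext (Bim.tens_ext _ _ fun x y => by
    rw [Bim.onR_tmul, Bim.Hom.tens_lin_tmul, hf, Bim.Hom.id_lin])

/-- Rephrases membership through bimodule homomorphisms, so that the Takeuchi condition becomes an
equation between 2-cells and can be moved through bicategorical calculations. -/
theorem mem_takeuchi {X : QBim k R S} {Y : QBim k S T} {t : (X.tens Y).carrier} :
    t ∈ takeuchi X Y ↔ ∀ s, ((X.ltHom s).tens (Bim.Hom.id Y.toBim)).lin t =
      ((Bim.Hom.id X.toBim).tens (Y.loHom (op s))).lin t := by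
  refine forall_congr' fun s => ?_
  exact iff_of_eq (congrArg₂ (· = ·)
    (LinearMap.congr_fun (Bim.onL_eq X.toBim Y.toBim X.lt X.lt_r s (X.ltHom s) fun _ => rfl) t)
    (LinearMap.congr_fun (Bim.onR_eq X.toBim Y.toBim Y.lo Y.lo_l (op s) (Y.loHom (op s))
      fun _ => rfl) t))

theorem mem_takeuchi3 {X : QBim k R S} {Y : QBim k S T} {Z : QBim k T U}
    {t : (X.tens (Y.tens Z)).carrier} :
    t ∈ takeuchi3 X Y Z ↔
      (∀ s, ((X.ltHom s).tens (Bim.Hom.id (Y.toBim.tens Z.toBim))).lin t =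
        ((Bim.Hom.id X.toBim).tens ((Y.loHom (op s)).tens (Bim.Hom.id Z.toBim))).lin t) ∧
      ∀ s, ((Bim.Hom.id X.toBim).tens ((Y.ltHom s).tens (Bim.Hom.id Z.toBim))).lin t =
        ((Bim.Hom.id X.toBim).tens ((Bim.Hom.id Y.toBim).tens (Z.loHom (op s)))).lin t := by
  refine and_congr ?_ (forall_congr' fun s => ?_)
  · refine mem_takeuchi.trans (forall_congr' fun s => ?_)
    rw [QBim.tens_loHom]
  · exact iff_of_eq (congrArg₂ (· = ·)
      (LinearMap.congr_fun (Bim.onR_eq X.toBim (Y.toBim.tens Z.toBim)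
        (Bim.onL Y.toBim Z.toBim Y.lt Y.lt_r) (actL_comm _ _ _ _ _ _ Y.lt_l) s
        ((Y.ltHom s).tens (Bim.Hom.id Z.toBim))
        (LinearMap.congr_fun (Bim.onL_eq Y.toBim Z.toBim Y.lt Y.lt_r s (Y.ltHom s)
          fun _ => rfl))) t)
      (LinearMap.congr_fun (Bim.onR_eq X.toBim (Y.toBim.tens Z.toBim)
        (Bim.onR Y.toBim Z.toBim Z.lo Z.lo_l) (fun q a x => (actL_actR _ _ _ _ _ _ a q x).symm)
        (op s) ((Bim.Hom.id Y.toBim).tens (Z.loHom (op s)))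
        (LinearMap.congr_fun (Bim.onR_eq Y.toBim Z.toBim Z.lo Z.lo_l (op s) (Z.loHom (op s))
          fun _ => rfl))) t))

theorem Bim.tens_eq_comp {X X' : Bim k R S} {Y Y' : Bim k S T} (f : X.Hom X') (g : Y.Hom Y') :
    f.tens g = (f.tens (Bim.Hom.id Y)).comp ((Bim.Hom.id X').tens g) :=
  Bim.Hom.comp_tens_comp f (Bim.Hom.id X') (Bim.Hom.id Y) g

/-- The homomorphism `a ↦ ε(a)(1)`. -/
def evalOneHom {A : QBim k R R} (e : A.Hom (T0 k R)) : A.toBim.Hom (Bim.regular k R) where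
  lin := evalOne e
  map_l := evalOne_l e
  map_r s := evalOne_r e s.unop

theorem contrL_eq {A : QBim k R R} (e : A.Hom (T0 k R)) (X : Bim k R S) :
    contrL e X = ((evalOneHom e).tens (Bim.Hom.id X)).comp (lunit X).hom :=
  Bim.tens_hom_ext fun x y => (contrLLin_tmul e X x y).trans
    ((congrArg (Bim.Hom.lin (lunit X).hom)
      ((evalOneHom e).tens_lin_tmul (Bim.Hom.id X) x y)).trans (lunit_hom_tmul X _ _)).symm

theorem contrR_eq {A : QBim k S S} (e : A.Hom (T0 k S)) (X : Bim k R S) :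
    contrR e X = ((Bim.Hom.id X).tens (evalOneHom e)).comp (runit X).hom :=
  Bim.tens_hom_ext fun x y => (contrRLin_tmul e X x y).trans
    ((congrArg (Bim.Hom.lin (runit X).hom)
      ((Bim.Hom.id X).tens_lin_tmul (evalOneHom e) x y)).trans (runit_hom_tmul X _ _)).symm

/-- Both sides evaluate the endomorphism `e.lin a` at `s`, written once as `1 * s` and once as `s *
1`. This is the only place where the target of the counit being `Hom_k(R, R)` rather than `R`
matters. -/
theorem ltHom_comp_evalOneHom {A : QBim k R R} (e : A.Hom (T0 k R)) (s : R) :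
    (A.ltHom s).comp (evalOneHom e) = (A.loHom (op s)).comp (evalOneHom e) := by
  refine Bim.hom_ext fun a => ?_
  let f : R →ₗ[k] R := e.lin a
  have h1 : evalOne e (A.lt s a) = f (1 * s) :=
    congrArg (fun f : R →ₗ[k] R => f 1) (e.map_lt s a)
  have h2 : evalOne e (A.lo (op s) a) = f (s * 1) :=
    congrArg (fun f : R →ₗ[k] R => f 1) (e.map_lo (op s) a)
  exact h1.trans (((congrArg f ((one_mul s).trans (mul_one s).symm))).trans h2.symm)

end

section

variable {k : Type w} [CommRing k]

/-- The base algebra of a coalgebroid. -/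
abbrev Coalgebroid.base (𝒜 : Coalgebroid.{w, u} k) : AlgObj.{w, u} k := ⟨𝒜.R⟩

variable (𝒜 : Coalgebroid.{w, u} k)

/-- The coring underlying a coalgebroid. -/
def Coalgebroid.coring : Coring 𝒜.base where
  A := 𝒜.B
  comul := 𝒜.comul.ten2
  counit := evalOneHom 𝒜.counit
  coassoc := 𝒜.coassoc
  counit_left := by
    have h := 𝒜.counit_left
    rw [contrL_eq] at h
    exact h
  counit_right := by
    have h := 𝒜.counit_right
    rw [contrR_eq] at h
    exact h

variable {𝒜} {ℬ : Coalgebroid.{w, u} k}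

/-- The 1-cell underlying a bimodule over `Rᵐᵒᵖ ⊗ S`. -/
def QBim.cell (M : QBim k 𝒜.R ℬ.R) : 𝒜.base ⟶ ℬ.base := M.toBim

/-- The action of `p` by `lo`, as a 2-cell. -/
def QBim.lo₂ (M : QBim k 𝒜.R ℬ.R) (p : 𝒜.Rᵐᵒᵖ) : M.cell ⟶ M.cell := M.loHom p

/-- The action of `q` by `lt`, as a 2-cell. -/
def QBim.lt₂ (M : QBim k 𝒜.R ℬ.R) (q : ℬ.R) : M.cell ⟶ M.cell := M.ltHom q

variable (𝒜) in
/-- The action of `p` on a coalgebroid by `lo`, as a 2-cell. -/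
def Coalgebroid.lo₂ (p : 𝒜.Rᵐᵒᵖ) : 𝒜.coring.A ⟶ 𝒜.coring.A := 𝒜.A.loHom p

variable (𝒜) in
/-- The action of `q` on a coalgebroid by `lt`, as a 2-cell. -/
def Coalgebroid.lt₂ (q : 𝒜.R) : 𝒜.coring.A ⟶ 𝒜.coring.A := 𝒜.A.ltHom q

theorem Coalgebroid.lt₂_counit (s : 𝒜.R) :
    𝒜.lt₂ s ≫ 𝒜.coring.counit = 𝒜.lo₂ (op s) ≫ 𝒜.coring.counit :=
  ltHom_comp_evalOneHom 𝒜.counit s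

/-- The coaction of a comodule, as a 2-cell. -/
def Comodule.coact₂ (M : Comodule 𝒜 ℬ) :
    M.M.cell ⟶ 𝒜.coring.A ≫ M.M.cell ≫ ℬ.coring.A := M.coact.ten3

variable (M : Comodule 𝒜 ℬ)

theorem Comodule.left_eq :
    M.left = M.coact₂ ≫ 𝒜.coring.A ◁ (M.M.cell ◁ ℬ.coring.counit ≫ (ρ_ M.M.cell).hom) := by
  rw [Comodule.left, contrR_eq]
  rfl

theorem Comodule.right_eq :
    M.right = M.coact₂ ≫ 𝒜.coring.counit ▷ (M.M.cell ≫ ℬ.coring.A) ≫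
      (λ_ (M.M.cell ≫ ℬ.coring.A)).hom := by
  rw [Comodule.right, contrL_eq]
  rfl

theorem Comodule.coact₂_coassoc : M.coact₂ ≫ 𝒜.coring.A ◁ (M.coact₂ ▷ ℬ.coring.A) ≫
      𝒜.coring.A ◁ ((α_ 𝒜.coring.A (M.M.cell ≫ ℬ.coring.A) ℬ.coring.A).hom ≫
        𝒜.coring.A ◁ (α_ M.M.cell ℬ.coring.A ℬ.coring.A).hom) =
    M.coact₂ ≫ (𝒜.coring.comul ▷ (M.M.cell ≫ ℬ.coring.A) ≫
      (𝒜.coring.A ≫ 𝒜.coring.A) ◁ (M.M.cell ◁ ℬ.coring.comul)) ≫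
      (α_ 𝒜.coring.A 𝒜.coring.A (M.M.cell ≫ ℬ.coring.A ≫ ℬ.coring.A)).hom := by
  have h := M.coassoc
  rw [Bim.tens_eq_comp 𝒜.comul.ten2] at h
  exact h

theorem Comodule.coact₂_counit :
    (M.coact₂ ≫ 𝒜.coring.counit ▷ (M.M.cell ≫ ℬ.coring.A) ≫
      (λ_ (M.M.cell ≫ ℬ.coring.A)).hom) ≫ M.M.cell ◁ ℬ.coring.counit ≫ (ρ_ M.M.cell).hom =
      𝟙 M.M.cell := by
  have h := M.counit
  rw [contrL_eq, contrR_eq] at h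
  exact h

/-- The commuting coactions of a comodule. -/
def Comodule.bicoaction : Bicoaction 𝒜.coring ℬ.coring M.M.cell :=
  Bicoaction.ofCoact M.coact₂ M.coact₂_coassoc M.coact₂_counit

theorem Comodule.bicoaction_l : M.bicoaction.l = M.left := M.left_eq.symm

theorem Comodule.bicoaction_r : M.bicoaction.r = M.right := M.right_eq.symm

theorem Comodule.bicoaction_coact : M.bicoaction.coact = M.coact₂ :=
  (coact_eq_left_comp_right M.coact₂ M.coact₂_coassoc).symm

/-- The compatibility of a bicoaction with the actions by `lo` and `lt`. -/
structure Compatible (M : QBim k 𝒜.R ℬ.R) (X : Bicoaction 𝒜.coring ℬ.coring M.cell) : Prop where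
  lo_l : ∀ p, M.lo₂ p ≫ X.l = X.l ≫ 𝒜.lo₂ p ▷ M.cell
  lt_l : ∀ q, M.lt₂ q ≫ X.l = X.l ≫ 𝒜.coring.A ◁ M.lt₂ q
  takeuchi_l : ∀ s, X.l ≫ 𝒜.lt₂ s ▷ M.cell = X.l ≫ 𝒜.coring.A ◁ M.lo₂ (op s)
  lo_r : ∀ p, M.lo₂ p ≫ X.r = X.r ≫ M.lo₂ p ▷ ℬ.coring.A
  lt_r : ∀ q, M.lt₂ q ≫ X.r = X.r ≫ M.cell ◁ ℬ.lt₂ q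
  takeuchi_r : ∀ s, X.r ≫ M.lt₂ s ▷ ℬ.coring.A = X.r ≫ M.cell ◁ ℬ.lo₂ (op s)

theorem Comodule.lo_coact₂ (p) :
    M.M.lo₂ p ≫ M.coact₂ = M.coact₂ ≫ 𝒜.lo₂ p ▷ (M.M.cell ≫ ℬ.coring.A) := by
  have h := (M.coact.comp (T3.incl _ _ _)).loHom_comp p
  rw [QBim.tens_loHom] at h
  exact h

theorem Comodule.lt_coact₂ (q) :
    M.M.lt₂ q ≫ M.coact₂ = M.coact₂ ≫ 𝒜.coring.A ◁ M.M.cell ◁ ℬ.lt₂ q := by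
  have h := (M.coact.comp (T3.incl _ _ _)).ltHom_comp q
  rw [QBim.tens_ltHom, QBim.tens_ltHom] at h
  exact h

theorem Comodule.coact₂_takeuchi_left (s) :
    M.coact₂ ≫ 𝒜.lt₂ s ▷ (M.M.cell ≫ ℬ.coring.A) =
      M.coact₂ ≫ 𝒜.coring.A ◁ M.M.lo₂ (op s) ▷ ℬ.coring.A :=
  Bim.hom_ext fun x => (mem_takeuchi3.1 (M.coact.lin x).2).1 s

theorem Comodule.coact₂_takeuchi_right (s) :
    M.coact₂ ≫ 𝒜.coring.A ◁ M.M.lt₂ s ▷ ℬ.coring.A =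
      M.coact₂ ≫ 𝒜.coring.A ◁ M.M.cell ◁ ℬ.lo₂ (op s) :=
  Bim.hom_ext fun x => (mem_takeuchi3.1 (M.coact.lin x).2).2 s

/-- For `lt_l` and `lo_r` the action passes through a factor that is contracted, and the counit
identity `lt₂_counit` is required; the other four laws only use naturality. -/
theorem Comodule.compatible : Compatible M.M M.bicoaction where
  lo_l p := left_endo_outer (M.lo_coact₂ p)
  lt_l q := left_endo (M.lt_coact₂ q) (M.coact₂_takeuchi_right q) (ℬ.lt₂_counit q)
  takeuchi_l s := left_takeuchi (M.coact₂_takeuchi_left s)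
  lo_r p := right_endo (M.lo_coact₂ p) (M.coact₂_takeuchi_left p.unop) (𝒜.lt₂_counit p.unop)
  lt_r q := right_endo_outer (M.lt_coact₂ q)
  takeuchi_r s := right_takeuchi (M.coact₂_takeuchi_right s)

theorem Compatible.lo_coact {M : QBim k 𝒜.R ℬ.R} {X : Bicoaction 𝒜.coring ℬ.coring M.cell}
    (h : Compatible M X) (p) :
    M.lo₂ p ≫ X.coact = X.coact ≫ 𝒜.lo₂ p ▷ (M.cell ≫ ℬ.coring.A) := by
  rw [Bicoaction.coact, reassoc_of% h.lo_l p, Category.assoc, whisker_exchange]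

theorem Compatible.lt_coact {M : QBim k 𝒜.R ℬ.R} {X : Bicoaction 𝒜.coring ℬ.coring M.cell}
    (h : Compatible M X) (q) :
    M.lt₂ q ≫ X.coact = X.coact ≫ 𝒜.coring.A ◁ M.cell ◁ ℬ.lt₂ q := by
  rw [Bicoaction.coact, reassoc_of% h.lt_l q, Category.assoc, ← whiskerLeft_comp, h.lt_r,
    whiskerLeft_comp]

theorem Compatible.takeuchi_left {M : QBim k 𝒜.R ℬ.R} {X : Bicoaction 𝒜.coring ℬ.coring M.cell}
    (h : Compatible M X) (s) : X.coact ≫ 𝒜.lt₂ s ▷ (M.cell ≫ ℬ.coring.A) =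
      X.coact ≫ 𝒜.coring.A ◁ M.lo₂ (op s) ▷ ℬ.coring.A := by
  rw [Bicoaction.coact, Category.assoc, whisker_exchange, reassoc_of% h.takeuchi_l s,
    ← whiskerLeft_comp, h.lo_r, whiskerLeft_comp, Category.assoc]

theorem Compatible.takeuchi_right {M : QBim k 𝒜.R ℬ.R} {X : Bicoaction 𝒜.coring ℬ.coring M.cell}
    (h : Compatible M X) (s) : X.coact ≫ 𝒜.coring.A ◁ M.lt₂ s ▷ ℬ.coring.A =
      X.coact ≫ 𝒜.coring.A ◁ M.cell ◁ ℬ.lo₂ (op s) := by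
  rw [Bicoaction.coact, Category.assoc, Category.assoc, ← whiskerLeft_comp, h.takeuchi_r,
    whiskerLeft_comp]

theorem Compatible.coact_mem {M : QBim k 𝒜.R ℬ.R} {X : Bicoaction 𝒜.coring ℬ.coring M.cell}
    (h : Compatible M X) (x : M.carrier) :
    Bim.Hom.lin X.coact x ∈ takeuchi3 𝒜.A M ℬ.A :=
  mem_takeuchi3.2
    ⟨fun s => congrArg (fun f : M.cell ⟶ 𝒜.coring.A ≫ M.cell ≫ ℬ.coring.A => Bim.Hom.lin f x)
      (h.takeuchi_left s),
    fun s => congrArg (fun f : M.cell ⟶ 𝒜.coring.A ≫ M.cell ≫ ℬ.coring.A => Bim.Hom.lin f x)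
      (h.takeuchi_right s)⟩

theorem lin_congr {a b : AlgObj.{w, u} k} {X Y : a ⟶ b} {f g : X ⟶ Y} (h : f = g) (x) :
    Bim.Hom.lin f x = Bim.Hom.lin g x := by rw [h]

/-- The homomorphism into a stable submodule given by a homomorphism that maps into it. -/
def QBim.Hom.codRestrict {R S : Type u} [Ring R] [Algebra k R] [Ring S] [Algebra k S]
    {X Y : QBim k R S} (f : X.Hom Y) {N : Submodule k Y.carrier} (hN : Y.Stable N)
    (h : ∀ x, f.lin x ∈ N) : X.Hom (Y.sub N hN) where
  lin := f.lin.codRestrict N h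
  map_l a x := Subtype.ext (f.map_l a x)
  map_r a x := Subtype.ext (f.map_r a x)
  map_lo a x := Subtype.ext (f.map_lo a x)
  map_lt a x := Subtype.ext (f.map_lt a x)

/-- The comodule given by compatible commuting coactions. -/
def Bicoaction.toComodule {M : QBim k 𝒜.R ℬ.R} (X : Bicoaction 𝒜.coring ℬ.coring M.cell)
    (h : Compatible M X) : Comodule 𝒜 ℬ where
  M := M
  coact := QBim.Hom.codRestrict (Y := 𝒜.A.tens (M.tens ℬ.A)) (QBim.homMk X.coact
    (fun p => by
      rw [QBim.tens_loHom]
      exact h.lo_coact p)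
    (fun q => by
      rw [QBim.tens_ltHom, QBim.tens_ltHom]
      exact h.lt_coact q)) (takeuchi3_stable _ _ _) h.coact_mem
  coassoc := by
    have := X.coact_coassoc
    rw [Bim.tens_eq_comp 𝒜.comul.ten2]
    exact this
  counit := by
    have h1 := X.r_counit
    rw [← X.coact_counit] at h1
    rw [contrL_eq, contrR_eq]
    exact h1

variable {M : QBim k 𝒜.R ℬ.R} (X : Bicoaction 𝒜.coring ℬ.coring M.cell) (h : Compatible M X)

theorem Bicoaction.toComodule_left : (X.toComodule h).left = X.l :=
  (X.toComodule h).left_eq.trans X.coact_counit'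

theorem Bicoaction.toComodule_right : (X.toComodule h).right = X.r :=
  (X.toComodule h).right_eq.trans X.coact_counit

end

/-! ### Homomorphisms of bicoactions -/

section Bicategorical

universe w₁ v₁ u₁

variable {B : Type u₁} [Bicategory.{w₁, v₁} B] {a b c d : B} {C : Coring a} {D : Coring b}
  {E : Coring c} {F : Coring d} {M M' M'' : a ⟶ b} {N N' : b ⟶ c} {P : c ⟶ d}

namespace Bicoaction

/-- A 2-cell that commutes with the coactions. -/
structure IsHom (X : Bicoaction C D M) (X' : Bicoaction C D M') (f : M ⟶ M') : Prop where
  l : X.l ≫ C.A ◁ f = f ≫ X'.l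
  r : X.r ≫ f ▷ D.A = f ≫ X'.r

variable {X : Bicoaction C D M} {X' : Bicoaction C D M'} {X'' : Bicoaction C D M''}
  {Y : Bicoaction D E N} {Y' : Bicoaction D E N'} {Z : Bicoaction E F P}

theorem IsHom.comp {f : M ⟶ M'} {g : M' ⟶ M''} (hf : IsHom X X' f) (hg : IsHom X' X'' g) :
    IsHom X X'' (f ≫ g) where
  l := by rw [whiskerLeft_comp, reassoc_of% hf.l, hg.l, Category.assoc]
  r := by rw [comp_whiskerRight, reassoc_of% hf.r, hg.r, Category.assoc]

theorem IsHom.of_comp {f : M ⟶ M'} {j : M' ⟶ M''} (hj : IsHom X' X'' j) [Mono (C.A ◁ j)]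
    [Mono (j ▷ D.A)] (hf : IsHom X X'' (f ≫ j)) : IsHom X X' f where
  l := by
    rw [← cancel_mono (C.A ◁ j), Category.assoc, ← whiskerLeft_comp, hf.l, Category.assoc,
      Category.assoc, hj.l]
  r := by
    rw [← cancel_mono (j ▷ D.A), Category.assoc, ← comp_whiskerRight, hf.r, Category.assoc,
      Category.assoc, hj.r]

theorem IsHom.whiskerRight {f : M ⟶ M'} (hf : IsHom X X' f) (Y : Bicoaction D E N) :
    IsHom (X.tens Y) (X'.tens Y) (f ▷ N) where
  l := by
    rw [tens_l, tens_l]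
    calc _ = (X.l ≫ C.A ◁ f) ▷ N ≫ (α_ _ _ _).hom := by bicategory
      _ = _ := by
        rw [hf.l]
        bicategory
  r := by
    rw [tens_r, tens_r, ← whisker_exchange_assoc]
    bicategory

theorem IsHom.whiskerLeft (X : Bicoaction C D M) {f : N ⟶ N'} (hf : IsHom Y Y' f) :
    IsHom (X.tens Y) (X.tens Y') (M ◁ f) where
  l := by
    rw [tens_l, tens_l, whisker_exchange_assoc]
    bicategory
  r := by
    rw [tens_r, tens_r]
    calc _ = M ◁ (Y.r ≫ f ▷ E.A) ≫ (α_ _ _ _).inv := by bicategory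
      _ = _ := by
        rw [hf.r]
        bicategory

theorem isHom_associator (X : Bicoaction C D M) (Y : Bicoaction D E N) (Z : Bicoaction E F P) :
    IsHom ((X.tens Y).tens Z) (X.tens (Y.tens Z)) (α_ M N P).hom where
  l := by
    simp only [tens_l]
    bicategory
  r := by
    simp only [tens_r]
    bicategory

theorem IsHom.inv {f : M ≅ M'} (hf : IsHom X X' f.hom) : IsHom X' X f.inv where
  l := by
    rw [← cancel_epi f.hom, f.hom_inv_id_assoc, ← reassoc_of% hf.l, ← whiskerLeft_comp,
      f.hom_inv_id, whiskerLeft_id, Category.comp_id]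
  r := by
    rw [← cancel_epi f.hom, f.hom_inv_id_assoc, ← reassoc_of% hf.r, ← comp_whiskerRight,
      f.hom_inv_id, id_whiskerRight, Category.comp_id]

/-- Left colinearity of a coaction is its coassociativity; right colinearity is its commutation with
the other coaction. -/
theorem isHom_l (X : Bicoaction C D M) : IsHom X ((regular C).tens X) X.l where
  l := X.l_coassoc.symm
  r := by
    rw [tens_r, ← reassoc_of% X.comm]
    bicategory

theorem isHom_r (X : Bicoaction C D M) : IsHom X (X.tens (regular D)) X.r where
  l := by
    rw [tens_l]
    exact X.comm.symm
  r := by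
    rw [tens_r]
    calc _ = (X.r ≫ X.r ▷ D.A ≫ (α_ _ _ _).hom) ≫ (α_ _ _ _).inv := by bicategory
      _ = _ := by
        rw [X.r_coassoc]
        simp

/-! ### Stability of the cotensor and Takeuchi equations -/

section Cotensor

variable {Q : a ⟶ c} {j : Q ⟶ M ≫ N}

/-- The cotensor equation concerns the right coaction of `M`, which commutes with its left coaction.
Hence the left coaction of `M` carries the equation into the last two factors. -/
theorem tens_l_equalizes (h : j ≫ X.r ▷ N ≫ (α_ M D.A N).hom = j ≫ M ◁ Y.l) :
    (j ≫ (X.tens Y).l) ≫ C.A ◁ (X.r ▷ N ≫ (α_ M D.A N).hom) =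
      (j ≫ (X.tens Y).l) ≫ C.A ◁ M ◁ Y.l := by
  rw [tens_l]
  calc _ = j ≫ (X.l ≫ C.A ◁ X.r) ▷ N ≫ (α_ _ _ _).hom ≫ C.A ◁ (α_ _ _ _).hom := by bicategory
    _ = (j ≫ X.r ▷ N ≫ (α_ _ _ _).hom) ≫ X.l ▷ (D.A ≫ N) ≫ (α_ _ _ _).hom := by
        rw [← X.comm]
        bicategory
    _ = _ := by
        rw [h, Category.assoc, whisker_exchange_assoc]
        bicategory

/-- Here it is the two coactions of `N` whose commutation is used. -/
theorem tens_r_equalizes (h : j ≫ X.r ▷ N ≫ (α_ M D.A N).hom = j ≫ M ◁ Y.l) :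
    (j ≫ (X.tens Y).r) ≫ (X.r ▷ N ≫ (α_ M D.A N).hom) ▷ E.A =
      (j ≫ (X.tens Y).r) ≫ (M ◁ Y.l) ▷ E.A := by
  rw [tens_r]
  calc _ = j ≫ (M ◁ Y.r ≫ X.r ▷ (N ≫ E.A)) ≫ (α_ _ _ _).inv ≫ (α_ _ _ _).hom ▷ E.A := by
        bicategory
    _ = (j ≫ X.r ▷ N ≫ (α_ _ _ _).hom) ≫ M ◁ D.A ◁ Y.r ≫ M ◁ (α_ _ _ _).inv ≫
          (α_ _ _ _).inv := by
        rw [whisker_exchange]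
        bicategory
    _ = j ≫ M ◁ (Y.l ≫ D.A ◁ Y.r) ≫ M ◁ (α_ _ _ _).inv ≫ (α_ _ _ _).inv := by
        rw [h]
        bicategory
    _ = _ := by
        rw [← Y.comm]
        bicategory

/-- In the application `u` is an action `lt` on `M` and `v` the matching action `lo` on `N`; one
Takeuchi equation survives because `u` is left colinear. -/
theorem tens_l_takeuchi {u : M ⟶ M} {v : N ⟶ N} (hu : u ≫ X.l = X.l ≫ C.A ◁ u)
    (h : j ≫ u ▷ N = j ≫ M ◁ v) :
    (j ≫ (X.tens Y).l) ≫ C.A ◁ u ▷ N = (j ≫ (X.tens Y).l) ≫ C.A ◁ M ◁ v := by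
  rw [tens_l]
  calc _ = j ≫ (X.l ≫ C.A ◁ u) ▷ N ≫ (α_ _ _ _).hom := by bicategory
    _ = (j ≫ u ▷ N) ≫ X.l ▷ N ≫ (α_ _ _ _).hom := by
        rw [← hu]
        bicategory
    _ = _ := by
        rw [h, Category.assoc, whisker_exchange_assoc]
        bicategory

theorem tens_r_takeuchi {u : M ⟶ M} {v : N ⟶ N} (hv : v ≫ Y.r = Y.r ≫ v ▷ E.A)
    (h : j ≫ u ▷ N = j ≫ M ◁ v) :
    (j ≫ (X.tens Y).r) ≫ (u ▷ N) ▷ E.A = (j ≫ (X.tens Y).r) ≫ (M ◁ v) ▷ E.A := by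
  rw [tens_r]
  calc _ = j ≫ (M ◁ Y.r ≫ u ▷ (N ≫ E.A)) ≫ (α_ _ _ _).inv := by bicategory
    _ = (j ≫ u ▷ N) ≫ M ◁ Y.r ≫ (α_ _ _ _).inv := by
        rw [whisker_exchange]
        simp only [Category.assoc]
    _ = j ≫ M ◁ (v ≫ Y.r) ≫ (α_ _ _ _).inv := by
        rw [h]
        bicategory
    _ = _ := by
        rw [hv]
        bicategory

theorem whiskerRight_equalizes {f : M ⟶ M'} (hf : IsHom X X' f)
    (h : j ≫ X.r ▷ N ≫ (α_ M D.A N).hom = j ≫ M ◁ Y.l) :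
    (j ≫ f ▷ N) ≫ X'.r ▷ N ≫ (α_ M' D.A N).hom = (j ≫ f ▷ N) ≫ M' ◁ Y.l := by
  calc _ = j ≫ (f ≫ X'.r) ▷ N ≫ (α_ _ _ _).hom := by bicategory
    _ = (j ≫ X.r ▷ N ≫ (α_ M D.A N).hom) ≫ f ▷ (D.A ≫ N) := by
        rw [← hf.r]
        bicategory
    _ = _ := by
        rw [h, Category.assoc, whisker_exchange, Category.assoc]

theorem whiskerLeft_equalizes {f : N ⟶ N'} (hf : IsHom Y Y' f)
    (h : j ≫ X.r ▷ N ≫ (α_ M D.A N).hom = j ≫ M ◁ Y.l) :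
    (j ≫ M ◁ f) ≫ X.r ▷ N' ≫ (α_ M D.A N').hom = (j ≫ M ◁ f) ≫ M ◁ Y'.l := by
  calc _ = j ≫ (M ◁ f ≫ X.r ▷ N') ≫ (α_ M D.A N').hom := by simp only [Category.assoc]
    _ = (j ≫ X.r ▷ N ≫ (α_ M D.A N).hom) ≫ M ◁ D.A ◁ f := by
        rw [whisker_exchange]
        bicategory
    _ = j ≫ M ◁ (Y.l ≫ D.A ◁ f) := by
        rw [h]
        bicategory
    _ = _ := by
        rw [hf.l]
        bicategory

theorem whiskerRight_takeuchi {f : M ⟶ M'} {u : M ⟶ M} {u' : M' ⟶ M'} {v : N ⟶ N}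
    (hf : u ≫ f = f ≫ u') (h : j ≫ u ▷ N = j ≫ M ◁ v) :
    (j ≫ f ▷ N) ≫ u' ▷ N = (j ≫ f ▷ N) ≫ M' ◁ v := by
  rw [Category.assoc, ← comp_whiskerRight, ← hf, comp_whiskerRight, reassoc_of% h,
    whisker_exchange, Category.assoc]

theorem whiskerLeft_takeuchi {f : N ⟶ N'} {u : M ⟶ M} {v : N ⟶ N} {v' : N' ⟶ N'}
    (hf : v ≫ f = f ≫ v') (h : j ≫ u ▷ N = j ≫ M ◁ v) :
    (j ≫ M ◁ f) ≫ u ▷ N' = (j ≫ M ◁ f) ≫ M ◁ v' := by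
  rw [Category.assoc, whisker_exchange, reassoc_of% h, Category.assoc, ← whiskerLeft_comp, hf,
    whiskerLeft_comp]

end Cotensor

section Tens

/-! Compatibility with endomorphisms: tensor products and subobjects. -/

variable {u : M ⟶ M} {v : N ⟶ N}

theorem tens_lo_l {p : C.A ⟶ C.A} (h : u ≫ X.l = X.l ≫ p ▷ M) :
    u ▷ N ≫ (X.tens Y).l = (X.tens Y).l ≫ p ▷ (M ≫ N) := by
  rw [tens_l, ← comp_whiskerRight_assoc, h]
  bicategory

theorem tens_lt_l : M ◁ v ≫ (X.tens Y).l = (X.tens Y).l ≫ C.A ◁ M ◁ v := by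
  rw [tens_l, whisker_exchange_assoc]
  bicategory

theorem tens_takeuchi_l {p : C.A ⟶ C.A} (h : X.l ≫ p ▷ M = X.l ≫ C.A ◁ u) :
    (X.tens Y).l ≫ p ▷ (M ≫ N) = (X.tens Y).l ≫ C.A ◁ u ▷ N := by
  rw [tens_l]
  calc _ = (X.l ≫ p ▷ M) ▷ N ≫ (α_ _ _ _).hom := by bicategory
    _ = _ := by
        rw [h]
        bicategory

theorem tens_lo_r : u ▷ N ≫ (X.tens Y).r = (X.tens Y).r ≫ (u ▷ N) ▷ E.A := by
  rw [tens_r, ← whisker_exchange_assoc]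
  bicategory

theorem tens_lt_r {q : E.A ⟶ E.A} (h : v ≫ Y.r = Y.r ≫ N ◁ q) :
    M ◁ v ≫ (X.tens Y).r = (X.tens Y).r ≫ (M ≫ N) ◁ q := by
  rw [tens_r, ← whiskerLeft_comp_assoc, h]
  bicategory

theorem tens_takeuchi_r {q : E.A ⟶ E.A} (h : Y.r ≫ v ▷ E.A = Y.r ≫ N ◁ q) :
    (X.tens Y).r ≫ (M ◁ v) ▷ E.A = (X.tens Y).r ≫ (M ≫ N) ◁ q := by
  rw [tens_r]
  calc _ = M ◁ (Y.r ≫ v ▷ E.A) ≫ (α_ _ _ _).inv := by bicategory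
    _ = _ := by
        rw [h]
        bicategory

theorem lo_equalizer_left {p : M ⟶ M} (h : p ≫ X.r = X.r ≫ p ▷ D.A) :
    p ▷ N ≫ X.r ▷ N ≫ (α_ M D.A N).hom = (X.r ▷ N ≫ (α_ M D.A N).hom) ≫ p ▷ (D.A ≫ N) := by
  rw [← comp_whiskerRight_assoc, h]
  bicategory

theorem lt_equalizer_left :
    M ◁ v ≫ X.r ▷ N ≫ (α_ M D.A N).hom = (X.r ▷ N ≫ (α_ M D.A N).hom) ≫ M ◁ D.A ◁ v := by
  rw [whisker_exchange_assoc]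
  bicategory

theorem lt_equalizer_right (h : v ≫ Y.l = Y.l ≫ D.A ◁ v) :
    M ◁ v ≫ M ◁ Y.l = M ◁ Y.l ≫ M ◁ D.A ◁ v := by
  rw [← whiskerLeft_comp, h, whiskerLeft_comp]

end Tens

/-! ### Inheritance of endomorphism laws by subobjects -/

section Sub

variable {j : M ⟶ M'} {u : M ⟶ M} {u' : M' ⟶ M'}

theorem IsHom.lo_l (hj : IsHom X X' j) [Mono (C.A ◁ j)] (hu : u ≫ j = j ≫ u') {p : C.A ⟶ C.A}
    (h : u' ≫ X'.l = X'.l ≫ p ▷ M') : u ≫ X.l = X.l ≫ p ▷ M := by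
  rw [← cancel_mono (C.A ◁ j), Category.assoc, Category.assoc, hj.l, reassoc_of% hu, h,
    ← whisker_exchange, reassoc_of% hj.l]

theorem IsHom.lt_l (hj : IsHom X X' j) [Mono (C.A ◁ j)] (hu : u ≫ j = j ≫ u')
    (h : u' ≫ X'.l = X'.l ≫ C.A ◁ u') : u ≫ X.l = X.l ≫ C.A ◁ u := by
  rw [← cancel_mono (C.A ◁ j), Category.assoc, Category.assoc, hj.l, reassoc_of% hu, h,
    ← whiskerLeft_comp, hu, whiskerLeft_comp, reassoc_of% hj.l]

theorem IsHom.takeuchi_l (hj : IsHom X X' j) [Mono (C.A ◁ j)] (hu : u ≫ j = j ≫ u')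
    {p : C.A ⟶ C.A} (h : X'.l ≫ p ▷ M' = X'.l ≫ C.A ◁ u') : X.l ≫ p ▷ M = X.l ≫ C.A ◁ u := by
  rw [← cancel_mono (C.A ◁ j), Category.assoc, Category.assoc, ← whisker_exchange,
    reassoc_of% hj.l, h, ← whiskerLeft_comp, hu, whiskerLeft_comp, reassoc_of% hj.l]

theorem IsHom.lo_r (hj : IsHom X X' j) [Mono (j ▷ D.A)] (hu : u ≫ j = j ≫ u')
    (h : u' ≫ X'.r = X'.r ≫ u' ▷ D.A) : u ≫ X.r = X.r ≫ u ▷ D.A := by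
  rw [← cancel_mono (j ▷ D.A), Category.assoc, Category.assoc, hj.r, reassoc_of% hu, h,
    ← comp_whiskerRight, hu, comp_whiskerRight, reassoc_of% hj.r]

theorem IsHom.lt_r (hj : IsHom X X' j) [Mono (j ▷ D.A)] (hu : u ≫ j = j ≫ u') {q : D.A ⟶ D.A}
    (h : u' ≫ X'.r = X'.r ≫ M' ◁ q) : u ≫ X.r = X.r ≫ M ◁ q := by
  rw [← cancel_mono (j ▷ D.A), Category.assoc, Category.assoc, hj.r, reassoc_of% hu, h,
    whisker_exchange, reassoc_of% hj.r]

theorem IsHom.takeuchi_r (hj : IsHom X X' j) [Mono (j ▷ D.A)] (hu : u ≫ j = j ≫ u')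
    {q : D.A ⟶ D.A} (h : X'.r ≫ u' ▷ D.A = X'.r ≫ M' ◁ q) : X.r ≫ u ▷ D.A = X.r ≫ M ◁ q := by
  rw [← cancel_mono (j ▷ D.A), Category.assoc, Category.assoc, whisker_exchange,
    reassoc_of% hj.r, ← h, ← comp_whiskerRight, hu, comp_whiskerRight, reassoc_of% hj.r]

end Sub

/-- Contract the first factor of the cotensor equation with the counit: one side becomes the
composite in question, and the other collapses to `j` by counitality of `C`. This will be the
inverse law of the left unitor. -/
theorem regular_tens_inv {Q : a ⟶ b} {j : Q ⟶ C.A ≫ M}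
    (h : j ≫ C.comul ▷ M ≫ (α_ C.A C.A M).hom = j ≫ C.A ◁ X.l) :
    (j ≫ C.counit ▷ M ≫ (λ_ M).hom) ≫ X.l = j := by
  calc _ = j ≫ (C.counit ▷ M ≫ 𝟙 _ ◁ X.l) ≫ (λ_ _).hom := by bicategory
    _ = (j ≫ C.comul ▷ M ≫ (α_ C.A C.A M).hom) ≫ C.counit ▷ (C.A ≫ M) ≫ (λ_ _).hom := by
        rw [← whisker_exchange, h]
        simp only [Category.assoc]
    _ = j ≫ (C.comul ≫ C.counit ▷ C.A ≫ (λ_ _).hom) ▷ M := by bicategory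
    _ = j := by
        rw [C.counit_left]
        simp

/-- On this side the last factor is contracted. -/
theorem tens_regular_inv {Q : a ⟶ b} {j : Q ⟶ M ≫ D.A}
    (h : j ≫ X.r ▷ D.A ≫ (α_ M D.A D.A).hom = j ≫ M ◁ D.comul) :
    (j ≫ M ◁ D.counit ≫ (ρ_ M).hom) ≫ X.r = j := by
  calc _ = j ≫ (M ◁ D.counit ≫ X.r ▷ 𝟙 _) ≫ (ρ_ _).hom := by bicategory
    _ = (j ≫ X.r ▷ D.A ≫ (α_ M D.A D.A).hom) ≫ M ◁ (D.A ◁ D.counit ≫ (ρ_ _).hom) := by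
        rw [whisker_exchange]
        bicategory
    _ = j ≫ M ◁ (D.comul ≫ D.A ◁ D.counit ≫ (ρ_ _).hom) := by
        rw [h]
        bicategory
    _ = j := by
        rw [D.counit_right]
        simp

theorem comp_tens_coact {Q : a ⟶ c} (j : Q ⟶ M ≫ N) :
    (j ≫ (X.tens Y).coact) ≫ C.A ◁ (α_ M N E.A).hom =
      (j ≫ X.l ▷ N ≫ (C.A ≫ M) ◁ Y.r) ≫ (α_ C.A M (N ≫ E.A)).hom := by
  rw [coact, tens_l, tens_r]
  bicategory

end Bicoaction

end Bicategorical

/-! ### The composite of two comodules -/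

section

variable {k : Type w} [CommRing k]

theorem mono_of_injective {a b : AlgObj.{w, u} k} {X Y : a ⟶ b} (f : X ⟶ Y)
    (hf : Function.Injective (Bim.Hom.lin f)) : Mono f :=
  ⟨fun _ _ e => Bim.hom_ext fun x => hf (lin_congr e x)⟩

/-- A homomorphism that takes values in the image of an injective one factors through it. -/
theorem exists_factor {a b : AlgObj.{w, u} k} {X Y Z : a ⟶ b} (j : X ⟶ Y)
    (hj : Function.Injective (Bim.Hom.lin j)) (f : Z ⟶ Y)
    (hf : ∀ z, ∃ x, Bim.Hom.lin j x = Bim.Hom.lin f z) : ∃ g : Z ⟶ X, g ≫ j = f := by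
  choose g hg using hf
  refine ⟨{ lin := { toFun := g, map_add' := fun x y => hj ?_, map_smul' := fun c x => hj ?_ },
            map_l := fun a x => hj ?_, map_r := fun b x => hj ?_ }, Bim.hom_ext hg⟩
  · simp only [map_add, hg]
  · simp only [map_smul, hg, RingHom.id_apply]
  · exact (hg _).trans ((Bim.Hom.map_l f a x).trans
      ((congrArg _ (hg x).symm).trans (Bim.Hom.map_l j a (g x)).symm))
  · exact (hg _).trans ((Bim.Hom.map_r f b x).trans
      ((congrArg _ (hg x).symm).trans (Bim.Hom.map_r j b (g x)).symm))

variable {𝒜 ℬ 𝒞 : Coalgebroid.{w, u} k}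

theorem QBim.tens_lo₂ (M : QBim k 𝒜.R ℬ.R) (N : QBim k ℬ.R 𝒞.R) (p) :
    (M.tens N).lo₂ p = M.lo₂ p ▷ N.cell :=
  QBim.tens_loHom M N p

theorem QBim.tens_lt₂ (M : QBim k 𝒜.R ℬ.R) (N : QBim k ℬ.R 𝒞.R) (q) :
    (M.tens N).lt₂ q = M.cell ◁ N.lt₂ q :=
  QBim.tens_ltHom M N q

/-- The tensor product over `R₂`, as a bicoaction. -/
def tensBicoaction {M : QBim k 𝒜.R ℬ.R} {N : QBim k ℬ.R 𝒞.R}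
    (X : Bicoaction 𝒜.coring ℬ.coring M.cell) (Y : Bicoaction ℬ.coring 𝒞.coring N.cell) :
    Bicoaction 𝒜.coring 𝒞.coring (M.tens N).cell :=
  X.tens Y

theorem Compatible.tens {M : QBim k 𝒜.R ℬ.R} {N : QBim k ℬ.R 𝒞.R}
    {X : Bicoaction 𝒜.coring ℬ.coring M.cell} {Y : Bicoaction ℬ.coring 𝒞.coring N.cell}
    (hX : Compatible M X) (hY : Compatible N Y) : Compatible (M.tens N) (tensBicoaction X Y) where
  lo_l p := by
    rw [QBim.tens_lo₂]
    exact Bicoaction.tens_lo_l (hX.lo_l p)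
  lt_l q := by
    rw [QBim.tens_lt₂]
    exact Bicoaction.tens_lt_l
  takeuchi_l s := by
    rw [QBim.tens_lo₂]
    exact Bicoaction.tens_takeuchi_l (hX.takeuchi_l s)
  lo_r p := by
    rw [QBim.tens_lo₂]
    exact Bicoaction.tens_lo_r
  lt_r q := by
    rw [QBim.tens_lt₂]
    exact Bicoaction.tens_lt_r (hY.lt_r q)
  takeuchi_r s := by
    rw [QBim.tens_lt₂]
    exact Bicoaction.tens_takeuchi_r (hY.takeuchi_r s)

theorem Compatible.of_isHom {M M' : QBim k 𝒜.R ℬ.R} {X : Bicoaction 𝒜.coring ℬ.coring M.cell}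
    {X' : Bicoaction 𝒜.coring ℬ.coring M'.cell} (h : Compatible M' X') (j : M.cell ⟶ M'.cell)
    (_ : Mono (𝒜.coring.A ◁ j)) (_ : Mono (j ▷ ℬ.coring.A)) (hj : Bicoaction.IsHom X X' j)
    (hlo : ∀ p, M.lo₂ p ≫ j = j ≫ M'.lo₂ p) (hlt : ∀ q, M.lt₂ q ≫ j = j ≫ M'.lt₂ q) :
    Compatible M X where
  lo_l p := hj.lo_l (hlo p) (h.lo_l p)
  lt_l q := hj.lt_l (hlt q) (h.lt_l q)
  takeuchi_l s := hj.takeuchi_l (hlo _) (h.takeuchi_l s)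
  lo_r p := hj.lo_r (hlo p) (h.lo_r p)
  lt_r q := hj.lt_r (hlt q) (h.lt_r q)
  takeuchi_r s := hj.takeuchi_r (hlt s) (h.takeuchi_r s)

/-- For the regular bicomodule both coactions are the comultiplication, so three identities serve
twice: linearity for `lo`, linearity for `lt`, and the fact that the comultiplication takes values
in the Takeuchi product. -/
theorem Coalgebroid.compatible_regular (𝒜 : Coalgebroid.{w, u} k) :
    Compatible 𝒜.A (Bicoaction.regular 𝒜.coring) := by
  have hlo : ∀ p, 𝒜.A.lo₂ p ≫ 𝒜.coring.comul = 𝒜.coring.comul ≫ 𝒜.lo₂ p ▷ 𝒜.A.cell := fun p => by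
    have h := (𝒜.comul.comp (T2.incl _ _)).loHom_comp p
    rw [QBim.tens_loHom] at h
    exact h
  have hlt : ∀ q, 𝒜.A.lt₂ q ≫ 𝒜.coring.comul = 𝒜.coring.comul ≫ 𝒜.coring.A ◁ 𝒜.lt₂ q :=
    fun q => by
      have h := (𝒜.comul.comp (T2.incl _ _)).ltHom_comp q
      rw [QBim.tens_ltHom] at h
      exact h
  have htak : ∀ s, 𝒜.coring.comul ≫ 𝒜.lt₂ s ▷ 𝒜.coring.A =
      𝒜.coring.comul ≫ 𝒜.coring.A ◁ 𝒜.lo₂ (op s) :=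
    fun s => Bim.hom_ext fun x => mem_takeuchi.1 (𝒜.comul.lin x).2 s
  exact ⟨hlo, hlt, htak, hlo, hlt, htak⟩

variable (M : Comodule 𝒜 ℬ) (N : Comodule ℬ 𝒞)

theorem mem_bullet {t : (M.M.tens N.M).carrier} : t ∈ bullet M N ↔
    (∀ s, Bim.Hom.lin (M.M.lt₂ s ▷ N.M.cell) t = Bim.Hom.lin (M.M.cell ◁ N.M.lo₂ (op s)) t) ∧
      Bim.Hom.lin (M.bicoaction.r ▷ N.M.cell ≫ (α_ M.M.cell ℬ.coring.A N.M.cell).hom) t =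
        Bim.Hom.lin (M.M.cell ◁ N.bicoaction.l) t := by
  rw [M.bicoaction_r, N.bicoaction_l]
  exact and_congr mem_takeuchi Iff.rfl

theorem eqLocus_stable {a b : AlgObj.{w, u} k} {X Y : a ⟶ b} {f g : X ⟶ Y} {u : X ⟶ X} {v : Y ⟶ Y}
    (hf : u ≫ f = f ≫ v) (hg : u ≫ g = g ≫ v) {t} (h : Bim.Hom.lin f t = Bim.Hom.lin g t) :
    Bim.Hom.lin f (Bim.Hom.lin u t) = Bim.Hom.lin g (Bim.Hom.lin u t) :=
  (lin_congr hf t).trans ((congrArg (Bim.Hom.lin v) h).trans (lin_congr hg t).symm)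

/-- For the equalizer condition, `lo` acts on `M` and must commute with its right coaction, while
`lt` acts on `N` and must commute with its left coaction; both facts are part of compatibility. -/
theorem bullet_stable : (M.M.tens N.M).Stable (bullet M N) where
  l a x hx := ⟨(takeuchi_stable _ _).l a x hx.1,
    (Bim.Hom.map_l _ a x).trans ((congrArg _ hx.2).trans (Bim.Hom.map_l _ a x).symm)⟩
  r b x hx := ⟨(takeuchi_stable _ _).r b x hx.1,
    (Bim.Hom.map_r _ b x).trans ((congrArg _ hx.2).trans (Bim.Hom.map_r _ b x).symm)⟩
  lo p x hx := (mem_bullet M N).2 ⟨fun s => mem_takeuchi.1 ((takeuchi_stable _ _).lo p x hx.1) s, by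
    have e : (M.M.tens N.M).lo p x = Bim.Hom.lin (M.M.lo₂ p ▷ N.M.cell) x :=
      lin_congr (QBim.tens_lo₂ M.M N.M p) x
    rw [e]
    exact eqLocus_stable (Bicoaction.lo_equalizer_left (M.compatible.lo_r p))
      (whisker_exchange _ _).symm ((mem_bullet M N).1 hx).2⟩
  lt q x hx := (mem_bullet M N).2 ⟨fun s => mem_takeuchi.1 ((takeuchi_stable _ _).lt q x hx.1) s, by
    have e : (M.M.tens N.M).lt q x = Bim.Hom.lin (M.M.cell ◁ N.M.lt₂ q) x :=
      lin_congr (QBim.tens_lt₂ M.M N.M q) x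
    rw [e]
    exact eqLocus_stable (Bicoaction.lt_equalizer_left)
      (Bicoaction.lt_equalizer_right (N.compatible.lt_l q)) ((mem_bullet M N).1 hx).2⟩

/-- The bimodule `M • N`. -/
def bulletQ : QBim k 𝒜.R 𝒞.R := (M.M.tens N.M).sub (bullet M N) (bullet_stable M N)

/-- The inclusion of `M • N` into `M ⊗ N`. -/
def bulletIncl : (bulletQ M N).Hom (M.M.tens N.M) :=
  (M.M.tens N.M).incl (bullet M N) (bullet_stable M N)

/-- The inclusion of `M • N` into `M ⊗ N`, as a 2-cell. -/
def bulletι : (bulletQ M N).cell ⟶ M.M.cell ≫ N.M.cell := (bulletIncl M N).toBimHom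

theorem bulletι_injective : Function.Injective (Bim.Hom.lin (bulletι M N)) :=
  Subtype.val_injective

theorem bulletι_takeuchi (s) :
    bulletι M N ≫ M.M.lt₂ s ▷ N.M.cell = bulletι M N ≫ M.M.cell ◁ N.M.lo₂ (op s) :=
  Bim.hom_ext fun x => ((mem_bullet M N).1 x.2).1 s

theorem bulletι_equalizes :
    bulletι M N ≫ M.bicoaction.r ▷ N.M.cell ≫ (α_ M.M.cell ℬ.coring.A N.M.cell).hom =
      bulletι M N ≫ M.M.cell ◁ N.bicoaction.l :=
  Bim.hom_ext fun x => ((mem_bullet M N).1 x.2).2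

theorem bullet_lift {Z : 𝒜.base ⟶ 𝒞.base} (f : Z ⟶ M.M.cell ≫ N.M.cell)
    (ht : ∀ s, f ≫ M.M.lt₂ s ▷ N.M.cell = f ≫ M.M.cell ◁ N.M.lo₂ (op s))
    (he : f ≫ M.bicoaction.r ▷ N.M.cell ≫ (α_ M.M.cell ℬ.coring.A N.M.cell).hom =
      f ≫ M.M.cell ◁ N.bicoaction.l) : ∃ g : Z ⟶ (bulletQ M N).cell, g ≫ bulletι M N = f :=
  exists_factor _ (bulletι_injective M N) f fun z =>
    ⟨⟨Bim.Hom.lin f z, (mem_bullet M N).2 ⟨fun s => lin_congr (ht s) z, lin_congr he z⟩⟩, rfl⟩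

end

/-! ### Tensoring a composite, and its coactions -/

section

variable {k : Type w} [CommRing k]

theorem mono_whiskerLeft {a b c : AlgObj.{w, u} k} {W : a ⟶ b} (hW : Bim.RightProj W)
    {X Y : b ⟶ c} (j : X ⟶ Y) (hj : Function.Injective (Bim.Hom.lin j)) : Mono (W ◁ j) :=
  mono_of_injective _ (Bim.tens_id_injective hW j hj)

theorem mono_whiskerRight {a b c : AlgObj.{w, u} k} {W : b ⟶ c} (hW : Bim.LeftProj W)
    {X Y : a ⟶ b} (j : X ⟶ Y) (hj : Function.Injective (Bim.Hom.lin j)) : Mono (j ▷ W) :=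
  mono_of_injective _ (Bim.id_tens_injective hW j hj)

section Lift

variable {𝒜 ℬ 𝒞 : Coalgebroid.{w, u} k} (M : Comodule 𝒜 ℬ) (N : Comodule ℬ 𝒞)

/-- This realizes `W ⊗ (M • N)` as the subobject of `W ⊗ M ⊗ N` given by the tensored equations.
Tensoring must preserve a whole family of equations at once, which is why the targets `M ⊗ N` and `M
⊗ A ⊗ N` are required to be locally projective. -/
theorem bullet_liftLeft {d : AlgObj.{w, u} k} {W : d ⟶ 𝒜.base} (hW : Bim.RightProj W)
    (h₂ : Bim.LeftProj (M.M.cell ≫ N.M.cell))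
    (h₃ : Bim.LeftProj (M.M.cell ≫ ℬ.coring.A ≫ N.M.cell)) {Z : d ⟶ 𝒞.base}
    (f : Z ⟶ W ≫ M.M.cell ≫ N.M.cell)
    (ht : ∀ s, f ≫ W ◁ M.M.lt₂ s ▷ N.M.cell = f ≫ W ◁ M.M.cell ◁ N.M.lo₂ (op s))
    (he : f ≫ W ◁ (M.bicoaction.r ▷ N.M.cell ≫ (α_ M.M.cell ℬ.coring.A N.M.cell).hom) =
      f ≫ W ◁ M.M.cell ◁ N.bicoaction.l) :
    ∃ g : Z ⟶ W ≫ (bulletQ M N).cell, g ≫ W ◁ bulletι M N = f := by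
  refine exists_factor _ (Bim.tens_id_injective hW _ (bulletι_injective M N)) f fun z => ?_
  -- `none` indexes the cotensor equation and `some s` the Takeuchi equation for `s`, so both kinds
  -- form one joint equalizer.
  refine Bim.exists_of_tens_id_eq (X := W) hW (bulletι M N) (I := Option ℬ.R)
    (Z := fun i => i.elim (M.M.cell ≫ ℬ.coring.A ≫ N.M.cell) fun _ => M.M.cell ≫ N.M.cell)
    (Option.rec h₃ fun _ => h₂)
    (Option.rec (M.bicoaction.r ▷ N.M.cell ≫ (α_ M.M.cell ℬ.coring.A N.M.cell).hom)
      fun s => M.M.lt₂ s ▷ N.M.cell)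
    (Option.rec (M.M.cell ◁ N.bicoaction.l) fun s => M.M.cell ◁ N.M.lo₂ (op s))
    (fun y hy => ⟨⟨y, (mem_bullet M N).2 ⟨fun s => hy (some s), hy none⟩⟩, rfl⟩) _ ?_
  rintro (_ | s)
  · exact lin_congr he z
  · exact lin_congr (ht s) z

theorem bullet_liftRight {d : AlgObj.{w, u} k} {W : 𝒞.base ⟶ d} (hW : Bim.LeftProj W)
    (h₂ : Bim.RightProj (M.M.cell ≫ N.M.cell))
    (h₃ : Bim.RightProj (M.M.cell ≫ ℬ.coring.A ≫ N.M.cell)) {Z : 𝒜.base ⟶ d}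
    (f : Z ⟶ (M.M.cell ≫ N.M.cell) ≫ W)
    (ht : ∀ s, f ≫ (M.M.lt₂ s ▷ N.M.cell) ▷ W = f ≫ (M.M.cell ◁ N.M.lo₂ (op s)) ▷ W)
    (he : f ≫ (M.bicoaction.r ▷ N.M.cell ≫ (α_ M.M.cell ℬ.coring.A N.M.cell).hom) ▷ W =
      f ≫ (M.M.cell ◁ N.bicoaction.l) ▷ W) :
    ∃ g : Z ⟶ (bulletQ M N).cell ≫ W, g ≫ bulletι M N ▷ W = f := by
  refine exists_factor _ (Bim.id_tens_injective hW _ (bulletι_injective M N)) f fun z => ?_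
  -- The same indexing of the equations by `Option` as on the other side.
  refine Bim.exists_of_id_tens_eq (Y := W) hW (bulletι M N) (I := Option ℬ.R)
    (Z := fun i => i.elim (M.M.cell ≫ ℬ.coring.A ≫ N.M.cell) fun _ => M.M.cell ≫ N.M.cell)
    (Option.rec h₃ fun _ => h₂)
    (Option.rec (M.bicoaction.r ▷ N.M.cell ≫ (α_ M.M.cell ℬ.coring.A N.M.cell).hom)
      fun s => M.M.lt₂ s ▷ N.M.cell)
    (Option.rec (M.M.cell ◁ N.bicoaction.l) fun s => M.M.cell ◁ N.M.lo₂ (op s))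
    (fun y hy => ⟨⟨y, (mem_bullet M N).2 ⟨fun s => hy (some s), hy none⟩⟩, rfl⟩) _ ?_
  rintro (_ | s)
  · exact lin_congr he z
  · exact lin_congr (ht s) z

end Lift

variable {𝒜 ℬ 𝒞 𝒟 : HCoalgebroid.{w, u} k}

/-- The 1-cell of bimodules underlying a comodule. -/
def HComodule.cell (M : HComodule 𝒜 ℬ) : 𝒜.base ⟶ ℬ.base := M.M.cell

/-- The coactions of a comodule. -/
def HComodule.bic (M : HComodule 𝒜 ℬ) : Bicoaction 𝒜.coring ℬ.coring M.cell :=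
  M.toComodule.bicoaction

variable (M : HComodule 𝒜 ℬ) (N : HComodule ℬ 𝒞)

theorem HComodule.union_tens : Bim.UnionOfProjectives (M.cell ≫ N.cell) :=
  Bim.UnionOfProjectives.tens 𝒜.hereditary 𝒞.hereditary M.union N.union

theorem HComodule.union_tens₃ : Bim.UnionOfProjectives (M.cell ≫ ℬ.coring.A ≫ N.cell) :=
  Bim.UnionOfProjectives.tens 𝒜.hereditary 𝒞.hereditary M.union
    (Bim.UnionOfProjectives.tens ℬ.hereditary 𝒞.hereditary ℬ.union N.union)

/-- The inclusion of `M • N` into `M ⊗ N`. -/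
def HComodule.inclBullet : (bulletQ M.toComodule N.toComodule).cell ⟶ M.cell ≫ N.cell :=
  bulletι M.toComodule N.toComodule

theorem HComodule.inclBullet_injective : Function.Injective (Bim.Hom.lin (M.inclBullet N)) :=
  bulletι_injective _ _

/-- The left coaction of `M` respects all the defining equations, so it restricts to `M • N` once
these equations are known to cut out `A ⊗ (M • N)`. -/
theorem HComodule.exists_left :
    ∃ g, g ≫ 𝒜.coring.A ◁ M.inclBullet N = M.inclBullet N ≫ (M.bic.tens N.bic).l :=
  bullet_liftLeft M.toComodule N.toComodule 𝒜.union.rightProj (M.union_tens N).leftProj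
    (M.union_tens₃ N).leftProj (M.inclBullet N ≫ (M.bic.tens N.bic).l)
    (fun s => Bicoaction.tens_l_takeuchi (M.compatible.lt_l s) (bulletι_takeuchi _ _ s))
    (Bicoaction.tens_l_equalizes (bulletι_equalizes _ _))

theorem HComodule.exists_right :
    ∃ g, g ≫ M.inclBullet N ▷ 𝒞.coring.A = M.inclBullet N ≫ (M.bic.tens N.bic).r :=
  bullet_liftRight M.toComodule N.toComodule 𝒞.union.leftProj (M.union_tens N).rightProj
    (M.union_tens₃ N).rightProj (M.inclBullet N ≫ (M.bic.tens N.bic).r)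
    (fun s => Bicoaction.tens_r_takeuchi (N.compatible.lo_r _) (bulletι_takeuchi _ _ s))
    (Bicoaction.tens_r_equalizes (bulletι_equalizes _ _))

instance : Mono (M.inclBullet N) := mono_of_injective _ (M.inclBullet_injective N)

theorem HComodule.mono_whiskerLeft {d : AlgObj.{w, u} k} (W : d ⟶ 𝒜.base)
    (hW : Bim.UnionOfProjectives W) : Mono (W ◁ M.inclBullet N) :=
  Coalgebroids.mono_whiskerLeft hW.rightProj _ (M.inclBullet_injective N)

theorem HComodule.mono_whiskerRight {d : AlgObj.{w, u} k} (W : 𝒞.base ⟶ d)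
    (hW : Bim.UnionOfProjectives W) : Mono (M.inclBullet N ▷ W) :=
  Coalgebroids.mono_whiskerRight hW.leftProj _ (M.inclBullet_injective N)

/-- Two applications of flatness; these instances are what `Bicoaction.sub` needs in order to
transfer coassociativity and commutation. -/
instance : Mono (𝒜.coring.A ◁ 𝒜.coring.A ◁ M.inclBullet N) :=
  Coalgebroids.mono_whiskerLeft 𝒜.union.rightProj _
    (Bim.tens_id_injective 𝒜.union.rightProj _ (M.inclBullet_injective N))
instance : Mono (M.inclBullet N ▷ (𝒞.coring.A ≫ 𝒞.coring.A)) :=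
  M.mono_whiskerRight N _ (Bim.UnionOfProjectives.tens 𝒞.hereditary 𝒞.hereditary 𝒞.union 𝒞.union)
instance : Mono (𝒜.coring.A ◁ (M.inclBullet N ▷ 𝒞.coring.A)) :=
  Coalgebroids.mono_whiskerLeft 𝒜.union.rightProj _
    (Bim.id_tens_injective 𝒞.union.leftProj _ (M.inclBullet_injective N))

/-- The coactions of `M • N`. -/
noncomputable def HComodule.bulletBicoaction :
    Bicoaction 𝒜.coring 𝒞.coring (bulletQ M.toComodule N.toComodule).cell :=
  (M.bic.tens N.bic).sub (M.inclBullet N) (M.exists_left N).choose (M.exists_left N).choose_spec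
    (M.exists_right N).choose (M.exists_right N).choose_spec

theorem HComodule.isHom_bulletBicoaction :
    Bicoaction.IsHom (M.bulletBicoaction N) (M.bic.tens N.bic) (M.inclBullet N) where
  l := (M.exists_left N).choose_spec
  r := (M.exists_right N).choose_spec

theorem HComodule.compatible_bulletBicoaction :
    Compatible (bulletQ M.toComodule N.toComodule) (M.bulletBicoaction N) := by
  exact Compatible.of_isHom (M := bulletQ M.toComodule N.toComodule) (M' := M.M.tens N.M)
    (X' := tensBicoaction M.bic N.bic)
    (M.compatible.tens N.compatible) (bulletι M.toComodule N.toComodule)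
    (M.mono_whiskerLeft N _ 𝒜.union) (M.mono_whiskerRight N _ 𝒞.union)
    (M.isHom_bulletBicoaction N) (fun p => (bulletIncl _ _).loHom_comp p)
    (fun q => (bulletIncl _ _).ltHom_comp q)

/-- The composite `M • N`. -/
noncomputable def HComodule.comp : HComodule 𝒜 𝒞 where
  toComodule := (M.bulletBicoaction N).toComodule (M.compatible_bulletBicoaction N)
  union := (M.union_tens N).of_injective 𝒜.hereditary 𝒞.hereditary (M.inclBullet N)
    (M.inclBullet_injective N)

/-- The unit comodule. -/
def HCoalgebroid.unit (𝒜 : HCoalgebroid.{w, u} k) : HComodule 𝒜 𝒜 where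
  toComodule := (Bicoaction.regular 𝒜.coring).toComodule 𝒜.compatible_regular
  union := 𝒜.union

end

/-! ### Bicategories of 1-cells with a composition that embeds into the given one -/

section

universe w₂ v₂ u₂ w₁ v₁ u₁

/-- Categories with functors `U` to the hom-categories of a bicategory, a composition that embeds
into the composition of the bicategory by `ι`, and units with a 2-cell `e` to the identities. -/
structure SubComposition {B : Type u₁} [Bicategory.{w₁, v₁} B] {O : Type u₂} (F : O → B)
    (H : O → O → Type v₂) [∀ x y, Category.{w₂} (H x y)] where
  U {x y : O} : H x y ⥤ (F x ⟶ F y)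
  faithful {x y : O} : (U (x := x) (y := y)).Faithful
  comp {x y z : O} : H x y → H y z → H x z
  one (x : O) : H x x
  ι {x y z : O} (M : H x y) (N : H y z) : U.obj (comp M N) ⟶ U.obj M ≫ U.obj N
  e (x : O) : U.obj (one x) ⟶ 𝟙 (F x)
  mono₁ {x y z : O} (M : H x y) (N : H y z) : Mono (ι M N)
  mono₂ {x y z t : O} (M : H x y) (N : H y z) (P : H z t) : Mono (U.obj M ◁ ι N P)
  mono₃ {x y z t s : O} (M : H x y) (N : H y z) (P : H z t) (Q : H t s) :
    Mono (U.obj M ◁ U.obj N ◁ ι P Q)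
  wl {x y z : O} (M : H x y) {N N' : H y z} (g : N ⟶ N') : comp M N ⟶ comp M N'
  wl_ι {x y z : O} (M : H x y) {N N' : H y z} (g : N ⟶ N') :
    U.map (wl M g) ≫ ι M N' = ι M N ≫ U.obj M ◁ U.map g
  wr {x y z : O} {M M' : H x y} (f : M ⟶ M') (N : H y z) : comp M N ⟶ comp M' N
  wr_ι {x y z : O} {M M' : H x y} (f : M ⟶ M') (N : H y z) :
    U.map (wr f N) ≫ ι M' N = ι M N ≫ U.map f ▷ U.obj N
  assoc {x y z t : O} (M : H x y) (N : H y z) (P : H z t) :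
    comp (comp M N) P ≅ comp M (comp N P)
  assoc_ι {x y z t : O} (M : H x y) (N : H y z) (P : H z t) :
    U.map (assoc M N P).hom ≫ ι M (comp N P) ≫ U.obj M ◁ ι N P =
      ι (comp M N) P ≫ ι M N ▷ U.obj P ≫ (α_ _ _ _).hom
  lu {x y : O} (M : H x y) : comp (one x) M ≅ M
  lu_ι {x y : O} (M : H x y) : U.map (lu M).hom = ι (one x) M ≫ e x ▷ U.obj M ≫ (λ_ _).hom
  ru {x y : O} (M : H x y) : comp M (one y) ≅ M
  ru_ι {x y : O} (M : H x y) : U.map (ru M).hom = ι M (one y) ≫ U.obj M ◁ e y ≫ (ρ_ _).hom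

namespace SubComposition

attribute [instance] faithful mono₁ mono₂ mono₃

variable {B : Type u₁} [Bicategory.{w₁, v₁} B] {O : Type u₂} {F : O → B}
  {H : O → O → Type v₂} [∀ x y, Category.{w₂} (H x y)] (s : SubComposition F H) {x y z t r : O}

/-- Faithfulness of `U` and monicity of `ι` reduce equality of 2-cells into a composite to equality
in the ambient bicategory. The next two lemmas iterate this for nested composites. -/
theorem hom_ext₁ {L : H x z} {M : H x y} {N : H y z} {f g : L ⟶ s.comp M N}
    (h : s.U.map f ≫ s.ι M N = s.U.map g ≫ s.ι M N) : f = g :=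
  s.U.map_injective ((cancel_mono _).1 h)

theorem hom_ext₂ {L : H x t} {M : H x y} {N : H y z} {P : H z t}
    {f g : L ⟶ s.comp M (s.comp N P)}
    (h : s.U.map f ≫ s.ι M (s.comp N P) ≫ s.U.obj M ◁ s.ι N P =
      s.U.map g ≫ s.ι M (s.comp N P) ≫ s.U.obj M ◁ s.ι N P) : f = g :=
  s.hom_ext₁ ((cancel_mono (s.U.obj M ◁ s.ι N P)).1 (by simpa only [Category.assoc] using h))

theorem hom_ext₃ {L : H x r} {M : H x y} {N : H y z} {P : H z t} {Q : H t r}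
    {f g : L ⟶ s.comp M (s.comp N (s.comp P Q))}
    (h : s.U.map f ≫ s.ι M _ ≫ s.U.obj M ◁ s.ι N _ ≫ s.U.obj M ◁ s.U.obj N ◁ s.ι P Q =
      s.U.map g ≫ s.ι M _ ≫ s.U.obj M ◁ s.ι N _ ≫ s.U.obj M ◁ s.U.obj N ◁ s.ι P Q) : f = g :=
  s.hom_ext₂ ((cancel_mono (s.U.obj M ◁ s.U.obj N ◁ s.ι P Q)).1
    (by simpa only [Category.assoc] using h))

theorem wl_id (M : H x y) (N : H y z) : s.wl M (𝟙 N) = 𝟙 (s.comp M N) := by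
  apply s.hom_ext₁
  rw [s.wl_ι, CategoryTheory.Functor.map_id, CategoryTheory.Functor.map_id, whiskerLeft_id,
    Category.comp_id, Category.id_comp]

theorem wl_comp (M : H x y) {N N' N'' : H y z} (f : N ⟶ N') (g : N' ⟶ N'') :
    s.wl M (f ≫ g) = s.wl M f ≫ s.wl M g := by
  apply s.hom_ext₁
  rw [s.wl_ι, Functor.map_comp, Functor.map_comp, Category.assoc, s.wl_ι, reassoc_of% s.wl_ι,
    whiskerLeft_comp]

theorem wr_id (M : H x y) (N : H y z) : s.wr (𝟙 M) N = 𝟙 (s.comp M N) := by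
  apply s.hom_ext₁
  rw [s.wr_ι, CategoryTheory.Functor.map_id, CategoryTheory.Functor.map_id, id_whiskerRight,
    Category.comp_id, Category.id_comp]

theorem wr_comp {M M' M'' : H x y} (f : M ⟶ M') (g : M' ⟶ M'') (N : H y z) :
    s.wr (f ≫ g) N = s.wr f N ≫ s.wr g N := by
  apply s.hom_ext₁
  rw [s.wr_ι, Functor.map_comp, Functor.map_comp, Category.assoc, s.wr_ι, reassoc_of% s.wr_ι,
    comp_whiskerRight]

theorem wl_lu {M N : H x y} (f : M ⟶ N) : s.wl (s.one x) f ≫ (s.lu N).hom = (s.lu M).hom ≫ f := by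
  apply s.U.map_injective
  rw [Functor.map_comp, Functor.map_comp, s.lu_ι, s.lu_ι, reassoc_of% s.wl_ι, whisker_exchange_assoc]
  simp

theorem wr_ru {M N : H x y} (f : M ⟶ N) : s.wr f (s.one y) ≫ (s.ru N).hom = (s.ru M).hom ≫ f := by
  apply s.U.map_injective
  rw [Functor.map_comp, Functor.map_comp, s.ru_ι, s.ru_ι, reassoc_of% s.wr_ι,
    ← whisker_exchange_assoc]
  simp

/-- All naturality laws of the associator follow one pattern: embed into the triple tensor product,
slide the embeddings outward, and use naturality there. -/
theorem wl_assoc (M : H x y) (N : H y z) {P P' : H z t} (f : P ⟶ P') :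
    s.wl (s.comp M N) f ≫ (s.assoc M N P').hom = (s.assoc M N P).hom ≫ s.wl M (s.wl N f) := by
  apply s.hom_ext₂
  simp only [Functor.map_comp, Category.assoc]
  rw [s.assoc_ι, reassoc_of% s.wl_ι, whisker_exchange_assoc, reassoc_of% s.wl_ι,
    ← whiskerLeft_comp, s.wl_ι, whiskerLeft_comp, reassoc_of% s.assoc_ι]
  simp

theorem wr_assoc {M M' : H x y} (f : M ⟶ M') (N : H y z) (P : H z t) :
    s.wr (s.wr f N) P ≫ (s.assoc M' N P).hom = (s.assoc M N P).hom ≫ s.wr f (s.comp N P) := by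
  apply s.hom_ext₂
  simp only [Functor.map_comp, Category.assoc]
  rw [s.assoc_ι, reassoc_of% s.wr_ι, ← comp_whiskerRight_assoc, s.wr_ι, reassoc_of% s.wr_ι,
    ← whisker_exchange, reassoc_of% s.assoc_ι]
  simp

theorem wl_wr_assoc (M : H x y) {N N' : H y z} (f : N ⟶ N') (P : H z t) :
    s.wr (s.wl M f) P ≫ (s.assoc M N' P).hom = (s.assoc M N P).hom ≫ s.wl M (s.wr f P) := by
  apply s.hom_ext₂
  simp only [Functor.map_comp, Category.assoc]
  rw [s.assoc_ι, reassoc_of% s.wr_ι, ← comp_whiskerRight_assoc, s.wl_ι, reassoc_of% s.wl_ι,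
    ← whiskerLeft_comp, s.wr_ι, whiskerLeft_comp, reassoc_of% s.assoc_ι]
  simp

theorem exchange {M M' : H x y} {N N' : H y z} (f : M ⟶ M') (g : N ⟶ N') :
    s.wl M g ≫ s.wr f N' = s.wr f N ≫ s.wl M' g := by
  apply s.hom_ext₁
  simp only [Functor.map_comp, Category.assoc]
  rw [s.wr_ι, s.wl_ι, reassoc_of% s.wr_ι, reassoc_of% s.wl_ι, whisker_exchange]

/-- After embedding into the fourfold tensor product, each structural associator becomes the ambient
one by `assoc_ι`, and the ambient pentagon remains. -/
theorem pentagon (M : H x y) (N : H y z) (P : H z t) (Q : H t r) :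
    s.wr (s.assoc M N P).hom Q ≫ (s.assoc M (s.comp N P) Q).hom ≫ s.wl M (s.assoc N P Q).hom =
      (s.assoc (s.comp M N) P Q).hom ≫ (s.assoc M N (s.comp P Q)).hom := by
  apply s.hom_ext₃
  have e1 : s.U.obj M ◁ s.ι N (s.comp P Q) ≫ s.U.obj M ◁ s.U.obj N ◁ s.ι P Q =
    s.U.obj M ◁ (s.ι N (s.comp P Q) ≫ s.U.obj N ◁ s.ι P Q) := (whiskerLeft_comp _ _ _).symm
  simp only [Functor.map_comp, Category.assoc]
  calc _ = s.U.map (s.wr (s.assoc M N P).hom Q) ≫ s.U.map (s.assoc M (s.comp N P) Q).hom ≫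
        s.ι _ _ ≫ s.U.obj M ◁ (s.U.map (s.assoc N P Q).hom ≫
          (s.ι N (s.comp P Q) ≫ s.U.obj N ◁ s.ι P Q)) := by
        rw [e1, reassoc_of% s.wl_ι, ← whiskerLeft_comp]
    _ = s.U.map (s.wr (s.assoc M N P).hom Q) ≫ (s.U.map (s.assoc M (s.comp N P) Q).hom ≫
        s.ι _ _ ≫ s.U.obj M ◁ s.ι (s.comp N P) Q) ≫ s.U.obj M ◁ (s.ι N P ▷ s.U.obj Q ≫
          (α_ _ _ _).hom) := by
        rw [s.assoc_ι]
        simp only [whiskerLeft_comp, Category.assoc]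
    _ = s.ι _ _ ≫ (s.U.map (s.assoc M N P).hom ≫ s.ι M (s.comp N P) ≫ s.U.obj M ◁ s.ι N P) ▷
          s.U.obj Q ≫ (α_ _ _ _).hom ≫ s.U.obj M ◁ (α_ _ _ _).hom := by
        rw [s.assoc_ι, Category.assoc, reassoc_of% s.wr_ι]
        bicategory
    _ = s.ι (s.comp (s.comp M N) P) Q ≫ s.ι (s.comp M N) P ▷ s.U.obj Q ≫
          (s.ι M N ▷ s.U.obj P) ▷ s.U.obj Q ≫ (α_ _ _ _).hom ≫ (α_ _ _ _).hom := by
        rw [s.assoc_ι]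
        bicategory
    _ = (s.ι (s.comp (s.comp M N) P) Q ≫ s.ι (s.comp M N) P ▷ s.U.obj Q ≫ (α_ _ _ _).hom) ≫
          s.ι M N ▷ (s.U.obj P ≫ s.U.obj Q) ≫ (α_ _ _ _).hom := by bicategory
    _ = s.U.map (s.assoc (s.comp M N) P Q).hom ≫ (s.ι (s.comp M N) (s.comp P Q) ≫
          s.ι M N ▷ s.U.obj (s.comp P Q) ≫ (α_ _ _ _).hom) ≫ s.U.obj M ◁ s.U.obj N ◁ s.ι P Q := by
        rw [← s.assoc_ι, Category.assoc, Category.assoc, whisker_exchange_assoc]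
        bicategory
    _ = _ := by
        rw [← s.assoc_ι]
        simp only [Category.assoc]

theorem triangle (M : H x y) (N : H y z) :
    (s.assoc M (s.one y) N).hom ≫ s.wl M (s.lu N).hom = s.wr (s.ru M).hom N := by
  apply s.hom_ext₁
  rw [Functor.map_comp, Category.assoc, s.wl_ι, s.wr_ι, s.lu_ι, s.ru_ι]
  calc _ = (s.U.map (s.assoc M (s.one y) N).hom ≫ s.ι _ _ ≫ s.U.obj M ◁ s.ι (s.one y) N) ≫
        s.U.obj M ◁ (s.e y ▷ s.U.obj N ≫ (λ_ _).hom) := by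
        simp only [whiskerLeft_comp, Category.assoc]
    _ = _ := by
        rw [s.assoc_ι]
        bicategory

/-- The bicategory with the given composition. -/
@[reducible]
def bicategory : Bicategory.{w₂, v₂} O where
  Hom := H
  id := s.one
  comp := s.comp
  whiskerLeft M _ _ g := s.wl M g
  whiskerRight f N := s.wr f N
  associator := s.assoc
  leftUnitor := s.lu
  rightUnitor := s.ru
  whiskerLeft_id := s.wl_id
  whiskerLeft_comp M _ _ _ f g := s.wl_comp M f g
  id_whiskerLeft f := eq_conj_of_comp_eq (s.wl_lu f)
  comp_whiskerLeft M N _ _ f := eq_conj_of_comp_eq (s.wl_assoc M N f)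
  id_whiskerRight := s.wr_id
  comp_whiskerRight := s.wr_comp
  whiskerRight_id f := eq_conj_of_comp_eq (s.wr_ru f)
  whiskerRight_comp f N P := by
    rw [s.wr_assoc, Iso.inv_hom_id_assoc]
  whisker_assoc M _ _ f P := eq_conj_of_comp_eq (s.wl_wr_assoc M f P)
  whisker_exchange := s.exchange
  pentagon := s.pentagon
  triangle := s.triangle

end SubComposition

end

/-! ### Iterated cotensor products -/

section

universe w₁ v₁ u₁

variable {B : Type u₁} [Bicategory.{w₁, v₁} B] {a b c d : B} {C : Coring a} {D : Coring b}
  {E : Coring c} {F : Coring d} {M : a ⟶ b} {N : b ⟶ c} {P : c ⟶ d} {Q : a ⟶ d}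

namespace Bicoaction

variable {X : Bicoaction C D M} {Y : Bicoaction D E N} {Z : Bicoaction E F P}

/-! ### Equations satisfied by `(M • N) • P` inside `M ⊗ (N ⊗ P)` -/

section Left

variable {K : a ⟶ c} {XY : Bicoaction C E K} {i : K ⟶ M ≫ N} {i' : Q ⟶ K ≫ P}

theorem assoc_takeuchi_inner {u : K ⟶ K} {u' : N ⟶ N} {v : P ⟶ P} (hu : u ≫ i = i ≫ M ◁ u')
    (h : i' ≫ u ▷ P = i' ≫ K ◁ v) :
    (i' ≫ i ▷ P ≫ (α_ M N P).hom) ≫ M ◁ u' ▷ P =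
      (i' ≫ i ▷ P ≫ (α_ M N P).hom) ≫ M ◁ N ◁ v := by
  calc _ = i' ≫ (i ≫ M ◁ u') ▷ P ≫ (α_ M N P).hom := by bicategory
    _ = (i' ≫ u ▷ P) ≫ i ▷ P ≫ (α_ M N P).hom := by
        rw [← hu]
        bicategory
    _ = _ := by
        rw [h, Category.assoc, whisker_exchange_assoc]
        bicategory

/-- The right coaction of `K = M • N` is induced by that of `N`, so the cotensor equation between
`K` and `P` is one between `N` and `P`. -/
theorem assoc_equalizes_inner (hi : XY.r ≫ i ▷ E.A = i ≫ (X.tens Y).r)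
    (h : i' ≫ XY.r ▷ P ≫ (α_ K E.A P).hom = i' ≫ K ◁ Z.l) :
    (i' ≫ i ▷ P ≫ (α_ M N P).hom) ≫ M ◁ (Y.r ▷ P ≫ (α_ N E.A P).hom) =
      (i' ≫ i ▷ P ≫ (α_ M N P).hom) ≫ M ◁ N ◁ Z.l := by
  rw [tens_r] at hi
  calc _ = i' ≫ (i ≫ M ◁ Y.r ≫ (α_ M N E.A).inv) ▷ P ≫ (α_ _ _ _).hom ≫ (α_ _ _ _).hom := by
        bicategory
    _ = (i' ≫ XY.r ▷ P ≫ (α_ K E.A P).hom) ≫ i ▷ (E.A ≫ P) ≫ (α_ _ _ _).hom := by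
        rw [← hi]
        bicategory
    _ = _ := by
        rw [h, Category.assoc, whisker_exchange_assoc]
        bicategory

theorem assoc_takeuchi_outer {u : M ⟶ M} {v : N ⟶ N} (h : i ≫ u ▷ N = i ≫ M ◁ v) :
    (i' ≫ i ▷ P ≫ (α_ M N P).hom) ≫ u ▷ (N ≫ P) =
      (i' ≫ i ▷ P ≫ (α_ M N P).hom) ≫ M ◁ v ▷ P := by
  calc _ = i' ≫ (i ≫ u ▷ N) ▷ P ≫ (α_ M N P).hom := by bicategory
    _ = _ := by
        rw [h]
        bicategory

/-- The equation between `M` and `N` holds already for `K`; tensoring with `P` only adds an idle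
factor. -/
theorem assoc_equalizes_outer (h : i ≫ X.r ▷ N ≫ (α_ M D.A N).hom = i ≫ M ◁ Y.l) :
    (i' ≫ i ▷ P ≫ (α_ M N P).hom) ≫ X.r ▷ (N ≫ P) ≫ (α_ M D.A (N ≫ P)).hom =
      (i' ≫ i ▷ P ≫ (α_ M N P).hom) ≫ M ◁ (Y.tens Z).l := by
  rw [tens_l]
  calc _ = i' ≫ (i ≫ X.r ▷ N ≫ (α_ M D.A N).hom) ▷ P ≫ (α_ _ _ _).hom ≫ M ◁ (α_ _ _ _).hom := by
        bicategory
    _ = _ := by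
        rw [h]
        bicategory

end Left

/-! ### Equations satisfied by `M • (N • P)` inside `(M ⊗ N) ⊗ P` -/

section Right

variable {K : b ⟶ d} {YZ : Bicoaction D F K} {i : K ⟶ N ≫ P} {i' : Q ⟶ M ≫ K}

theorem assoc_inv_takeuchi_inner {u : M ⟶ M} {v : K ⟶ K} {v' : N ⟶ N}
    (hv : v ≫ i = i ≫ v' ▷ P) (h : i' ≫ u ▷ K = i' ≫ M ◁ v) :
    (i' ≫ M ◁ i ≫ (α_ M N P).inv) ≫ (u ▷ N) ▷ P =
      (i' ≫ M ◁ i ≫ (α_ M N P).inv) ≫ (M ◁ v') ▷ P := by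
  calc _ = i' ≫ (M ◁ i ≫ u ▷ (N ≫ P)) ≫ (α_ M N P).inv := by bicategory
    _ = (i' ≫ u ▷ K) ≫ M ◁ i ≫ (α_ M N P).inv := by
        rw [whisker_exchange]
        simp only [Category.assoc]
    _ = i' ≫ M ◁ (v ≫ i) ≫ (α_ M N P).inv := by
        rw [h]
        bicategory
    _ = _ := by
        rw [hv]
        bicategory

theorem assoc_inv_equalizes_inner (hi : YZ.l ≫ D.A ◁ i = i ≫ (Y.tens Z).l)
    (h : i' ≫ X.r ▷ K ≫ (α_ M D.A K).hom = i' ≫ M ◁ YZ.l) :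
    (i' ≫ M ◁ i ≫ (α_ M N P).inv) ≫ (X.r ▷ N ≫ (α_ M D.A N).hom) ▷ P =
      (i' ≫ M ◁ i ≫ (α_ M N P).inv) ≫ (M ◁ Y.l) ▷ P := by
  rw [tens_l] at hi
  calc _ = i' ≫ (M ◁ i ≫ X.r ▷ (N ≫ P)) ≫ (α_ _ _ _).inv ≫ (α_ M D.A N).hom ▷ P := by bicategory
    _ = (i' ≫ X.r ▷ K ≫ (α_ M D.A K).hom) ≫ M ◁ D.A ◁ i ≫ M ◁ (α_ _ _ _).inv ≫
          (α_ _ _ _).inv := by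
        rw [whisker_exchange]
        bicategory
    _ = i' ≫ M ◁ (YZ.l ≫ D.A ◁ i) ≫ M ◁ (α_ _ _ _).inv ≫ (α_ _ _ _).inv := by
        rw [h]
        bicategory
    _ = _ := by
        rw [hi]
        bicategory

theorem assoc_inv_takeuchi_outer {u : N ⟶ N} {v : P ⟶ P} (h : i ≫ u ▷ P = i ≫ N ◁ v) :
    (i' ≫ M ◁ i ≫ (α_ M N P).inv) ≫ (M ◁ u) ▷ P =
      (i' ≫ M ◁ i ≫ (α_ M N P).inv) ≫ (M ≫ N) ◁ v := by
  calc _ = i' ≫ M ◁ (i ≫ u ▷ P) ≫ (α_ M N P).inv := by bicategory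
    _ = _ := by
        rw [h]
        bicategory

theorem assoc_inv_equalizes_outer (h : i ≫ Y.r ▷ P ≫ (α_ N E.A P).hom = i ≫ N ◁ Z.l) :
    (i' ≫ M ◁ i ≫ (α_ M N P).inv) ≫ (X.tens Y).r ▷ P ≫ (α_ (M ≫ N) E.A P).hom =
      (i' ≫ M ◁ i ≫ (α_ M N P).inv) ≫ (M ≫ N) ◁ Z.l := by
  rw [tens_r]
  calc _ = i' ≫ M ◁ (i ≫ Y.r ▷ P ≫ (α_ N E.A P).hom) ≫ (α_ _ _ _).inv := by bicategory
    _ = _ := by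
        rw [h]
        bicategory

end Right

/-! ### Descending equations to a subobject of one factor -/

section Cancel

/-- Once a map into `M ⊗ T` factors through `M ⊗ K`, the outer equation can be tested after the
monic inclusion. This is the second stage of each associativity map. -/
theorem takeuchi_of_whiskerLeft {T K : b ⟶ d} {i : K ⟶ T} [Mono (M ◁ i)] {f : Q ⟶ M ≫ T}
    {g : Q ⟶ M ≫ K} (hg : g ≫ M ◁ i = f) {u : M ⟶ M} {v : T ⟶ T} {v' : K ⟶ K}
    (hv : v' ≫ i = i ≫ v) (h : f ≫ u ▷ T = f ≫ M ◁ v) : g ≫ u ▷ K = g ≫ M ◁ v' := by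
  rw [← cancel_mono (M ◁ i), Category.assoc, Category.assoc, ← whisker_exchange, reassoc_of% hg, h,
    ← whiskerLeft_comp, hv, whiskerLeft_comp, reassoc_of% hg]

theorem equalizes_of_whiskerLeft {T K : b ⟶ d} {i : K ⟶ T} [Mono (M ◁ D.A ◁ i)]
    {f : Q ⟶ M ≫ T} {g : Q ⟶ M ≫ K} (hg : g ≫ M ◁ i = f) {s : T ⟶ D.A ≫ T} {s' : K ⟶ D.A ≫ K}
    (hs : s' ≫ D.A ◁ i = i ≫ s) (h : f ≫ X.r ▷ T ≫ (α_ M D.A T).hom = f ≫ M ◁ s) :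
    g ≫ X.r ▷ K ≫ (α_ M D.A K).hom = g ≫ M ◁ s' := by
  rw [← cancel_mono (M ◁ D.A ◁ i)]
  calc _ = g ≫ (X.r ▷ K ≫ (M ≫ D.A) ◁ i) ≫ (α_ M D.A T).hom := by bicategory
    _ = (g ≫ M ◁ i) ≫ X.r ▷ T ≫ (α_ M D.A T).hom := by
        rw [← whisker_exchange]
        simp only [Category.assoc]
    _ = g ≫ M ◁ (i ≫ s) := by
        rw [hg, h, ← hg]
        bicategory
    _ = _ := by
        rw [← hs]
        bicategory

theorem takeuchi_of_whiskerRight {T K : a ⟶ c} {i : K ⟶ T} [Mono (i ▷ P)] {f : Q ⟶ T ≫ P}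
    {g : Q ⟶ K ≫ P} (hg : g ≫ i ▷ P = f) {u : T ⟶ T} {u' : K ⟶ K} {v : P ⟶ P}
    (hu : u' ≫ i = i ≫ u) (h : f ≫ u ▷ P = f ≫ T ◁ v) : g ≫ u' ▷ P = g ≫ K ◁ v := by
  rw [← cancel_mono (i ▷ P), Category.assoc, Category.assoc, whisker_exchange, reassoc_of% hg, ← h,
    ← comp_whiskerRight, hu, comp_whiskerRight, reassoc_of% hg]

theorem equalizes_of_whiskerRight {T K : a ⟶ c} {i : K ⟶ T} [Mono (i ▷ (E.A ≫ P))]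
    {f : Q ⟶ T ≫ P} {g : Q ⟶ K ≫ P} (hg : g ≫ i ▷ P = f) {s : T ⟶ T ≫ E.A} {s' : K ⟶ K ≫ E.A}
    (hs : s' ≫ i ▷ E.A = i ≫ s) (h : f ≫ s ▷ P ≫ (α_ T E.A P).hom = f ≫ T ◁ Z.l) :
    g ≫ s' ▷ P ≫ (α_ K E.A P).hom = g ≫ K ◁ Z.l := by
  rw [← cancel_mono (i ▷ (E.A ≫ P))]
  calc _ = g ≫ (s' ≫ i ▷ E.A) ▷ P ≫ (α_ T E.A P).hom := by bicategory
    _ = (g ≫ i ▷ P) ≫ s ▷ P ≫ (α_ T E.A P).hom := by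
        rw [hs]
        bicategory
    _ = _ := by
        rw [hg, h, ← hg, Category.assoc, Category.assoc, whisker_exchange]

end Cancel

end Bicoaction

end

/-! ### Comodule homomorphisms as 2-cells -/

section

variable {k : Type w} [CommRing k]

section

variable {𝒜 ℬ 𝒞 𝒟 : Coalgebroid.{w, u} k}

/-- A 2-cell that commutes with the coactions and with the actions by `lo` and `lt`. -/
structure IsQHom (M M' : QBim k 𝒜.R ℬ.R) (X : Bicoaction 𝒜.coring ℬ.coring M.cell)
    (X' : Bicoaction 𝒜.coring ℬ.coring M'.cell) (f : M.cell ⟶ M'.cell) : Prop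
    extends Bicoaction.IsHom X X' f where
  lo : ∀ p, M.lo₂ p ≫ f = f ≫ M'.lo₂ p
  lt : ∀ q, M.lt₂ q ≫ f = f ≫ M'.lt₂ q

namespace IsQHom

variable {M M' M'' : QBim k 𝒜.R ℬ.R} {X : Bicoaction 𝒜.coring ℬ.coring M.cell}
  {X' : Bicoaction 𝒜.coring ℬ.coring M'.cell} {X'' : Bicoaction 𝒜.coring ℬ.coring M''.cell}
  {N N' : QBim k ℬ.R 𝒞.R} {Y : Bicoaction ℬ.coring 𝒞.coring N.cell}
  {Y' : Bicoaction ℬ.coring 𝒞.coring N'.cell}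
  {P : QBim k 𝒞.R 𝒟.R} {Z : Bicoaction 𝒞.coring 𝒟.coring P.cell}

theorem comp {f : M.cell ⟶ M'.cell} {g : M'.cell ⟶ M''.cell} (hf : IsQHom M M' X X' f)
    (hg : IsQHom M' M'' X' X'' g) : IsQHom M M'' X X'' (f ≫ g) where
  toIsHom := hf.toIsHom.comp hg.toIsHom
  lo p := by rw [reassoc_of% hf.lo p, hg.lo, Category.assoc]
  lt q := by rw [reassoc_of% hf.lt q, hg.lt, Category.assoc]

theorem of_comp {f : M.cell ⟶ M'.cell} {j : M'.cell ⟶ M''.cell} {g : M.cell ⟶ M''.cell}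
    (hj : IsQHom M' M'' X' X'' j)
    (h1 : Mono j) (h2 : Mono (𝒜.coring.A ◁ j)) (h3 : Mono (j ▷ ℬ.coring.A))
    (hg : f ≫ j = g) (hf : IsQHom M M'' X X'' g) : IsQHom M M' X X' f := by
  subst hg
  refine ⟨hj.toIsHom.of_comp hf.toIsHom, fun p => ?_, fun q => ?_⟩
  · rw [← cancel_mono j, Category.assoc, hf.lo, Category.assoc, Category.assoc, hj.lo]
  · rw [← cancel_mono j, Category.assoc, hf.lt, Category.assoc, Category.assoc, hj.lt]

theorem inv {f : M.cell ≅ M'.cell} (hf : IsQHom M M' X X' f.hom) : IsQHom M' M X' X f.inv where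
  toIsHom := hf.toIsHom.inv
  lo p := by rw [← cancel_epi f.hom, ← reassoc_of% hf.lo p]; simp
  lt p := by rw [← cancel_epi f.hom, ← reassoc_of% hf.lt p]; simp

theorem whiskerRight {f : M.cell ⟶ M'.cell} (hf : IsQHom M M' X X' f)
    (Y : Bicoaction ℬ.coring 𝒞.coring N.cell) :
    IsQHom (M.tens N) (M'.tens N) (tensBicoaction X Y) (tensBicoaction X' Y) (f ▷ N.cell) where
  toIsHom := hf.toIsHom.whiskerRight Y
  lo p := by
    rw [QBim.tens_lo₂, QBim.tens_lo₂]
    exact (comp_whiskerRight _ _ _).symm.trans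
      ((congrArg (· ▷ N.cell) (hf.lo p)).trans (comp_whiskerRight _ _ _))
  lt q := by
    rw [QBim.tens_lt₂, QBim.tens_lt₂]
    exact whisker_exchange _ _

theorem whiskerLeft (X : Bicoaction 𝒜.coring ℬ.coring M.cell) {f : N.cell ⟶ N'.cell}
    (hf : IsQHom N N' Y Y' f) :
    IsQHom (M.tens N) (M.tens N') (tensBicoaction X Y) (tensBicoaction X Y') (M.cell ◁ f) where
  toIsHom := hf.toIsHom.whiskerLeft X
  lo p := by
    rw [QBim.tens_lo₂, QBim.tens_lo₂]
    exact (whisker_exchange _ _).symm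
  lt q := by
    rw [QBim.tens_lt₂, QBim.tens_lt₂]
    exact (whiskerLeft_comp _ _ _).symm.trans
      ((congrArg (M.cell ◁ ·) (hf.lt q)).trans (whiskerLeft_comp _ _ _))

theorem associator (X : Bicoaction 𝒜.coring ℬ.coring M.cell)
    (Y : Bicoaction ℬ.coring 𝒞.coring N.cell) (Z : Bicoaction 𝒞.coring 𝒟.coring P.cell) :
    IsQHom ((M.tens N).tens P) (M.tens (N.tens P)) (tensBicoaction (tensBicoaction X Y) Z)
      (tensBicoaction X (tensBicoaction Y Z)) (α_ M.cell N.cell P.cell).hom where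
  toIsHom := Bicoaction.isHom_associator X Y Z
  lo p := by
    rw [QBim.tens_lo₂, QBim.tens_lo₂, QBim.tens_lo₂]
    exact associator_naturality_left (M.lo₂ p) N.cell P.cell
  lt q := by
    rw [QBim.tens_lt₂, QBim.tens_lt₂, QBim.tens_lt₂]
    exact associator_naturality_right M.cell N.cell (P.lt₂ q)

theorem left (h : Compatible M X) :
    IsQHom M (𝒜.A.tens M) X (tensBicoaction (Bicoaction.regular 𝒜.coring) X) X.l where
  toIsHom := Bicoaction.isHom_l X
  lo p := by
    rw [QBim.tens_lo₂]
    exact h.lo_l p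
  lt p := by
    rw [QBim.tens_lt₂]
    exact h.lt_l p

theorem right (h : Compatible M X) :
    IsQHom M (M.tens ℬ.A) X (tensBicoaction X (Bicoaction.regular ℬ.coring)) X.r where
  toIsHom := Bicoaction.isHom_r X
  lo p := by
    rw [QBim.tens_lo₂]
    exact h.lo_r p
  lt p := by
    rw [QBim.tens_lt₂]
    exact h.lt_r p

end IsQHom

/-- The round trip matters because composites and units are built from bicoactions, whereas comodule
homomorphisms refer to the bicoaction extracted from the comodule. -/
theorem Bicoaction.toComodule_bicoaction {M : QBim k 𝒜.R ℬ.R}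
    (X : Bicoaction 𝒜.coring ℬ.coring M.cell) (h : Compatible M X) :
    (X.toComodule h).bicoaction = X :=
  Bicoaction.ext ((X.toComodule h).bicoaction_l.trans (X.toComodule_left h))
    ((X.toComodule h).bicoaction_r.trans (X.toComodule_right h))

end

namespace HComodule

variable {𝒜 ℬ 𝒞 𝒟 : HCoalgebroid.{w, u} k} {M M' : HComodule 𝒜 ℬ} {N N' : HComodule ℬ 𝒞}
  {P : HComodule 𝒞 𝒟}

/-- The 2-cell underlying a homomorphism of comodules. -/
def forget : HComodule 𝒜 ℬ ⥤ (𝒜.base ⟶ ℬ.base) where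
  obj M := M.cell
  map f := bimHom f

instance : (forget (𝒜 := 𝒜) (ℬ := ℬ)).Faithful where
  map_injective {_ _ f g} h :=
    Comodule.Hom.ext (congrArg Bim.Hom.lin h : (bimHom f).lin = (bimHom g).lin)

/-- A 2-cell that is a homomorphism of comodules. -/
abbrev IsHom (M M' : HComodule 𝒜 ℬ) (f : M.cell ⟶ M'.cell) : Prop :=
  IsQHom M.M M'.M M.bic M'.bic f

/-- Commutation with the two-sided coaction yields both one-sided laws by contraction; `homMk` goes
the other way. Comodule homomorphisms can therefore be handled through one-sided coactions only. -/
theorem isHom_map (f : M ⟶ M') : IsHom M M' (forget.map f) := by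
  have h : M.bic.coact ≫ 𝒜.coring.A ◁ (forget.map f ▷ ℬ.coring.A) =
      forget.map f ≫ M'.bic.coact := by
    have h := Comodule.Hom.coact_comm f
    have e1 : M.bic.coact = M.coact₂ := M.toComodule.bicoaction_coact
    have e2 : M'.bic.coact = M'.coact₂ := M'.toComodule.bicoaction_coact
    rw [e1, e2]
    exact h
  exact ⟨⟨Bicoaction.l_comm h, Bicoaction.r_comm h⟩,
    fun p => (Comodule.Hom.toQHom f).loHom_comp p, fun p => (Comodule.Hom.toQHom f).ltHom_comp p⟩

/-- The homomorphism of comodules given by a 2-cell. -/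
def homMk (f : M.cell ⟶ M'.cell) (hf : IsHom M M' f) : M ⟶ M' :=
  show M.toComodule.Hom M'.toComodule from
  { toQHom := QBim.homMk f hf.lo hf.lt
    coact_comm := by
      have h : M.bic.coact ≫ 𝒜.coring.A ◁ (f ▷ ℬ.coring.A) = f ≫ M'.bic.coact :=
        Bicoaction.coact_comm hf.l hf.r
      have e1 : M.bic.coact = M.coact₂ := M.toComodule.bicoaction_coact
      have e2 : M'.bic.coact = M'.coact₂ := M'.toComodule.bicoaction_coact
      rw [e1, e2] at h
      exact h }

/-- The isomorphism of comodules given by an invertible 2-cell. -/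
def isoMk (f : M.cell ≅ M'.cell) (hf : IsHom M M' f.hom) : M ≅ M' where
  hom := homMk f.hom hf
  inv := homMk f.inv hf.inv
  hom_inv_id := forget.map_injective f.hom_inv_id
  inv_hom_id := forget.map_injective f.inv_hom_id

variable (M N)

/-- The inclusion of the composite into the tensor product. -/
def ι : (M.comp N).cell ⟶ M.cell ≫ N.cell := M.inclBullet N

theorem ι_injective : Function.Injective (Bim.Hom.lin (M.ι N)) := M.inclBullet_injective N

instance : Mono (M.ι N) := mono_of_injective _ (M.ι_injective N)

theorem bic_comp : (M.comp N).bic = M.bulletBicoaction N :=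
  Bicoaction.toComodule_bicoaction _ (M.compatible_bulletBicoaction N)

theorem bic_unit (𝒜 : HCoalgebroid.{w, u} k) : 𝒜.unit.bic = Bicoaction.regular 𝒜.coring :=
  Bicoaction.toComodule_bicoaction _ 𝒜.compatible_regular

theorem isQHom_ι :
    IsQHom (M.comp N).M (M.M.tens N.M) (M.comp N).bic (tensBicoaction M.bic N.bic) (M.ι N) where
  toIsHom := by
    rw [bic_comp]
    exact M.isHom_bulletBicoaction N
  lo p := (bulletIncl _ _).loHom_comp p
  lt p := (bulletIncl _ _).ltHom_comp p

theorem ι_takeuchi (s) : M.ι N ≫ M.M.lt₂ s ▷ N.cell = M.ι N ≫ M.cell ◁ N.M.lo₂ (op s) :=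
  bulletι_takeuchi _ _ s

theorem ι_equalizes : M.ι N ≫ M.bic.r ▷ N.cell ≫ (α_ M.cell ℬ.coring.A N.cell).hom =
    M.ι N ≫ M.cell ◁ N.bic.l :=
  bulletι_equalizes _ _

theorem exists_lift {Z : 𝒜.base ⟶ 𝒞.base} (f : Z ⟶ M.cell ≫ N.cell)
    (ht : ∀ s, f ≫ M.M.lt₂ s ▷ N.cell = f ≫ M.cell ◁ N.M.lo₂ (op s))
    (he : f ≫ M.bic.r ▷ N.cell ≫ (α_ M.cell ℬ.coring.A N.cell).hom = f ≫ M.cell ◁ N.bic.l) :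
    ∃ g : Z ⟶ (M.comp N).cell, g ≫ M.ι N = f :=
  bullet_lift _ _ f ht he

theorem isHom_of_comp_ι {L : HComodule 𝒜 𝒞} {g : L.cell ⟶ (M.comp N).cell}
    {f : L.cell ⟶ M.cell ≫ N.cell} (hg : g ≫ M.ι N = f)
    (hf : IsQHom L.M (M.M.tens N.M) L.bic (tensBicoaction M.bic N.bic) f) :
    IsHom L (M.comp N) g :=
  (M.isQHom_ι N).of_comp (mono_of_injective _ (M.ι_injective N))
    (M.mono_whiskerLeft N _ 𝒜.union) (M.mono_whiskerRight N _ 𝒞.union) hg hf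

/-- A homomorphism into the composite given by one into the tensor product. -/
theorem exists_hom {L : HComodule 𝒜 𝒞} (f : L.cell ⟶ M.cell ≫ N.cell)
    (hf : IsQHom L.M (M.M.tens N.M) L.bic (tensBicoaction M.bic N.bic) f)
    (ht : ∀ s, f ≫ M.M.lt₂ s ▷ N.cell = f ≫ M.cell ◁ N.M.lo₂ (op s))
    (he : f ≫ M.bic.r ▷ N.cell ≫ (α_ M.cell ℬ.coring.A N.cell).hom = f ≫ M.cell ◁ N.bic.l) :
    ∃ g : L ⟶ M.comp N, forget.map g ≫ M.ι N = f := by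
  obtain ⟨g, hg⟩ := M.exists_lift N f ht he
  exact ⟨homMk g (M.isHom_of_comp_ι N hg hf), hg⟩

variable {M N}

theorem exists_whiskerRight (f : M ⟶ M') (N : HComodule ℬ 𝒞) :
    ∃ g : M.comp N ⟶ M'.comp N, forget.map g ≫ M'.ι N = M.ι N ≫ forget.map f ▷ N.cell :=
  M'.exists_hom N _ ((M.isQHom_ι N).comp ((isHom_map f).whiskerRight N.bic))
    (fun s => Bicoaction.whiskerRight_takeuchi ((isHom_map f).lt s) (M.ι_takeuchi N s))
    (Bicoaction.whiskerRight_equalizes (isHom_map f).toIsHom (M.ι_equalizes N))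

theorem exists_whiskerLeft (M : HComodule 𝒜 ℬ) (f : N ⟶ N') :
    ∃ g : M.comp N ⟶ M.comp N', forget.map g ≫ M.ι N' = M.ι N ≫ M.cell ◁ forget.map f :=
  M.exists_hom N' _ ((M.isQHom_ι N).comp ((isHom_map f).whiskerLeft M.bic))
    (fun s => Bicoaction.whiskerLeft_takeuchi ((isHom_map f).lo _) (M.ι_takeuchi N s))
    (Bicoaction.whiskerLeft_equalizes (isHom_map f).toIsHom (M.ι_equalizes N))

end HComodule

end

/-! ### The bicategory of comodules -/

section

variable {k : Type w} [CommRing k]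

namespace HComodule

variable {𝒜 ℬ 𝒞 𝒟 : HCoalgebroid.{w, u} k}

/-! ### The unit isomorphisms -/

section Unitors

variable (M : HComodule 𝒜 ℬ)

/-- The Takeuchi equation for the left coaction is part of compatibility, and its cotensor equation
against the regular comodule is exactly coassociativity. -/
theorem exists_lift_left :
    ∃ g : M.cell ⟶ (𝒜.unit.comp M).cell, g ≫ 𝒜.unit.ι M = M.bic.l := by
  refine 𝒜.unit.exists_lift M M.bic.l (fun s => M.compatible.takeuchi_l s) ?_
  rw [bic_unit]
  exact M.bic.l_coassoc

theorem exists_lift_right :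
    ∃ g : M.cell ⟶ (M.comp ℬ.unit).cell, g ≫ M.ι ℬ.unit = M.bic.r := by
  refine M.exists_lift ℬ.unit M.bic.r (fun s => M.compatible.takeuchi_r s) ?_
  rw [bic_unit]
  exact M.bic.r_coassoc

theorem ι_unit_left_equalizes :
    𝒜.unit.ι M ≫ 𝒜.coring.comul ▷ M.cell ≫ (α_ 𝒜.coring.A 𝒜.coring.A M.cell).hom =
      𝒜.unit.ι M ≫ 𝒜.coring.A ◁ M.bic.l := by
  have h := 𝒜.unit.ι_equalizes M
  rw [bic_unit] at h
  exact h

theorem ι_unit_right_equalizes :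
    M.ι ℬ.unit ≫ M.bic.r ▷ ℬ.coring.A ≫ (α_ M.cell ℬ.coring.A ℬ.coring.A).hom =
      M.ι ℬ.unit ≫ M.cell ◁ ℬ.coring.comul := by
  have h := M.ι_equalizes ℬ.unit
  rw [bic_unit] at h
  exact h

/-- The counit of a coalgebroid, as a 2-cell. -/
def counit₂ (𝒜 : HCoalgebroid.{w, u} k) : 𝒜.unit.cell ⟶ 𝟙 𝒜.base := 𝒜.coring.counit

theorem left_unitor_inv :
    (𝒜.unit.ι M ≫ counit₂ 𝒜 ▷ M.cell ≫ (λ_ M.cell).hom) ≫ M.bic.l = 𝒜.unit.ι M :=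
  Bicoaction.regular_tens_inv (ι_unit_left_equalizes M)

theorem right_unitor_inv :
    (M.ι ℬ.unit ≫ M.cell ◁ counit₂ ℬ ≫ (ρ_ M.cell).hom) ≫ M.bic.r = M.ι ℬ.unit :=
  Bicoaction.tens_regular_inv (ι_unit_right_equalizes M)

/-- The left coaction, as an isomorphism. -/
noncomputable def leftIso : M.cell ≅ (𝒜.unit.comp M).cell where
  hom := M.exists_lift_left.choose
  inv := 𝒜.unit.ι M ≫ counit₂ 𝒜 ▷ M.cell ≫ (λ_ M.cell).hom
  hom_inv_id := by
    rw [reassoc_of% M.exists_lift_left.choose_spec]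
    exact M.bic.l_counit
  inv_hom_id := by
    rw [← cancel_mono (𝒜.unit.ι M), Category.assoc, M.exists_lift_left.choose_spec]
    exact M.left_unitor_inv.trans (Category.id_comp _).symm

/-- The right coaction, as an isomorphism. -/
noncomputable def rightIso : M.cell ≅ (M.comp ℬ.unit).cell where
  hom := M.exists_lift_right.choose
  inv := M.ι ℬ.unit ≫ M.cell ◁ counit₂ ℬ ≫ (ρ_ M.cell).hom
  hom_inv_id := by
    rw [reassoc_of% M.exists_lift_right.choose_spec]
    exact M.bic.r_counit
  inv_hom_id := by
    rw [← cancel_mono (M.ι ℬ.unit), Category.assoc, M.exists_lift_right.choose_spec]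
    exact M.right_unitor_inv.trans (Category.id_comp _).symm

theorem leftIso_hom : M.leftIso.hom ≫ 𝒜.unit.ι M = M.bic.l := M.exists_lift_left.choose_spec

theorem rightIso_hom : M.rightIso.hom ≫ M.ι ℬ.unit = M.bic.r := M.exists_lift_right.choose_spec

theorem isHom_leftIso : IsHom M (𝒜.unit.comp M) M.leftIso.hom := by
  refine isHom_of_comp_ι 𝒜.unit M M.leftIso_hom ?_
  rw [bic_unit]
  exact IsQHom.left M.compatible

theorem isHom_rightIso : IsHom M (M.comp ℬ.unit) M.rightIso.hom := by
  refine isHom_of_comp_ι M ℬ.unit M.rightIso_hom ?_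
  rw [bic_unit]
  exact IsQHom.right M.compatible

end Unitors

/-! ### The associativity isomorphism -/

section Associator

variable (M : HComodule 𝒜 ℬ) (N : HComodule ℬ 𝒞) (P : HComodule 𝒞 𝒟)

/-- The inclusion of `(M • N) • P` into `(M ⊗ N) ⊗ P`. -/
noncomputable def ιLeft : ((M.comp N).comp P).cell ⟶ (M.cell ≫ N.cell) ≫ P.cell :=
  (M.comp N).ι P ≫ M.ι N ▷ P.cell

/-- The inclusion of `M • (N • P)` into `M ⊗ (N ⊗ P)`. -/
noncomputable def ιRight : (M.comp (N.comp P)).cell ⟶ M.cell ≫ N.cell ≫ P.cell :=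
  M.ι (N.comp P) ≫ M.cell ◁ N.ι P

theorem ιLeft_injective : Function.Injective (Bim.Hom.lin (ιLeft M N P)) := by
  have h : Function.Injective (Bim.Hom.lin (M.ι N ▷ P.cell)) :=
    Bim.id_tens_injective P.union.leftProj _ (M.ι_injective N)
  exact h.comp ((M.comp N).ι_injective P)

theorem ιRight_injective : Function.Injective (Bim.Hom.lin (ιRight M N P)) := by
  have h : Function.Injective (Bim.Hom.lin (M.cell ◁ N.ι P)) :=
    Bim.tens_id_injective M.union.rightProj _ (N.ι_injective P)
  exact h.comp (M.ι_injective (N.comp P))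

theorem isQHom_ιLeft : IsQHom ((M.comp N).comp P).M ((M.M.tens N.M).tens P.M)
    ((M.comp N).comp P).bic (tensBicoaction (tensBicoaction M.bic N.bic) P.bic) (ιLeft M N P) :=
  ((M.comp N).isQHom_ι P).comp ((M.isQHom_ι N).whiskerRight P.bic)

theorem isQHom_ιRight : IsQHom (M.comp (N.comp P)).M (M.M.tens (N.M.tens P.M))
    (M.comp (N.comp P)).bic (tensBicoaction M.bic (tensBicoaction N.bic P.bic)) (ιRight M N P) :=
  (M.isQHom_ι (N.comp P)).comp ((N.isQHom_ι P).whiskerLeft M.bic)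

/-- Two stages. The inner equations place `(M • N) • P` in `M ⊗ (N • P)`, which uses that tensoring
with `M` preserves the joint equalizer; the outer equations then place it in `M • (N • P)`. -/
theorem exists_assoc_hom : ∃ g : ((M.comp N).comp P).cell ⟶ (M.comp (N.comp P)).cell,
    g ≫ ιRight M N P = ιLeft M N P ≫ (α_ M.cell N.cell P.cell).hom := by
  obtain ⟨g, hg⟩ : ∃ g : ((M.comp N).comp P).cell ⟶ M.cell ≫ (N.comp P).cell,
      g ≫ M.cell ◁ N.ι P = (M.comp N).ι P ≫ M.ι N ▷ P.cell ≫ (α_ M.cell N.cell P.cell).hom :=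
    bullet_liftLeft N.toComodule P.toComodule (W := M.cell) M.union.rightProj
    (N.union_tens P).leftProj (N.union_tens₃ P).leftProj
    ((M.comp N).ι P ≫ M.ι N ▷ P.cell ≫ (α_ M.cell N.cell P.cell).hom)
    (fun s => Bicoaction.assoc_takeuchi_inner
      (((M.isQHom_ι N).lt s).trans (congrArg (M.ι N ≫ ·) (QBim.tens_lt₂ M.M N.M s)))
      ((M.comp N).ι_takeuchi P s))
    (Bicoaction.assoc_equalizes_inner (M.isQHom_ι N).r ((M.comp N).ι_equalizes P))
  have m1 : Mono (M.cell ◁ N.ι P) := N.mono_whiskerLeft P _ M.union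
  have m2 : Mono (M.cell ◁ ℬ.coring.A ◁ N.ι P) := Coalgebroids.mono_whiskerLeft M.union.rightProj _
    (Bim.tens_id_injective ℬ.union.rightProj _ (N.ι_injective P))
  -- The outer equations are known only in `M ⊗ N ⊗ P`. The monomorphisms `m1` and `m2` pull them
  -- back to equations over `N • P`.
  obtain ⟨h, hh⟩ := M.exists_lift (N.comp P) g
    (fun s => Bicoaction.takeuchi_of_whiskerLeft hg
      (((N.isQHom_ι P).lo _).trans (congrArg (N.ι P ≫ ·) (QBim.tens_lo₂ N.M P.M (op s))))
      (Bicoaction.assoc_takeuchi_outer (M.ι_takeuchi N s)))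
    (Bicoaction.equalizes_of_whiskerLeft hg (N.isQHom_ι P).l
      (Bicoaction.assoc_equalizes_outer (M.ι_equalizes N)))
  refine ⟨h, ?_⟩
  rw [ιRight, reassoc_of% hh, hg, ιLeft, Category.assoc]

theorem exists_assoc_inv : ∃ g : (M.comp (N.comp P)).cell ⟶ ((M.comp N).comp P).cell,
    g ≫ ιLeft M N P = ιRight M N P ≫ (α_ M.cell N.cell P.cell).inv := by
  obtain ⟨g, hg⟩ : ∃ g : (M.comp (N.comp P)).cell ⟶ (M.comp N).cell ≫ P.cell,
      g ≫ M.ι N ▷ P.cell =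
        M.ι (N.comp P) ≫ M.cell ◁ N.ι P ≫ (α_ M.cell N.cell P.cell).inv :=
    bullet_liftRight M.toComodule N.toComodule (W := P.cell) P.union.leftProj
    (M.union_tens N).rightProj (M.union_tens₃ N).rightProj
    (M.ι (N.comp P) ≫ M.cell ◁ N.ι P ≫ (α_ M.cell N.cell P.cell).inv)
    (fun s => Bicoaction.assoc_inv_takeuchi_inner
      (((N.isQHom_ι P).lo _).trans (congrArg (N.ι P ≫ ·) (QBim.tens_lo₂ N.M P.M (op s))))
      (M.ι_takeuchi (N.comp P) s))
    (Bicoaction.assoc_inv_equalizes_inner (N.isQHom_ι P).l (M.ι_equalizes (N.comp P)))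
  have m1 : Mono (M.ι N ▷ P.cell) := M.mono_whiskerRight N _ P.union
  have m2 : Mono (M.ι N ▷ (𝒞.coring.A ≫ P.cell)) := M.mono_whiskerRight N _
    (Bim.UnionOfProjectives.tens 𝒞.hereditary 𝒟.hereditary 𝒞.union P.union)
  obtain ⟨h, hh⟩ := (M.comp N).exists_lift P g
    (fun s => Bicoaction.takeuchi_of_whiskerRight hg
      (((M.isQHom_ι N).lt s).trans (congrArg (M.ι N ≫ ·) (QBim.tens_lt₂ M.M N.M s)))
      (Bicoaction.assoc_inv_takeuchi_outer (N.ι_takeuchi P s)))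
    (Bicoaction.equalizes_of_whiskerRight hg (M.isQHom_ι N).r
      (Bicoaction.assoc_inv_equalizes_outer (N.ι_equalizes P)))
  refine ⟨h, ?_⟩
  rw [ιLeft, reassoc_of% hh, hg, ιRight, Category.assoc]

/-- The associativity isomorphism. -/
noncomputable def assocIso : ((M.comp N).comp P).cell ≅ (M.comp (N.comp P)).cell where
  hom := (exists_assoc_hom M N P).choose
  inv := (exists_assoc_inv M N P).choose
  hom_inv_id := by
    have := mono_of_injective _ (ιLeft_injective M N P)
    rw [← cancel_mono (ιLeft M N P), Category.assoc, (exists_assoc_inv M N P).choose_spec,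
      reassoc_of% (exists_assoc_hom M N P).choose_spec, Iso.hom_inv_id, Category.comp_id,
      Category.id_comp]
  inv_hom_id := by
    have := mono_of_injective _ (ιRight_injective M N P)
    rw [← cancel_mono (ιRight M N P), Category.assoc, (exists_assoc_hom M N P).choose_spec,
      reassoc_of% (exists_assoc_inv M N P).choose_spec, Iso.inv_hom_id, Category.comp_id,
      Category.id_comp]

theorem assocIso_hom :
    (HComodule.assocIso M N P).hom ≫ ιRight M N P = ιLeft M N P ≫ (α_ M.cell N.cell P.cell).hom :=
  (exists_assoc_hom M N P).choose_spec

/-- Colinearity is tested in the triple tensor product, where the ambient associator is already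
colinear and compatible with `lo` and `lt`. -/
theorem isHom_assocIso :
    IsHom ((M.comp N).comp P) (M.comp (N.comp P)) (HComodule.assocIso M N P).hom :=
  (isQHom_ιRight M N P).of_comp (mono_of_injective _ (ιRight_injective M N P))
    (Coalgebroids.mono_whiskerLeft 𝒜.union.rightProj _ (ιRight_injective M N P))
    (Coalgebroids.mono_whiskerRight 𝒟.union.leftProj _ (ιRight_injective M N P))
    (assocIso_hom M N P) ((isQHom_ιLeft M N P).comp (IsQHom.associator M.bic N.bic P.bic))

end Associator

/-- The composition of comodules, inside the bicategory of bimodules. -/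
noncomputable def subComposition (k : Type w) [CommRing k] :
    SubComposition (B := AlgObj.{w, u} k) (fun 𝒜 : HCoalgebroid.{w, u} k => 𝒜.base) HComodule where
  U := forget
  faithful := inferInstance
  comp := HComodule.comp
  one := HCoalgebroid.unit
  ι := HComodule.ι
  e := counit₂
  mono₁ M N := mono_of_injective _ (M.ι_injective N)
  mono₂ M N P := N.mono_whiskerLeft P _ M.union
  mono₃ M N P Q := Coalgebroids.mono_whiskerLeft M.union.rightProj _
    (Bim.tens_id_injective N.union.rightProj _ (P.ι_injective Q))
  wl M _ _ g := (exists_whiskerLeft M g).choose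
  wl_ι M _ _ g := (exists_whiskerLeft M g).choose_spec
  wr f N := (exists_whiskerRight f N).choose
  wr_ι f N := (exists_whiskerRight f N).choose_spec
  assoc M N P := isoMk (HComodule.assocIso M N P) (isHom_assocIso M N P)
  assoc_ι M N P := (assocIso_hom M N P).trans (Category.assoc _ _ _)
  lu M := (isoMk M.leftIso M.isHom_leftIso).symm
  lu_ι _ := rfl
  ru M := (isoMk M.rightIso M.isHom_rightIso).symm
  ru_ι _ := rfl

/-- The inclusion of `M • N`, as a homomorphism of bimodules over `Rᵐᵒᵖ ⊗ S`. -/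
def qι (M : HComodule 𝒜 ℬ) (N : HComodule ℬ 𝒞) : (M.comp N).M.Hom (M.M.tens N.M) :=
  bulletIncl M.toComodule N.toComodule

theorem ι_coact (M : HComodule 𝒜 ℬ) (N : HComodule ℬ 𝒞) :
    ((M.comp N).coact₂ ≫ 𝒜.coring.A ◁ (M.ι N ▷ 𝒞.coring.A)) ≫
        𝒜.coring.A ◁ (α_ M.cell N.cell 𝒞.coring.A).hom =
      (M.ι N ≫ M.bic.l ▷ N.cell ≫ (𝒜.coring.A ≫ M.cell) ◁ N.bic.r) ≫
        (α_ 𝒜.coring.A M.cell (N.cell ≫ 𝒞.coring.A)).hom := by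
  have h : (M.comp N).bic.coact ≫ 𝒜.coring.A ◁ (M.ι N ▷ 𝒞.coring.A) =
      M.ι N ≫ (M.bic.tens N.bic).coact :=
    Bicoaction.coact_comm (M.isQHom_ι N).l (M.isQHom_ι N).r
  have e : (M.comp N).bic.coact = (M.comp N).coact₂ := (M.comp N).toComodule.bicoaction_coact
  rw [e] at h
  exact (congrArg (· ≫ 𝒜.coring.A ◁ (α_ M.cell N.cell 𝒞.coring.A).hom) h).trans
    (Bicoaction.comp_tens_coact _)

end HComodule

open HComodule in
theorem tens_coact_eq {𝒜 ℬ 𝒞 : HCoalgebroid.{w, u} k} (M : HComodule 𝒜 ℬ) (N : HComodule ℬ 𝒞) :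
    ((M.comp N).coact.ten3.comp ((Bim.Hom.id 𝒜.B).tens
        ((qι M N).toBimHom.tens (Bim.Hom.id 𝒞.B)))).comp
        ((Bim.Hom.id 𝒜.B).tens (assoc _ _ 𝒞.B)) =
      ((qι M N).toBimHom.comp (M.left.tens N.right)).comp (assoc 𝒜.B _ _) := by
  rw [Bim.tens_eq_comp M.left, ← M.toComodule.bicoaction_l, ← N.toComodule.bicoaction_r]
  exact ι_coact M N

theorem unit_coact_eq (𝒜 : HCoalgebroid.{w, u} k) :
    𝒜.unit.coact.ten3.comp
        ((Bim.Hom.id 𝒜.B).tens ((Bim.Hom.id 𝒜.B).tens (Bim.Hom.id 𝒜.B))) =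
      𝒜.comul.ten2.comp ((Bim.Hom.id 𝒜.B).tens 𝒜.comul.ten2) :=
  congrArg 𝒜.unit.coact.ten3.comp
    ((congrArg (Bim.Hom.id 𝒜.B).tens (Bim.Hom.id_tens_id 𝒜.B 𝒜.B)).trans
      (Bim.Hom.id_tens_id 𝒜.B (𝒜.B.tens 𝒜.B)))

/-- The bicategory of comodules. -/
noncomputable def bulletBicategory (k : Type w) [CommRing k] : BulletBicategory.{w, u} k where
  bicategory := (HComodule.subComposition k).bicategory
  -- The hom-categories are the comodule categories themselves, so the comparison functors are
  -- identities and the fields about 2-cells are the defining properties of `subComposition`.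
  cell _ _ := 𝟭 (HComodule _ _)
  cell_isEquivalence _ _ := inferInstanceAs (𝟭 (HComodule _ _)).IsEquivalence
  cell_bijective _ _ := Function.bijective_id
  unit 𝒜 := QBim.Hom.id 𝒜.A
  unit_bijective _ := Function.bijective_id
  unit_coact 𝒜 := unit_coact_eq 𝒜
  incl M N := HComodule.qι M N
  incl_injective M N := HComodule.ι_injective M N
  incl_range M N := Submodule.range_subtype _
  incl_coact M N := tens_coact_eq M N
  whiskerLeft_incl M _ _ g := (HComodule.subComposition k).wl_ι M g
  whiskerRight_incl f N := (HComodule.subComposition k).wr_ι f N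
  associator_incl M N P := (HComodule.subComposition k).assoc_ι M N P
  leftUnitor_incl M := by
    -- The left unitor is contraction with the counit, and following it by the left coaction returns
    -- the inclusion.
    have h := HComodule.left_unitor_inv M
    have e : M.bic.l = M.left := M.toComodule.bicoaction_l
    rw [e] at h
    exact h.trans (congrArg (HComodule.qι (HCoalgebroid.unit _) M).toBimHom.comp
      (Bim.Hom.id_tens_id (Coalgebroid.B _) M.M.toBim).symm)
  rightUnitor_incl M := by
    have h := HComodule.right_unitor_inv M
    have e : M.bic.r = M.right := M.toComodule.bicoaction_r
    rw [e] at h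
    exact h.trans (congrArg (HComodule.qι M (HCoalgebroid.unit _)).toBimHom.comp
      (Bim.Hom.id_tens_id M.M.toBim (Coalgebroid.B _)).symm)

end

end Coalgebroids

theorem theorem22 (k : Type w) [CommRing k] :
    Nonempty (Coalgebroids.BulletBicategory.{w, u} k) :=
  ⟨Coalgebroids.bulletBicategory k⟩
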